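/- Let $\mathbb H=\{z\in\mathbb C : \Im z>0\}$ and let $\overline{\mathbb H}$ be its closure in $\mathbb C$. Let $\kappa\in C^\infty(\mathbb R;\overline{\mathbb H})$ be an attenuation coefficient, that is: $\kappa\neq0$; every derivative of $\kappa$ is polynomially bounded; $\kappa(-\omega)=-\overline{\kappa(\omega)}$ for all $\omega\in\mathbb R$; and $\kappa$ has a continuation $\tilde\kappa\in C(\overline{\mathbb H};\overline{\mathbb H})$ with $\tilde\kappa|_{\mathbb R}=\kappa$ which is holomorphic on $\mathbb H$ and satisfies $|\tilde\kappa(z)|\le C(1+|z|)^N$ on $\overline{\mathbb H}$ for some constants $C>0$, $N\in\mathbb N$. Let $\mathcal A_\kappa$ be the operator on $\mathcal S'(\mathbb R\times\mathbb R^3)$ given by $\langle\mathcal A_\kappa u,\phi\otimes\psi\rangle=-\langle u,(\mathcal F^{-1}\kappa^2\mathcal F\phi)\otimes\psi\rangle$, where $\mathcal F\phi(\omega)=\frac1{\sqrt{2\pi}}\int\phi(t)e^{-i\omega t}\,dt$. For $h\in L^2(\mathbb R^3)$, real-valued with compact essential support, the solution of the attenuated wave equation is the distribution $p\in\mathcal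 S'(\mathbb R\times\mathbb R^3)$ with $\operatorname{supp}p\subset[0,\infty)\times\mathbb R^3$ and $$\langle\mathcal A_\kappa p,\vartheta\rangle-\langle\Delta p,\vartheta\rangle=-\int_{\mathbb R^3}h(x)\,\partial_t\vartheta(0,x)\,dx\quad\text{for all }\vartheta\in\mathcal S(\mathbb R\times\mathbb R^3),$$ where $\Delta$ acts in the space variable. For $c>0$, we say that the solution propagates with finite speed $c$ if, for every such $h$ and every $R>0$ with $\operatorname{supp}h\subset B_R(0)$, the solution $p$ satisfies $\operatorname{supp}p\subset\{(t,x) : |x|\le ct+R\}$; and that it propagates faster than with speed $c$ if this inclusion fails for some such $h$ and $R$. Let $c>0$. (i) If $\Im(\tilde\kappa(z)-\frac zc)\ge0$ for every $z\in\overline{\mathbb H}$, then the solution propagates with finite speed $c$. (ii) Suppose that there is a sequence $(z_\ell)$ in $\mathbb H$ such that $\Im z_\ell\ge\eta_1$ for all $\ell$ with some $\eta_1>0$, $|z_\ell|\to\infty$, and, for some $\delta>0$, $\Im(\tilde\kappa(z_\ell)-\frac{z_\ell}c)\le-\delta|z_\ell|$ for all $\ell$. Then the solution propagates faster than with speed $c$.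 -/

import Mathlib

open MeasureTheory Filter Topology
open scoped SchwartzMap LineDeriv

namespace AttenuatedWave

/-- Physical space `ℝ³` with the Euclidean norm. -/
abbrev Space3 : Type := EuclideanSpace ℝ (Fin 3)

/-- Space-time `ℝ × ℝ³`; the time of a point `q` is `q.fst`, its position is `q.snd`. -/
abbrev SpaceTime : Type := WithLp 2 (ℝ × Space3)

/-- The point of space-time with time `t` and position `x`. -/
abbrev mkST (t : ℝ) (x : Space3) : SpaceTime := WithLp.toLp 2 (t, x)

/-- `κt` is a holomorphic continuation of `κ` to the closed upper half plane: it is continuous on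
the closed upper half plane and holomorphic inside, extends `κ`, has values in the closed upper
half plane and is polynomially bounded. The values of `κt` off the closed upper half plane play no
role. -/
structure IsHolomorphicContinuation (κ : ℝ → ℂ) (κt : ℂ → ℂ) : Prop where
  continuousOn : ContinuousOn κt {z : ℂ | 0 ≤ z.im}
  differentiableOn : DifferentiableOn ℂ κt {z : ℂ | 0 < z.im}
  apply_ofReal : ∀ ω : ℝ, κt (ω : ℂ) = κ ω
  im_nonneg : ∀ z : ℂ, 0 ≤ z.im → 0 ≤ (κt z).im
  bound : ∃ (C : ℝ) (N : ℕ), ∀ z : ℂ, 0 ≤ z.im → ‖κt z‖ ≤ C * (1 + ‖z‖) ^ N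

/-- Attenuation coefficients. `Function.HasTemperateGrowth` says that `κ` is smooth and that each
of its derivatives is polynomially bounded. -/
structure IsAttenuationCoefficient (κ : ℝ → ℂ) : Prop where
  ne_zero : κ ≠ 0
  im_nonneg : ∀ ω : ℝ, 0 ≤ (κ ω).im
  hasTemperateGrowth : κ.HasTemperateGrowth
  exists_continuation : ∃ κt : ℂ → ℂ, IsHolomorphicContinuation κ κt
  symm : ∀ ω : ℝ, κ (-ω) = -(starRingEnd ℂ) (κ ω)

/-- The operator `F⁻¹ κ² F` acting in the time variable of a test function on space-time, where
`(F φ)(ω) = (2π)^(-1/2) ∫ φ(t) exp(-iωt) dt`. Mathlib's Fourier transform has the kernel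
`exp(-2πi⟨ξ, q⟩)`, so that `ω = 2π ξ.fst`; since the multiplier depends on the dual variable of
time only, the Fourier transform in space cancels. -/
noncomputable def timeMultiplier (κ : ℝ → ℂ) : 𝓢(SpaceTime, ℂ) →L[ℂ] 𝓢(SpaceTime, ℂ) :=
  SchwartzMap.fourierMultiplierCLM ℂ (fun ξ : SpaceTime => κ (2 * Real.pi * ξ.fst) ^ 2)

/-- The attenuation operator `A_κ` on tempered distributions on space-time:
`⟨A_κ u, ϑ⟩ = -⟨u, F⁻¹ κ² F ϑ⟩`, the Fourier transform being that in time. -/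
noncomputable def attenuationOp (κ : ℝ → ℂ) : 𝓢'(SpaceTime, ℂ) →L[ℂ] 𝓢'(SpaceTime, ℂ) :=
  -PointwiseConvergenceCLM.precomp ℂ (timeMultiplier κ)

theorem attenuationOp_apply_apply (κ : ℝ → ℂ) (u : 𝓢'(SpaceTime, ℂ)) (ϑ : 𝓢(SpaceTime, ℂ)) :
    attenuationOp κ u ϑ = -u (timeMultiplier κ ϑ) := rfl

/-- The symbol of the time multiplier has temperate growth, so that `timeMultiplier κ` is indeed
multiplication by the symbol on the Fourier side. -/
theorem IsAttenuationCoefficient.symbol_hasTemperateGrowth {κ : ℝ → ℂ}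
    (hκ : IsAttenuationCoefficient κ) :
    (fun ξ : SpaceTime => κ (2 * Real.pi * ξ.fst) ^ 2).HasTemperateGrowth := by
  have h1 : (fun ξ : SpaceTime => 2 * Real.pi * ξ.fst).HasTemperateGrowth :=
    ((2 * Real.pi) • WithLp.fstL 2 ℝ ℝ Space3).hasTemperateGrowth
  have h2 := hκ.hasTemperateGrowth.comp h1
  simp only [sq]
  exact h2.mul h2

theorem fourier_prod (Φ : SpaceTime → ℂ) (f : ℝ → ℂ) (g : Space3 → ℂ) (h : ∀ q, Φ q = f q.fst * g q.snd) (ξ : SpaceTime) :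
    FourierTransform.fourier Φ ξ = FourierTransform.fourier f ξ.fst * FourierTransform.fourier g ξ.snd := by
  simp only [Real.fourier_eq', smul_eq_mul]
  rw [← integral_prod_mul, ← Measure.volume_eq_prod,
    ← (WithLp.volume_preserving_ofLp (U := ℝ) (V := Space3)).integral_comp
      (MeasurableEquiv.toLp 2 (ℝ × Space3)).symm.measurableEmbedding]
  refine integral_congr_ae (Eventually.of_forall fun q => ?_)
  simp only [h, WithLp.prod_inner_apply]
  push_cast
  rw [show ∀ a b : ℂ, -2*Real.pi*(a+b)*Complex.I = -2*Real.pi*a*Complex.I + -2*Real.pi*b*Complex.I by intros; ring, Complex.exp_add]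
  simp
  ring

theorem fourierInv_prod (Φ : SpaceTime → ℂ) (f : ℝ → ℂ) (g : Space3 → ℂ) (h : ∀ q, Φ q = f q.fst * g q.snd) (ξ : SpaceTime) :
    FourierTransformInv.fourierInv Φ ξ = FourierTransformInv.fourierInv f ξ.fst * FourierTransformInv.fourierInv g ξ.snd := by
  rw [Real.fourierInv_eq_fourier_neg, Real.fourierInv_eq_fourier_neg, Real.fourierInv_eq_fourier_neg, fourier_prod Φ f g h]
  simp

/-- On a tensor product `φ ⊗ ψ`, the operator is `(F⁻¹ κ² F φ) ⊗ ψ`. -/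
theorem timeMultiplier_tensor {κ : ℝ → ℂ} (hκ : IsAttenuationCoefficient κ)
    (ϑ : 𝓢(SpaceTime, ℂ)) (φ : 𝓢(ℝ, ℂ)) (ψ : 𝓢(Space3, ℂ))
    (h : ∀ q : SpaceTime, ϑ q = φ q.fst * ψ q.snd) (q : SpaceTime) :
    timeMultiplier κ ϑ q =
      SchwartzMap.fourierMultiplierCLM ℂ (fun ξ : ℝ => κ (2 * Real.pi * ξ) ^ 2) φ q.fst * ψ q.snd := by
  have h1 : (fun ξ : ℝ => 2 * Real.pi * ξ).HasTemperateGrowth :=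
    ((2 * Real.pi) • ContinuousLinearMap.id ℝ ℝ).hasTemperateGrowth
  have h2 := hκ.hasTemperateGrowth.comp h1
  have h3 : (fun ξ : ℝ => κ (2 * Real.pi * ξ) ^ 2).HasTemperateGrowth := by
    simp only [sq]
    exact h2.mul h2
  have e : ψ = FourierTransformInv.fourierInv (FourierTransform.fourier ψ) := by simp
  rw [timeMultiplier, SchwartzMap.fourierMultiplierCLM_apply, SchwartzMap.fourierMultiplierCLM_apply]
  conv_rhs => rw [e]
  rw [SchwartzMap.fourierInv_coe, SchwartzMap.fourierInv_coe, SchwartzMap.fourierInv_coe]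
  apply fourierInv_prod
  intro ξ
  rw [SchwartzMap.smulLeftCLM_apply_apply hκ.symbol_hasTemperateGrowth, SchwartzMap.smulLeftCLM_apply_apply h3,
    SchwartzMap.fourier_coe, fourier_prod ϑ φ ψ h, SchwartzMap.fourier_coe, SchwartzMap.fourier_coe]
  simp [mul_assoc]

/-- The Laplacian in the space variable on tempered distributions on space-time. -/
noncomputable def spatialLaplacian (u : 𝓢'(SpaceTime, ℂ)) : 𝓢'(SpaceTime, ℂ) :=
  ∑ i : Fin 3, ∂_{mkST 0 (EuclideanSpace.single i 1)}
    (∂_{mkST 0 (EuclideanSpace.single i 1)} u : 𝓢'(SpaceTime, ℂ))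

/-- On a tensor product, `⟨Δ u, φ ⊗ ψ⟩ = ⟨u, φ ⊗ Δ ψ⟩`. -/
theorem spatialLaplacian_apply_tensor (u : 𝓢'(SpaceTime, ℂ)) (ϑ ϑ' : 𝓢(SpaceTime, ℂ)) (φ : 𝓢(ℝ, ℂ)) (ψ : 𝓢(Space3, ℂ))
    (h : ∀ q : SpaceTime, ϑ q = φ q.fst * ψ q.snd)
    (h' : ∀ q : SpaceTime, ϑ' q = φ q.fst * (Laplacian.laplacian ψ : 𝓢(Space3, ℂ)) q.snd) :
    spatialLaplacian u ϑ = u ϑ' := by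
  have key : ∀ (η : 𝓢(SpaceTime, ℂ)) (ψ : 𝓢(Space3, ℂ)) (i : Fin 3) (h : ∀ q : SpaceTime, η q = φ q.fst * ψ q.snd) (q : SpaceTime),
      (∂_{mkST 0 (EuclideanSpace.single i 1)} η : 𝓢(SpaceTime, ℂ)) q = φ q.fst * (∂_{EuclideanSpace.single i (1:ℝ)} ψ : 𝓢(Space3, ℂ)) q.snd := by
    intro η ψ i h q
    rw [SchwartzMap.lineDerivOp_apply, SchwartzMap.lineDerivOp_apply]
    simp only [lineDeriv, h]
    simp
  have : ϑ' = ∑ i : Fin 3, (∂_{mkST 0 (EuclideanSpace.single i 1)} (∂_{mkST 0 (EuclideanSpace.single i 1)} ϑ : 𝓢(SpaceTime, ℂ)) : 𝓢(SpaceTime, ℂ)) := by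
    ext q
    rw [sum_apply, h', SchwartzMap.laplacian_eq_sum (EuclideanSpace.basisFun (Fin 3) ℝ), sum_apply, Finset.mul_sum]
    refine Finset.sum_congr rfl fun i _ => ?_
    rw [key _ _ i (key _ _ i h)]
    simp
  rw [this, map_sum]
  simp [spatialLaplacian, TemperedDistribution.lineDerivOp_apply_apply]

/-- The essential support of `h`: the complement of the largest open set on which `h` vanishes
almost everywhere. -/
def essSupport (h : Space3 → ℝ) : Set Space3 :=
  {x | ∀ U ∈ 𝓝 x, ¬ ∀ᵐ y ∂(volume.restrict U), h y = 0}

/-- `p` is the causal solution of the attenuated wave equation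
`A_κ p(t,x) - Δ p(t,x) = δ'(t) h(x)`, `p(t,x) = 0` for `t < 0`, in the sense of tempered
distributions. -/
structure IsCausalSolution (κ : ℝ → ℂ) (h : Space3 → ℝ) (p : 𝓢'(SpaceTime, ℂ)) : Prop where
  equation : ∀ ϑ : 𝓢(SpaceTime, ℂ),
    attenuationOp κ p ϑ - spatialLaplacian p ϑ =
      -∫ x : Space3, (h x : ℂ) * deriv (fun t : ℝ => ϑ (mkST t x)) 0
  causal : Distribution.dsupport p ⊆ {q : SpaceTime | 0 ≤ q.fst}

/-- The solution of the attenuated wave equation with attenuation coefficient `κ` propagates with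
finite speed `c`: whenever the source `h`, square integrable with compact essential support, is
supported in the ball `B_R(0)`, the causal solution is supported in the cone `|x| ≤ c t + R`. -/
def PropagatesWithSpeed (κ : ℝ → ℂ) (c : ℝ) : Prop :=
  ∀ (h : Space3 → ℝ) (R : ℝ), MemLp h 2 volume → IsCompact (essSupport h) →
    0 < R → essSupport h ⊆ Metric.ball 0 R →
    ∀ p : 𝓢'(SpaceTime, ℂ), IsCausalSolution κ h p →
      Distribution.dsupport p ⊆ {q : SpaceTime | ‖q.snd‖ ≤ c * q.fst + R}

/-- The solution propagates faster than with speed `c`: for some admissible source supported in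
some ball `B_R(0)`, the support of the causal solution is not contained in the cone
`|x| ≤ c t + R`. -/
def PropagatesFasterThan (κ : ℝ → ℂ) (c : ℝ) : Prop :=
  ∃ (h : Space3 → ℝ) (R : ℝ), MemLp h 2 volume ∧ IsCompact (essSupport h) ∧
    0 < R ∧ essSupport h ⊆ Metric.ball 0 R ∧
    ∃ p : 𝓢'(SpaceTime, ℂ), IsCausalSolution κ h p ∧
      ¬ Distribution.dsupport p ⊆ {q : SpaceTime | ‖q.snd‖ ≤ c * q.fst + R}

end AttenuatedWave

/-! The proof works with exponential weights. Conjugating the wave operator on test functions by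
`exp ⟪v, ·⟫`, `v = (η, α)`, moves its symbol to complex covectors: it becomes `ζ ⬝ ζ - k²` with `k =
κt z`, `z = 2πτ + iη`, `ζ = 2πξ + iα`. If `ζ ⬝ ζ = ν²`, then `|Im ν| ≤ ‖α‖`, so the factors `ν ± k`
give the lower bound `(Im k - ‖α‖)²` as long as `‖α‖ ≤ Im k` (`sq_le_norm_waveSymbol`). A multiplier
that continues holomorphically with polynomial bounds in the direction `v` does not push supports
towards larger `⟪v, ·⟫`: shift the contour and let the shift tend to infinity
(`ShiftSymbol.fourierInv_eq_zero`).

(i) If `Im κt z ≥ Im z / c`, the symbol is bounded below by `1 / c²` along all weights `(1 + μ,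
-(μ/c)θ)`, `μ ≥ 0`, `‖θ‖ = 1`. Its inverse therefore preserves the half-spaces `⟪θ, x⟫ - c t ≥ b`.
Every point outside the cone has a neighbourhood in such a half-space with `b > R`. A test function
supported there is the image of a function vanishing near the source, so the solution annihilates
it.

(ii) One point `z` with `Im κt z < Im z / c` is enough. Were the solution supported in the cone, it
could be tested against the plane wave `exp(i(z t + k x₀))`, which decays exponentially on the cone
and is annihilated by the operator. The source term would then vanish, but it is a multiple of the
integral of `exp(i k x₀)` over a small ball, which is nonzero (`not_dsupport_subset_cone`).

Part (ii) also needs a solution to exist. By the maximum principle `Im κt > 0` in the open half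
plane, and Schwarz–Pick makes this quantitative, so the weighted symbol with `α = 0` is invertible
with a loss of `η⁻²`. The resulting functional does not depend on `η`. Choosing `η ≈ 1/n` at times
`t ≈ n` and summing over time slabs makes it tempered. -/

namespace AttenuatedWave

/-! ### Uniform derivative bounds for families of weights. -/

section DerivBound

open scoped ContDiff

variable {ι V W : Type*} [NormedAddCommGroup V] [NormedSpace ℝ V] [NormedAddCommGroup W]
  [NormedSpace ℝ W]

/-- A family of smooth functions whose derivatives are bounded by multiples of given weights,
uniformly in the family. -/
structure DerivBound (f : ι → V → ℂ) (g : ι → V → ℝ) : Prop where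
  smooth : ∀ i, ContDiff ℝ ∞ (f i)
  bound : ∀ n : ℕ, ∃ C, 0 ≤ C ∧ ∀ i x, ‖iteratedFDeriv ℝ n (f i) x‖ ≤ C * g i x

namespace DerivBound

variable {f f₁ f₂ : ι → V → ℂ} {g g₁ g₂ : ι → V → ℝ}

theorem mono (h : DerivBound f g₁) {C : ℝ} (hC : 0 ≤ C) (hg : ∀ i x, g₁ i x ≤ C * g₂ i x) :
    DerivBound f g₂ := by
  refine ⟨h.smooth, fun n => ?_⟩
  obtain ⟨D, hD, hb⟩ := h.bound n
  refine ⟨D * C, by positivity, fun i x => (hb i x).trans ?_⟩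
  rw [mul_assoc]
  gcongr
  exact hg i x

theorem mul (h₁ : DerivBound f₁ g₁) (h₂ : DerivBound f₂ g₂) :
    DerivBound (fun i x => f₁ i x * f₂ i x) (fun i x => g₁ i x * g₂ i x) := by
  refine ⟨fun i => (h₁.smooth i).mul (h₂.smooth i), fun n => ?_⟩
  choose C₁ hC₁ hb₁ using h₁.bound
  choose C₂ hC₂ hb₂ using h₂.bound
  refine ⟨∑ j ∈ Finset.range (n + 1), (n.choose j : ℝ) * C₁ j * C₂ (n - j),
    Finset.sum_nonneg fun j _ => by have := hC₁ j; have := hC₂ (n - j); positivity,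
    fun i x => ?_⟩
  refine (norm_iteratedFDeriv_mul_le (N := ∞) (h₁.smooth i) (h₂.smooth i) x
    (mod_cast le_top)).trans ?_
  rw [Finset.sum_mul]
  refine Finset.sum_le_sum fun j _ => ?_
  calc _ ≤ (n.choose j : ℝ) * (C₁ j * g₁ i x) * (C₂ (n - j) * g₂ i x) := by
        gcongr
        · exact mul_nonneg (by positivity) ((norm_nonneg _).trans (hb₁ j i x))
        · exact hb₁ j i x
        · exact hb₂ _ i x
    _ = _ := by ring

theorem comp_affine {κ : Type*} (h : DerivBound f g) (σ : κ → ι) (ℓ : κ → W →L[ℝ] V) (b : κ → V)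
    {B : ℝ} (hB : ∀ k, ‖ℓ k‖ ≤ B) :
    DerivBound (fun k x => f (σ k) (ℓ k x + b k)) (fun k x => g (σ k) (ℓ k x + b k)) := by
  have hs : ∀ k, ContDiff ℝ ∞ (fun y => f (σ k) (y + b k)) :=
    fun k => (h.smooth (σ k)).comp (contDiff_id.add contDiff_const)
  refine ⟨fun k => (hs k).comp (ℓ k).contDiff, fun n => ?_⟩
  obtain ⟨D, hD, hb⟩ := h.bound n
  rcases isEmpty_or_nonempty κ with hκ | ⟨⟨k₀⟩⟩
  · exact ⟨0, le_rfl, fun k => hκ.elim k⟩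
  have hB0 : 0 ≤ B := (norm_nonneg _).trans (hB k₀)
  refine ⟨D * B ^ n, by positivity, fun k x => ?_⟩
  have e := (ℓ k).iteratedFDeriv_comp_right (hs k) x (i := n) (mod_cast le_top)
  have e' : (fun x => f (σ k) (ℓ k x + b k)) = (fun y => f (σ k) (y + b k)) ∘ ℓ k := rfl
  rw [e', e, iteratedFDeriv_comp_add_right]
  refine (ContinuousMultilinearMap.norm_compContinuousLinearMap_le _ _).trans ?_
  rw [Finset.prod_const, Finset.card_univ, Fintype.card_fin]
  have h1 := hb (σ k) (ℓ k x + b k)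
  calc _ ≤ (D * g (σ k) (ℓ k x + b k)) * B ^ n := by
        gcongr
        · exact (norm_nonneg _).trans h1
        · exact hB k
    _ = _ := by ring

theorem hasTemperateGrowth (h : DerivBound f g) (i : ι) {C : ℝ} (hg : ∀ x, g i x ≤ C) :
    (f i).HasTemperateGrowth := by
  refine ⟨h.smooth i, fun n => ?_⟩
  obtain ⟨D, hD, hb⟩ := h.bound n
  exact ⟨0, D * C, fun x => (hb i x).trans (by simpa using by gcongr; exact hg x)⟩

theorem exp_linear : DerivBound (fun (_ : Unit) (s : ℝ) => Complex.exp s)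
    (fun _ s => Real.exp s) := by
  have hs : ContDiff ℝ ∞ (fun s : ℝ => Complex.exp s) :=
    Complex.contDiff_exp.comp Complex.ofRealCLM.contDiff
  have hd : deriv (fun s : ℝ => Complex.exp s) = fun s : ℝ => Complex.exp s := by
    ext s
    simpa using ((Complex.hasDerivAt_exp (s : ℂ)).comp_ofReal).deriv
  refine ⟨fun _ => hs, fun n => ⟨1, zero_le_one, fun _ x => ?_⟩⟩
  rw [norm_iteratedFDeriv_eq_norm_iteratedDeriv, iteratedDeriv_eq_iterate,
    Function.iterate_fixed hd]
  simp [Complex.norm_exp]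

end DerivBound

/-- A smooth cutoff function, equal to `0` for `s ≤ 0` and to `1` for `1 ≤ s`. -/
noncomputable def cutoff (s : ℝ) : ℂ := Real.smoothTransition s

theorem cutoff_of_nonpos {s : ℝ} (h : s ≤ 0) : cutoff s = 0 := by
  simp [cutoff, Real.smoothTransition.zero_of_nonpos h]

theorem cutoff_of_one_le {s : ℝ} (h : 1 ≤ s) : cutoff s = 1 := by
  simp [cutoff, Real.smoothTransition.one_of_one_le h]

theorem contDiff_cutoff : ContDiff ℝ ∞ cutoff :=
  Complex.ofRealCLM.contDiff.comp Real.smoothTransition.contDiff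

theorem derivBound_cutoff :
    DerivBound (fun (_ : Unit) => cutoff) (fun _ => Set.indicator (Set.Ici 0) 1) := by
  refine ⟨fun _ => contDiff_cutoff, fun n => ?_⟩
  have hneg : ∀ s < 0, iteratedFDeriv ℝ n cutoff s = 0 := fun s hs => by
    have : cutoff =ᶠ[𝓝 s] fun _ => 0 := by
      filter_upwards [gt_mem_nhds hs] with y hy using cutoff_of_nonpos hy.le
    rw [(this.iteratedFDeriv ℝ n).eq_of_nhds]
    simp
  have hcont : Continuous (fun s => ‖iteratedFDeriv ℝ n cutoff s‖) :=
    (contDiff_cutoff.continuous_iteratedFDeriv (mod_cast le_top)).norm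
  obtain ⟨C, hC⟩ := (isCompact_Icc (a := (0 : ℝ)) (b := 1)).exists_bound_of_continuousOn
    hcont.continuousOn
  refine ⟨max C 1, by positivity, fun _ s => ?_⟩
  rcases lt_or_ge s 0 with hs | hs
  · rw [hneg s hs]
    simp [Set.indicator, hs.not_ge]
  rw [Set.indicator_of_mem (by exact hs), Pi.one_apply, mul_one]
  rcases le_or_gt s 1 with h1 | h1
  · exact ((le_abs_self _).trans (hC s ⟨hs, h1⟩)).trans (le_max_left _ _)
  · have : cutoff =ᶠ[𝓝 s] fun _ => 1 := by
      filter_upwards [lt_mem_nhds h1] with y hy using cutoff_of_one_le hy.le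
    rw [(this.iteratedFDeriv ℝ n).eq_of_nhds]
    rcases n with _ | n
    · simp
    · simp [iteratedFDeriv_const_of_ne]

/-- The functions `cutoff (ℓ q + b) * exp (-(ℓ q))`, as a function of one variable. -/
theorem derivBound_cutoff_mul_exp (ε b : ℝ) (hε : 0 ≤ ε) :
    DerivBound (fun (_ : Unit) (s : ℝ) => cutoff (s + b) * Complex.exp ((-ε * s : ℝ) : ℂ))
      (fun _ s => Real.exp (-ε * |s|)) := by
  have h1 := derivBound_cutoff.comp_affine (W := ℝ) (fun _ : Unit => ())
    (fun _ => ContinuousLinearMap.id ℝ ℝ) (fun _ => b) (B := 1)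
    (fun _ => ContinuousLinearMap.norm_id_le)
  have h2 := DerivBound.exp_linear.comp_affine (W := ℝ) (fun _ : Unit => ())
    (fun _ => (-ε) • ContinuousLinearMap.id ℝ ℝ) (fun _ => 0)
    (fun _ => le_rfl)
  -- The cutoff leaves only `s ≥ -b`. A negative such `s` has `|s| ≤ |b|`, so `-ε s ≤ -ε |s| + 2 ε
  -- |b|`.
  have h3 := (h1.mul h2).mono (g₂ := fun _ s => Real.exp (-ε * |s|)) (C := Real.exp (2 * ε * |b|))
    (by positivity) ?_
  · simpa using h3
  · intro _ s
    simp only [ContinuousLinearMap.id_apply, Set.indicator, Set.mem_Ici, Pi.one_apply,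
      smul_apply, smul_eq_mul, add_zero, ite_mul, one_mul, zero_mul]
    split_ifs with h
    · rw [← Real.exp_add, Real.exp_le_exp]
      rcases abs_cases s with ⟨h', _⟩ | ⟨h', _⟩ <;> rw [h']
      · nlinarith [mul_nonneg hε (abs_nonneg b)]
      · nlinarith [mul_nonneg hε (show 0 ≤ s + |b| by linarith [le_abs_self b])]
    · positivity

/-- By Leibniz, polynomial growth of order `K` costs `K` extra powers in the seminorm. The constant
depends neither on the index nor on `ϑ`, and the weight matters only on `S`, since the product
vanishes off `tsupport ϑ`. -/
theorem norm_pow_mul_iteratedFDeriv_mul_le {f : ι → V → ℂ} {g : ι → V → ℝ} (h : DerivBound f g)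
    (S : Set V) (A : ι → ℝ) (K : ℕ) (hA : ∀ i, ∀ x ∈ S, g i x ≤ A i * (1 + ‖x‖) ^ K) (k n : ℕ) :
    ∃ C, 0 ≤ C ∧ ∀ (i : ι) (ϑ : 𝓢(V, ℂ)), tsupport ϑ ⊆ S → ∀ x,
      ‖x‖ ^ k * ‖iteratedFDeriv ℝ n (fun y => f i y * ϑ y) x‖ ≤
        C * |A i| * (Finset.Iic (k + K, n)).sup (schwartzSeminormFamily ℝ V ℂ) ϑ := by
  choose C₁ hC₁ hb₁ using h.bound
  refine ⟨∑ j ∈ Finset.range (n + 1), (n.choose j : ℝ) * C₁ j * 2 ^ (k + K),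
    Finset.sum_nonneg fun j _ => by have := hC₁ j; positivity, fun i ϑ hϑ x => ?_⟩
  by_cases hx : x ∈ tsupport ϑ
  · have h0 := norm_iteratedFDeriv_mul_le (N := ∞) (h.smooth i) (ϑ.smooth ⊤) x
      (n := n) (mod_cast le_top)
    have hgA : g i x ≤ |A i| * (1 + ‖x‖) ^ K :=
      (hA i x (hϑ hx)).trans (by gcongr; exact le_abs_self _)
    calc _ ≤ (1 + ‖x‖) ^ k * ∑ j ∈ Finset.range (n + 1), (n.choose j : ℝ) *
          ‖iteratedFDeriv ℝ j (f i) x‖ * ‖iteratedFDeriv ℝ (n - j) ϑ x‖ := by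
          gcongr
          linarith [norm_nonneg x]
      _ ≤ _ := by
          rw [Finset.mul_sum, Finset.sum_mul, Finset.sum_mul]
          refine Finset.sum_le_sum fun j _ => ?_
          have h2 := SchwartzMap.one_add_le_sup_seminorm_apply (𝕜 := ℝ) (m := (k + K, n))
            (k := k + K) (n := n - j) le_rfl (Nat.sub_le _ _) ϑ x
          calc _ ≤ (1 + ‖x‖) ^ k * ((n.choose j : ℝ) * (C₁ j * (|A i| * (1 + ‖x‖) ^ K)) *
                ‖iteratedFDeriv ℝ (n - j) ϑ x‖) := by
                gcongr
                refine (hb₁ j i x).trans ?_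
                gcongr
                exact hC₁ j
            _ = (n.choose j : ℝ) * C₁ j * |A i| *
                ((1 + ‖x‖) ^ (k + K) * ‖iteratedFDeriv ℝ (n - j) ϑ x‖) := by ring
            _ ≤ (n.choose j : ℝ) * C₁ j * |A i| * (2 ^ (k + K) *
                (Finset.Iic (k + K, n)).sup (schwartzSeminormFamily ℝ V ℂ) ϑ) := by
                have := hC₁ j
                exact mul_le_mul_of_nonneg_left h2 (by positivity)
            _ = _ := by ring
  · have h0 : iteratedFDeriv ℝ n (fun y => f i y * ϑ y) x = 0 := by
      have h1 : x ∉ tsupport (fun y => f i y * ϑ y) := fun hx' => hx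
        (tsupport_mul_subset_right hx')
      have h2 := support_iteratedFDeriv_subset (𝕜 := ℝ) (f := fun y => f i y * ϑ y) n
      by_contra h3
      exact h1 (h2 h3)
    rw [h0]
    simp only [norm_zero, mul_zero]
    have : ∀ j, 0 ≤ C₁ j := hC₁
    have := apply_nonneg ((Finset.Iic (k + K, n)).sup (schwartzSeminormFamily ℝ V ℂ)) ϑ
    have : 0 ≤ ∑ j ∈ Finset.range (n + 1), (n.choose j : ℝ) * C₁ j * 2 ^ (k + K) :=
      Finset.sum_nonneg fun j _ => by have := hC₁ j; positivity
    positivity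

/-- A smooth function all of whose derivatives decay exponentially is a Schwartz function. -/
theorem DerivBound.exists_schwartz {f : V → ℂ} {g : V → ℝ}
    (h : DerivBound (fun _ : Unit => f) (fun _ => g)) {C ε : ℝ} (hε : 0 < ε) (hC : 0 ≤ C)
    (hg : ∀ x, g x ≤ C * Real.exp (-ε * ‖x‖)) : ∃ φ : 𝓢(V, ℂ), ∀ x, φ x = f x := by
  refine ⟨⟨f, h.smooth (), fun k n => ?_⟩, fun x => rfl⟩
  obtain ⟨D, hD, hb⟩ := h.bound n
  refine ⟨D * C * (k.factorial / ε ^ k), fun x => ?_⟩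
  -- This is one term of the exponential series, `(ε‖x‖)^k / k! ≤ exp (ε‖x‖)`.
  have h1 : ‖x‖ ^ k * Real.exp (-ε * ‖x‖) ≤ k.factorial / ε ^ k := by
    have := Real.pow_div_factorial_le_exp (x := ε * ‖x‖) (by positivity) k
    rw [neg_mul, Real.exp_neg, le_div_iff₀ (by positivity), mul_assoc, mul_comm,
      mul_assoc, inv_mul_le_iff₀ (Real.exp_pos _)]
    rw [div_le_iff₀ (by positivity), mul_pow] at this
    linarith
  calc _ ≤ ‖x‖ ^ k * (D * (C * Real.exp (-ε * ‖x‖))) := by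
        gcongr
        exact (hb () x).trans (by gcongr; exact hg x)
    _ = D * C * (‖x‖ ^ k * Real.exp (-ε * ‖x‖)) := by ring
    _ ≤ _ := by gcongr

end DerivBound

/-! ### Density of compactly supported test functions, and supports of tempered distributions. -/

section Truncation

open scoped ContDiff

variable {V : Type*} [NormedAddCommGroup V] [NormedSpace ℝ V]

/-- Truncation of Schwartz functions: compactly supported functions are dense. -/
theorem exists_tendsto_hasCompactSupport [FiniteDimensional ℝ V] (ϑ : 𝓢(V, ℂ)) :
    ∃ u : ℕ → 𝓢(V, ℂ), (∀ n, HasCompactSupport (u n)) ∧ (∀ n, tsupport (u n) ⊆ tsupport ϑ) ∧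
      Tendsto u atTop (𝓝 ϑ) := by
  let b : ContDiffBump (0 : V) := ⟨1, 2, one_pos, one_lt_two⟩
  let B : V → ℂ := fun x => (b x : ℂ)
  have hB : ContDiff ℝ ∞ B := Complex.ofRealCLM.contDiff.comp b.contDiff
  have hBc : HasCompactSupport B := b.hasCompactSupport.comp_left (g := Complex.ofReal) (by simp)
  have h1 : DerivBound (fun (_ : Unit) (x : V) => 1 - B x)
      (fun _ => Set.indicator {x | 1 ≤ ‖x‖} 1) := by
    refine ⟨fun _ => contDiff_const.sub hB, fun n => ?_⟩
    have hs : ContDiff ℝ ∞ (fun x : V => 1 - B x) := contDiff_const.sub hB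
    have hcont : Continuous (fun s => ‖iteratedFDeriv ℝ n (fun x : V => 1 - B x) s‖) :=
      (hs.continuous_iteratedFDeriv (mod_cast le_top)).norm
    obtain ⟨C, hC⟩ := (isCompact_closedBall (0 : V) 2).exists_bound_of_continuousOn
      hcont.continuousOn
    refine ⟨max C 1, by positivity, fun _ x => ?_⟩
    rcases lt_or_ge ‖x‖ 1 with hx | hx
    · have : (fun x : V => 1 - B x) =ᶠ[𝓝 x] fun _ => 0 := by
        have ho : Metric.ball (0 : V) 1 ∈ 𝓝 x :=
          Metric.isOpen_ball.mem_nhds (by simpa using hx)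
        filter_upwards [ho] with y hy
        have : b y = 1 := b.one_of_mem_closedBall (Metric.ball_subset_closedBall hy)
        simp [B, this]
      rw [(this.iteratedFDeriv ℝ n).eq_of_nhds]
      simp [Set.indicator, hx.not_ge]
    rw [Set.indicator_of_mem (by exact hx), Pi.one_apply, mul_one]
    rcases le_or_gt ‖x‖ 2 with h2 | h2
    · exact ((le_abs_self _).trans (hC x (by simpa using h2))).trans (le_max_left _ _)
    · have : (fun x : V => 1 - B x) =ᶠ[𝓝 x] fun _ => 1 := by
        have ho : {y : V | 2 < ‖y‖} ∈ 𝓝 x := (isOpen_lt continuous_const continuous_norm).mem_nhds h2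
        filter_upwards [ho] with y hy
        have : b y = 0 := b.zero_of_le_dist (by simpa using (show (2 : ℝ) < ‖y‖ from hy).le)
        simp [B, this]
      rw [(this.iteratedFDeriv ℝ n).eq_of_nhds]
      rcases n with _ | n
      · simp
      · simp [iteratedFDeriv_const_of_ne]
  have h2 := h1.comp_affine (fun _ : ℕ => ())
    (fun n : ℕ => ((n : ℝ) + 1)⁻¹ • ContinuousLinearMap.id ℝ V) (fun _ => 0) (B := 1) (fun n => by
      rw [norm_smul, norm_inv, Real.norm_of_nonneg (by positivity)]
      have h3 : ((n : ℝ) + 1)⁻¹ ≤ 1 := inv_le_one_of_one_le₀ (by simp)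
      have h4 := ContinuousLinearMap.norm_id_le (𝕜 := ℝ) (E := V)
      nlinarith [norm_nonneg (ContinuousLinearMap.id ℝ V)])
  have hcs : ∀ n : ℕ, HasCompactSupport (fun x => B (((n : ℝ) + 1)⁻¹ • x) * ϑ x) := fun n => by
    have : HasCompactSupport (fun x => B (((n : ℝ) + 1)⁻¹ • x)) :=
      hBc.comp_smul (inv_ne_zero (by positivity))
    exact this.mul_right
  let u : ℕ → 𝓢(V, ℂ) := fun n => (hcs n).toSchwartzMap
    ((hB.comp (contDiff_id.const_smul (((n : ℝ) + 1)⁻¹))).mul (ϑ.smooth ⊤))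
  refine ⟨u, hcs, fun n => tsupport_mul_subset_right, ?_⟩
  rw [(schwartz_withSeminorms ℝ V ℂ).tendsto_nhds]
  rintro ⟨k, n⟩ ε hε
  -- The error factor `1 - B (x / (n + 1))` lives where `‖x‖ ≥ n + 1`, hence is at most `(1 + ‖x‖) /
  -- (n + 1)`: one power of `‖x‖` buys a factor tending to zero.
  obtain ⟨C, hC, hb⟩ := norm_pow_mul_iteratedFDeriv_mul_le h2 Set.univ
    (fun n : ℕ => ((n : ℝ) + 1)⁻¹) 1 (fun i x _ => by
      simp only [add_zero, Set.indicator, Set.mem_ofPred_eq, Pi.one_apply, pow_one,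
        smul_apply, ContinuousLinearMap.id_apply, norm_smul, norm_inv]
      rw [Real.norm_of_nonneg (by positivity)]
      split_ifs with h
      · refine h.trans ?_
        gcongr
        linarith
      · positivity) k n
  set M := (Finset.Iic (k + 1, n)).sup (schwartzSeminormFamily ℝ V ℂ) ϑ
  have hM : 0 ≤ M := apply_nonneg _ _
  have hlim : Tendsto (fun i : ℕ => C * |((i : ℝ) + 1)⁻¹| * M) atTop (𝓝 0) := by
    have := (tendsto_one_div_add_atTop_nhds_zero_nat (𝕜 := ℝ)).abs
    simpa using (this.const_mul C).mul_const M
  filter_upwards [hlim.eventually (gt_mem_nhds hε)] with i hi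
  refine lt_of_le_of_lt ?_ hi
  have hneg : schwartzSeminormFamily ℝ V ℂ (k, n) (u i - ϑ) =
      schwartzSeminormFamily ℝ V ℂ (k, n) (ϑ - u i) := map_sub_rev _ _ _
  rw [hneg]
  refine SchwartzMap.seminorm_le_bound ℝ k n _ (by positivity) fun x => ?_
  have h3 : ⇑(ϑ - u i) = fun y => (1 - B (((i : ℝ) + 1)⁻¹ • y)) * ϑ y := by
    ext y
    simp [u, sub_mul]
  rw [h3]
  simpa using hb i ϑ (Set.subset_univ _) x

theorem eq_of_eq_on_hasCompactSupport [FiniteDimensional ℝ V] {p q : 𝓢(V, ℂ) → ℂ}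
    (hp : Continuous p) (hq : Continuous q)
    (h : ∀ ϑ : 𝓢(V, ℂ), HasCompactSupport ϑ → p ϑ = q ϑ) (ϑ : 𝓢(V, ℂ)) : p ϑ = q ϑ := by
  obtain ⟨u, hu, -, hlim⟩ := exists_tendsto_hasCompactSupport ϑ
  refine tendsto_nhds_unique ((hp.tendsto ϑ).comp hlim) ?_
  simpa only [Function.comp_def, h _ (hu _)] using (hq.tendsto ϑ).comp hlim

theorem continuous_temperedDistribution (p : 𝓢'(V, ℂ)) : Continuous (fun ϑ : 𝓢(V, ℂ) => p ϑ) :=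
  (p : 𝓢(V, ℂ) →L[ℂ] ℂ).continuous

open scoped Manifold in
/-- A tempered distribution vanishes on the Schwartz functions whose support does not meet
its support. -/
theorem apply_eq_zero_of_disjoint_dsupport [FiniteDimensional ℝ V] (p : 𝓢'(V, ℂ)) (ϑ : 𝓢(V, ℂ))
    (h : Disjoint (tsupport ϑ) (Distribution.dsupport p)) : p ϑ = 0 := by
  have key : ∀ φ : 𝓢(V, ℂ), HasCompactSupport φ → Disjoint (tsupport φ) (Distribution.dsupport p) →
      p φ = 0 := by
    intro φ hφ hd
    have hx : ∀ x ∈ tsupport φ, ∃ s : Set V, Distribution.IsVanishingOn p s ∧ IsOpen s ∧ x ∈ s :=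
      fun x hx => (Distribution.notMem_dsupport_iff x).1 (Set.disjoint_left.1 hd hx)
    choose! s hs hso hxs using hx
    obtain ⟨t, ht, htK⟩ := hφ.isCompact.elim_nhds_subcover s
      fun x hx => (hso x hx).mem_nhds (hxs x hx)
    -- Cut `φ` into finitely many pieces, each supported in an open set on which `p` vanishes.
    obtain ⟨f, hf⟩ := SmoothPartitionOfUnity.exists_isSubordinate 𝓘(ℝ, V)
      (isClosed_tsupport φ) (fun x : t => s x) (fun x => hso x (ht x x.2)) (by
        intro y hy
        obtain ⟨x, hx, hyx⟩ := Set.mem_iUnion₂.1 (htK hy)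
        exact Set.mem_iUnion.2 ⟨⟨x, hx⟩, hyx⟩)
    have hcs : ∀ x : t, HasCompactSupport (fun y => (f x y : ℂ) * φ y) := fun x => hφ.mul_left
    have hsm : ∀ x : t, ContDiff ℝ ∞ (fun y => (f x y : ℂ) * φ y) := fun x =>
      (Complex.ofRealCLM.contDiff.comp (f x).contMDiff.contDiff).mul (φ.smooth ⊤)
    have e : φ = ∑ x : t, (hcs x).toSchwartzMap (hsm x) := by
      ext y
      rw [sum_apply]
      simp only [HasCompactSupport.toSchwartzMap_toFun]
      by_cases hy : y ∈ tsupport φ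
      · have h1 := f.sum_eq_one hy
        rw [finsum_eq_sum_of_fintype] at h1
        rw [← Finset.sum_mul, ← Complex.ofReal_sum, h1]
        simp
      · simp [image_eq_zero_of_notMem_tsupport hy]
    rw [e, map_sum]
    refine Finset.sum_eq_zero fun x _ => hs x (ht x x.2) _ ?_
    refine Set.Subset.trans ?_ (hf x)
    refine (tsupport_mul_subset_left (f := fun y => (f x y : ℂ)) (g := φ)).trans ?_
    exact tsupport_comp_subset (g := Complex.ofReal) (by simp) _
  obtain ⟨u, hu, hus, hlim⟩ := exists_tendsto_hasCompactSupport ϑ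
  refine tendsto_nhds_unique (((continuous_temperedDistribution p).tendsto ϑ).comp hlim) ?_
  have : (fun n => p (u n)) = fun _ => 0 := funext fun n => key _ (hu n) (h.mono_left (hus n))
  simp [Function.comp_def, this]

end Truncation

/-! ### Contour shifts in finite dimensional spaces. -/

section Contour

variable {E : Type*} [NormedAddCommGroup E] [InnerProductSpace ℝ E]

/-- An integrable weight on a finite dimensional space. -/
noncomputable def decayWeight (q : E) : ℝ := ((1 + ‖q‖) ^ (Module.finrank ℝ E + 1))⁻¹

theorem decayWeight_nonneg (q : E) : 0 ≤ decayWeight q := by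
  unfold decayWeight
  positivity

/-- A Peetre-type inequality. It keeps the majorant integrable, uniformly under bounded
translations. -/
theorem decayWeight_add_le (q v : E) :
    decayWeight (q + v) ≤ (1 + ‖v‖) ^ (Module.finrank ℝ E + 1) * decayWeight q := by
  unfold decayWeight
  rw [← div_eq_mul_inv, le_div_iff₀ (by positivity), inv_mul_le_iff₀ (by positivity), ← mul_pow]
  gcongr
  have h : ‖q‖ ≤ ‖q + v‖ + ‖v‖ := by simpa using norm_sub_le (q + v) v
  nlinarith [norm_nonneg (q + v), norm_nonneg v]

variable [FiniteDimensional ℝ E] [MeasurableSpace E] [BorelSpace E]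

theorem integrable_decayWeight : Integrable (decayWeight (E := E)) := by
  have h := integrable_one_add_norm (E := E) (μ := volume) (r := Module.finrank ℝ E + 1)
    (by linarith)
  refine h.congr (Eventually.of_forall fun q => ?_)
  simp only [decayWeight]
  rw [Real.rpow_neg (by positivity)]
  norm_cast

theorem integrable_uncurry_of_le_decayWeight {a b : ℝ} (hab : a ≤ b) {f : ℝ → E → ℂ} {C : ℝ}
    (hf : ContinuousOn (Function.uncurry f) (Set.Icc a b ×ˢ Set.univ))
    (hb : ∀ s ∈ Set.Icc a b, ∀ q, ‖f s q‖ ≤ C * decayWeight q) :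
    Integrable (Function.uncurry f)
      ((volume.restrict (Set.uIoc a b)).prod (volume : Measure E)) := by
  rw [Set.uIoc_of_le hab]
  have hI : Integrable (fun p : ℝ × E => C * decayWeight p.2)
      ((volume.restrict (Set.Ioc a b)).prod (volume : Measure E)) :=
    (integrable_decayWeight.const_mul C).comp_snd _
  have e : (volume.restrict (Set.Ioc a b)).prod (volume : Measure E) =
      (volume.prod volume).restrict (Set.Ioc a b ×ˢ Set.univ) := by
    rw [← Measure.prod_restrict, Measure.restrict_univ]
  refine hI.mono' ?_ ?_
  · rw [e]
    exact (hf.mono (Set.prod_mono Set.Ioc_subset_Icc_self subset_rfl)).aestronglyMeasurable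
      (measurableSet_Ioc.prod MeasurableSet.univ)
  · rw [e]
    refine (ae_restrict_iff' (measurableSet_Ioc.prod MeasurableSet.univ)).2
      (Eventually.of_forall fun p hp => hb p.1 (Set.Ioc_subset_Icc_self hp.1) p.2)

/-- Shift of the domain of integration in an imaginary direction. -/
theorem integral_shift {H : E → ℝ → ℂ} {v : E} {Λ : ℝ} (hΛ : 0 ≤ Λ)
    (hc : ContinuousOn (Function.uncurry H) (Set.univ ×ˢ Set.Icc 0 Λ))
    (hd : ∀ q, DifferentiableOn ℂ (fun w : ℂ => H (q + w.re • v) w.im) {w | 0 < w.im ∧ w.im < Λ})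
    {C : ℝ} (hC : 0 ≤ C) (hb : ∀ q, ∀ μ ∈ Set.Icc 0 Λ, ‖H q μ‖ ≤ C * decayWeight q) :
    ∫ q, H q 0 = ∫ q, H q Λ := by
  -- Cauchy's theorem on the rectangle `[0, 1] × [0, Λ]` based at each `q`. Integrating over `q`,
  -- translation invariance cancels the vertical sides and turns each horizontal side into a full
  -- integral, so `E` need not be split along `v`.
  have rect : ∀ q, (∫ s in (0 : ℝ)..1, H (q + s • v) 0) - (∫ s in (0 : ℝ)..1, H (q + s • v) Λ) +
      Complex.I • (∫ μ in (0 : ℝ)..Λ, H (q + v) μ) -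
      Complex.I • (∫ μ in (0 : ℝ)..Λ, H q μ) = 0 := by
    intro q
    have := Complex.integral_boundary_rect_eq_zero_of_continuousOn_of_differentiableOn
      (fun w : ℂ => H (q + w.re • v) w.im) 0 (1 + Λ * Complex.I) ?_ ?_
    · simpa using this
    · refine hc.comp (f := fun w : ℂ => (q + w.re • v, w.im)) (by fun_prop) ?_
      intro w hw
      simpa [Complex.mem_reProdIm, Set.uIcc_of_le hΛ] using hw.2
    · refine (hd q).mono fun w hw => ?_
      simpa [Complex.mem_reProdIm, hΛ] using hw.2
  have hcv : ∀ s : ℝ, s ∈ Set.Icc (0 : ℝ) 1 → ∀ μ ∈ Set.Icc 0 Λ, ∀ q,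
      ‖H (q + s • v) μ‖ ≤ C * (1 + ‖v‖) ^ (Module.finrank ℝ E + 1) * decayWeight q := by
    intro s hs μ hμ q
    refine (hb _ μ hμ).trans ?_
    rw [mul_assoc]
    gcongr
    refine (decayWeight_add_le q (s • v)).trans ?_
    have := decayWeight_nonneg q
    gcongr
    rw [norm_smul, Real.norm_of_nonneg hs.1]
    exact mul_le_of_le_one_left (norm_nonneg v) hs.2
  have side : ∀ μ ∈ Set.Icc 0 Λ,
      Integrable (Function.uncurry fun s q => H (q + s • v) μ)
        ((volume.restrict (Set.uIoc (0 : ℝ) 1)).prod volume) := by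
    intro μ hμ
    refine integrable_uncurry_of_le_decayWeight zero_le_one ?_ (fun s hs q => hcv s hs μ hμ q)
    refine hc.comp (f := fun p : ℝ × E => (p.2 + p.1 • v, μ)) (by fun_prop) ?_
    intro p _
    exact ⟨trivial, hμ⟩
  have vert : ∀ s ∈ Set.Icc (0 : ℝ) 1, Integrable (Function.uncurry fun μ q => H (q + s • v) μ)
        ((volume.restrict (Set.uIoc (0 : ℝ) Λ)).prod volume) := by
    intro s hs
    refine integrable_uncurry_of_le_decayWeight hΛ ?_ (fun μ hμ q => hcv s hs μ hμ q)
    refine hc.comp (f := fun p : ℝ × E => (p.2 + s • v, p.1)) (by fun_prop) ?_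
    intro p hp
    exact ⟨trivial, hp.1⟩
  have iside : ∀ μ ∈ Set.Icc 0 Λ, ∫ q, (∫ s in (0 : ℝ)..1, H (q + s • v) μ) = ∫ q, H q μ := by
    intro μ hμ
    rw [← intervalIntegral_integral_swap (side μ hμ)]
    simp_rw [integral_add_right_eq_self (fun q => H q μ)]
    simp
  have ivert : ∀ s ∈ Set.Icc (0 : ℝ) 1, ∫ q, (∫ μ in (0 : ℝ)..Λ, H (q + s • v) μ) =
      ∫ μ in (0 : ℝ)..Λ, ∫ q, H q μ := by
    intro s hs
    rw [← intervalIntegral_integral_swap (vert s hs)]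
    exact intervalIntegral.integral_congr fun μ _ =>
      integral_add_right_eq_self (fun q => H q μ) (s • v)
  have int1 : ∀ μ ∈ Set.Icc 0 Λ, Integrable fun q => ∫ s in (0 : ℝ)..1, H (q + s • v) μ := by
    intro μ hμ
    have := (side μ hμ).integral_prod_right
    simpa [intervalIntegral.integral_of_le] using this
  have int2 : ∀ s ∈ Set.Icc (0 : ℝ) 1, Integrable fun q => ∫ μ in (0 : ℝ)..Λ, H (q + s • v) μ := by
    intro s hs
    have := (vert s hs).integral_prod_right
    simpa [intervalIntegral.integral_of_le hΛ, Set.uIoc_of_le hΛ] using this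
  have h0 : (0 : ℝ) ∈ Set.Icc 0 Λ := ⟨le_rfl, hΛ⟩
  have hL : Λ ∈ Set.Icc 0 Λ := ⟨hΛ, le_rfl⟩
  have i0 : (0 : ℝ) ∈ Set.Icc (0 : ℝ) 1 := by simp
  have i1 : (1 : ℝ) ∈ Set.Icc (0 : ℝ) 1 := by simp
  have j0 := int2 0 i0
  have j1 := int2 1 i1
  have k0 := ivert 0 i0
  have k1 := ivert 1 i1
  simp only [zero_smul, add_zero, one_smul] at j0 j1 k0 k1
  have e : (fun q => (∫ s in (0 : ℝ)..1, H (q + s • v) 0) - ∫ s in (0 : ℝ)..1, H (q + s • v) Λ) =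
      fun q => Complex.I * ((∫ μ in (0 : ℝ)..Λ, H q μ) - ∫ μ in (0 : ℝ)..Λ, H (q + v) μ) :=
    funext fun q => by
      have := rect q
      simp only [smul_eq_mul] at this
      linear_combination this
  have e1 := integral_sub (int1 0 h0) (int1 Λ hL)
  have e2 := integral_sub j0 j1
  rw [e, integral_const_mul, e2, k0, k1, sub_self, mul_zero, iside 0 h0, iside Λ hL] at e1
  exact (sub_eq_zero.1 e1.symm)

end Contour

/-! ### Fourier–Laplace transforms of test functions. -/

section Shift

open scoped ContDiff FourierTransform InnerProductSpace

variable {E : Type*} [NormedAddCommGroup E] [InnerProductSpace ℝ E]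

theorem contDiff_exp_inner (v : E) :
    ContDiff ℝ ∞ (fun x : E => Complex.exp ((⟪v, x⟫_ℝ : ℝ) : ℂ)) :=
  Complex.contDiff_exp.comp (Complex.ofRealCLM.contDiff.comp (innerSL ℝ v).contDiff)

/-- The product of a compactly supported test function with the exponential weight
`exp ⟪v, ·⟫`. -/
noncomputable def expMul (v : E) (φ : 𝓢(E, ℂ)) (hφ : HasCompactSupport φ) : 𝓢(E, ℂ) :=
  (hφ.mul_left (f := fun x : E => Complex.exp ((⟪v, x⟫_ℝ : ℝ) : ℂ))).toSchwartzMap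
    ((contDiff_exp_inner v).mul (φ.smooth ⊤))

theorem expMul_apply (v : E) (φ : 𝓢(E, ℂ)) (hφ : HasCompactSupport φ) (x : E) :
    expMul v φ hφ x = Complex.exp ((⟪v, x⟫_ℝ : ℝ) : ℂ) * φ x := rfl

theorem hasCompactSupport_expMul (v : E) (φ : 𝓢(E, ℂ)) (hφ : HasCompactSupport φ) :
    HasCompactSupport (expMul v φ hφ) :=
  hφ.mul_left (f := fun x : E => Complex.exp ((⟪v, x⟫_ℝ : ℝ) : ℂ))

theorem tsupport_expMul_subset (v : E) (φ : 𝓢(E, ℂ)) (hφ : HasCompactSupport φ) :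
    tsupport (expMul v φ hφ) ⊆ tsupport φ :=
  tsupport_mul_subset_right (f := fun x : E => Complex.exp ((⟪v, x⟫_ℝ : ℝ) : ℂ))

/-- Each derivative produces a factor `μ ‖v‖`. The powers of `μ` are absorbed by `exp (μ ε)`, which
makes the constants uniform in `μ ≥ 0`. -/
theorem derivBound_exp_inner (v : E) {ε : ℝ} (hε : 0 < ε) :
    DerivBound (fun (μ : Set.Ici (0 : ℝ)) (x : E) => Complex.exp ((⟪(μ : ℝ) • v, x⟫_ℝ : ℝ) : ℂ))
      (fun μ x => Real.exp ((μ : ℝ) * (⟪v, x⟫_ℝ + ε))) := by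
  refine ⟨fun μ => contDiff_exp_inner _, fun n => ?_⟩
  refine ⟨(n.factorial / ε ^ n) * ‖v‖ ^ n, by positivity, fun μ x => ?_⟩
  have hμ : (0 : ℝ) ≤ μ := μ.2
  have e := (innerSL ℝ ((μ : ℝ) • v)).iteratedFDeriv_comp_right
    (DerivBound.exp_linear.smooth ()) x (i := n) (mod_cast le_top)
  have e' : (fun x => Complex.exp ((⟪(μ : ℝ) • v, x⟫_ℝ : ℝ) : ℂ)) =
    (fun s : ℝ => Complex.exp s) ∘ innerSL ℝ ((μ : ℝ) • v) := rfl
  rw [e', e]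
  refine (ContinuousMultilinearMap.norm_compContinuousLinearMap_le _ _).trans ?_
  rw [Finset.prod_const, Finset.card_univ, Fintype.card_fin, innerSL_apply_norm, norm_smul,
    Real.norm_of_nonneg hμ]
  have hd : deriv (fun s : ℝ => Complex.exp s) = fun s : ℝ => Complex.exp s := by
    ext s
    simpa using ((Complex.hasDerivAt_exp (s : ℂ)).comp_ofReal).deriv
  rw [norm_iteratedFDeriv_eq_norm_iteratedDeriv, iteratedDeriv_eq_iterate,
    Function.iterate_fixed hd]
  simp only [Complex.norm_exp, Complex.ofReal_re, innerSL_apply_apply, inner_smul_left,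
    conj_trivial]
  have h1 : (μ : ℝ) ^ n ≤ n.factorial / ε ^ n * Real.exp (μ * ε) := by
    have := Real.pow_div_factorial_le_exp (x := μ * ε) (by positivity) n
    rw [div_mul_eq_mul_div, le_div_iff₀ (by positivity), ← mul_pow]
    rw [div_le_iff₀ (by positivity)] at this
    linarith
  rw [mul_add, Real.exp_add, mul_pow]
  calc _ ≤ Real.exp (μ * ⟪v, x⟫_ℝ) * ((n.factorial / ε ^ n * Real.exp (μ * ε)) * ‖v‖ ^ n) := by
        gcongr
    _ = _ := by ring

variable [FiniteDimensional ℝ E] [MeasurableSpace E] [BorelSpace E]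

/-- Continuity of the Fourier transform on Schwartz space, expressed through seminorms. -/
theorem exists_norm_fourier_le (M : ℕ) : ∃ (s : Finset (ℕ × ℕ)) (C : ℝ), 0 ≤ C ∧
    ∀ (ψ : 𝓢(E, ℂ)) (q : E),
      (1 + ‖q‖) ^ M * ‖𝓕 ψ q‖ ≤ C * s.sup (schwartzSeminormFamily ℝ E ℂ) ψ := by
  let r : Seminorm ℝ 𝓢(E, ℂ) := ((Finset.Iic (M, 0)).sup (schwartzSeminormFamily ℝ E ℂ)).comp
    (FourierTransform.fourierCLM ℝ 𝓢(E, ℂ)).toLinearMap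
  have hr : Continuous r := by
    have h1 : Continuous ⇑((Finset.Iic (M, 0)).sup (schwartzSeminormFamily ℝ E ℂ)) :=
      Seminorm.continuous_finsetSup fun i _ => (schwartz_withSeminorms ℝ E ℂ).continuous_seminorm i
    exact h1.comp (FourierTransform.fourierCLM ℝ 𝓢(E, ℂ)).continuous
  obtain ⟨s, C, -, hb⟩ := Seminorm.bound_of_continuous (schwartz_withSeminorms ℝ E ℂ) r hr
  refine ⟨s, 2 ^ M * C, by positivity, fun ψ q => ?_⟩
  have h2 := SchwartzMap.one_add_le_sup_seminorm_apply (𝕜 := ℝ) (m := (M, 0))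
    (k := M) (n := 0) le_rfl le_rfl (𝓕 ψ) q
  rw [norm_iteratedFDeriv_zero] at h2
  refine h2.trans ?_
  rw [mul_assoc]
  exact mul_le_mul_of_nonneg_left (hb ψ) (by positivity)

/-- Uniform decay of the Fourier transforms of products of a test function with a family of
functions with controlled derivatives. -/
theorem exists_norm_fourier_mul_le {ι : Type*} {f : ι → E → ℂ} {g : ι → E → ℝ}
    (h : DerivBound f g) (S : Set E) (A : ι → ℝ) (K : ℕ)
    (hA : ∀ i, ∀ x ∈ S, g i x ≤ A i * (1 + ‖x‖) ^ K) (M : ℕ) :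
    ∃ (s : Finset (ℕ × ℕ)) (C : ℝ), 0 ≤ C ∧ ∀ (i : ι) (ϑ ψ : 𝓢(E, ℂ)), tsupport ϑ ⊆ S →
      (∀ x, ψ x = f i x * ϑ x) → ∀ q,
      (1 + ‖q‖) ^ M * ‖𝓕 ψ q‖ ≤ C * |A i| * s.sup (schwartzSeminormFamily ℝ E ℂ) ϑ := by
  obtain ⟨s, C, hC, hF⟩ := exists_norm_fourier_le (E := E) M
  choose D hD hb using norm_pow_mul_iteratedFDeriv_mul_le h S A K hA
  refine ⟨s.biUnion fun p => Finset.Iic (p.1 + K, p.2), C * ∑ p ∈ s, D p.1 p.2,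
    mul_nonneg hC (Finset.sum_nonneg fun p _ => hD _ _), fun i ϑ ψ hϑ hψ q => ?_⟩
  refine (hF ψ q).trans ?_
  rw [mul_assoc, mul_assoc]
  refine mul_le_mul_of_nonneg_left ?_ hC
  set P := (s.biUnion fun p => Finset.Iic (p.1 + K, p.2)).sup (schwartzSeminormFamily ℝ E ℂ) ϑ
  have hP : 0 ≤ P := apply_nonneg _ _
  refine Seminorm.finset_sup_apply_le
    (mul_nonneg (Finset.sum_nonneg fun p _ => hD _ _) (by positivity)) fun p hp => ?_
  have hψ' : (ψ : E → ℂ) = fun x => f i x * ϑ x := funext hψ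
  have h1 : D p.1 p.2 ≤ ∑ p ∈ s, D p.1 p.2 :=
    Finset.single_le_sum (f := fun p : ℕ × ℕ => D p.1 p.2) (fun p _ => hD _ _) hp
  have h2 : (Finset.Iic (p.1 + K, p.2)).sup (schwartzSeminormFamily ℝ E ℂ) ϑ ≤ P :=
    (Finset.sup_mono (f := schwartzSeminormFamily ℝ E ℂ)
      (Finset.subset_biUnion_of_mem (fun p : ℕ × ℕ => Finset.Iic (p.1 + K, p.2)) hp)) ϑ
  have h0 := hD p.1 p.2
  refine SchwartzMap.seminorm_le_bound ℝ p.1 p.2 ψ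
    (mul_nonneg (h0.trans h1) (by positivity)) fun x => ?_
  rw [hψ']
  refine (hb p.1 p.2 i ϑ hϑ x).trans ?_
  rw [mul_assoc]
  gcongr
  exact h0.trans h1

/-- Decay of the Fourier-Laplace transform of a compactly supported test function. -/
theorem exists_norm_fourier_expMul_le (v : E) (φ : 𝓢(E, ℂ)) (hφ : HasCompactSupport φ) {b : ℝ}
    (hb : ∀ x ∈ tsupport φ, ⟪v, x⟫_ℝ ≤ b) {ε : ℝ} (hε : 0 < ε) (M : ℕ) :
    ∃ C, 0 ≤ C ∧ ∀ μ, 0 ≤ μ → ∀ q,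
      (1 + ‖q‖) ^ M * ‖𝓕 (expMul (μ • v) φ hφ) q‖ ≤ C * Real.exp (μ * (b + ε)) := by
  obtain ⟨s, C, hC, h⟩ := exists_norm_fourier_mul_le (derivBound_exp_inner v hε) (tsupport φ)
    (fun μ => Real.exp ((μ : ℝ) * (b + ε))) 0 (fun μ x hx => by
      have hμ : (0 : ℝ) ≤ μ := μ.2
      have := hb x hx
      rw [pow_zero, mul_one]
      gcongr) M
  refine ⟨C * s.sup (schwartzSeminormFamily ℝ E ℂ) φ, mul_nonneg hC (apply_nonneg _ _),
    fun μ hμ q => ?_⟩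
  have := h ⟨μ, hμ⟩ φ (expMul (μ • v) φ hφ) subset_rfl (fun x => rfl) q
  rw [abs_of_pos (Real.exp_pos _)] at this
  linarith

/-- The real shift of the frequency and the real exponential weight combine into one complex
variable, since `-i Re w + Im w = -i w`. The factor `(2π)⁻¹` cancels the `2π` of the kernel, and the
right-hand side is visibly entire in `w`. -/
theorem fourier_expMul_eq (v : E) (φ : 𝓢(E, ℂ)) (hφ : HasCompactSupport φ) (q : E) (w : ℂ) :
    𝓕 (expMul (w.im • v) φ hφ) (q + w.re • ((2 * Real.pi)⁻¹ • v)) =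
      ∫ x, φ x * Complex.exp (-2 * Real.pi * Complex.I * ⟪x, q⟫_ℝ - Complex.I * w * ⟪v, x⟫_ℝ) := by
  obtain ⟨a, b, rfl⟩ : ∃ a b : ℝ, w = a + b * Complex.I := ⟨w.re, w.im, by simp⟩
  rw [SchwartzMap.fourier_coe, Real.fourier_eq']
  refine integral_congr_ae (Eventually.of_forall fun x => ?_)
  simp only [expMul_apply, smul_eq_mul, inner_smul_left, inner_add_right, inner_smul_right,
    conj_trivial, Complex.add_re, Complex.add_im, Complex.ofReal_re, Complex.ofReal_im,
    Complex.mul_re, Complex.mul_im, Complex.I_re, Complex.I_im]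
  rw [mul_left_comm, ← mul_assoc, mul_comm, mul_assoc, ← Complex.exp_add, real_inner_comm v x]
  congr 2
  have hpi : (Real.pi : ℂ) ≠ 0 := by exact_mod_cast Real.pi_ne_zero
  push_cast
  field_simp
  linear_combination ((b : ℂ) * ⟪v, x⟫_ℝ) * Complex.I_sq

theorem continuous_fourier_expMul (v : E) (φ : 𝓢(E, ℂ)) (hφ : HasCompactSupport φ) :
    Continuous (fun p : E × ℝ => 𝓕 (expMul (p.2 • v) φ hφ) p.1) := by
  have e : (fun p : E × ℝ => 𝓕 (expMul (p.2 • v) φ hφ) p.1) = fun p : E × ℝ =>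
      ∫ x, φ x * Complex.exp (-2 * Real.pi * Complex.I * ⟪x, p.1⟫_ℝ -
        Complex.I * (p.2 * Complex.I) * ⟪v, x⟫_ℝ) := funext fun p => by
    simpa using fourier_expMul_eq v φ hφ p.1 (p.2 * Complex.I)
  rw [e, ← continuousOn_univ]
  refine continuousOn_integral_of_compact_support (k := tsupport φ) hφ.isCompact ?_ ?_
  · refine Continuous.continuousOn ?_
    have : Continuous φ := φ.continuous
    simp only [Function.uncurry_def]
    fun_prop
  · intro p x _ hx
    simp [image_eq_zero_of_notMem_tsupport hx]

theorem differentiable_fourier_expMul (v : E) (φ : 𝓢(E, ℂ)) (hφ : HasCompactSupport φ) (q : E) :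
    Differentiable ℂ (fun w : ℂ =>
      𝓕 (expMul (w.im • v) φ hφ) (q + w.re • ((2 * Real.pi)⁻¹ • v))) := by
  simp_rw [fourier_expMul_eq]
  intro w₀
  obtain ⟨B, hB⟩ := hφ.isCompact.exists_bound_of_continuousOn
    (f := fun x => ⟪v, x⟫_ℝ) (by fun_prop)
  set F : ℂ → E → ℂ := fun w x =>
    φ x * Complex.exp (-2 * Real.pi * Complex.I * ⟪x, q⟫_ℝ - Complex.I * w * ⟪v, x⟫_ℝ)
  set F' : ℂ → E → ℂ := fun w x =>
    φ x * (Complex.exp (-2 * Real.pi * Complex.I * ⟪x, q⟫_ℝ - Complex.I * w * ⟪v, x⟫_ℝ) *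
      (-(Complex.I * ⟪v, x⟫_ℝ)))
  have hFc : ∀ w, Continuous (F w) := fun w => by
    have : Continuous φ := φ.continuous
    simp only [F]
    fun_prop
  have hFc' : ∀ w, Continuous (F' w) := fun w => by
    have : Continuous φ := φ.continuous
    simp only [F']
    fun_prop
  have hFs : ∀ w, HasCompactSupport (F w) := fun w => hφ.mul_right
  -- For `w` in the unit ball about `w₀` one has `|Im w| ≤ ‖w₀‖ + 1`, and `|⟪v, x⟫| ≤ B` on the
  -- support of `φ`.
  have key := hasDerivAt_integral_of_dominated_loc_of_deriv_le (μ := (volume : Measure E))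
    (F := F) (F' := F') (x₀ := w₀) (s := Metric.ball w₀ 1)
    (bound := fun x => ‖φ x‖ * (Real.exp ((‖w₀‖ + 1) * B) * B))
    (Metric.ball_mem_nhds _ one_pos) (Eventually.of_forall fun w => (hFc w).aestronglyMeasurable)
    ((hFc w₀).integrable_of_hasCompactSupport (hFs w₀)) (hFc' w₀).aestronglyMeasurable
    (Eventually.of_forall fun x w hw => ?_) (φ.integrable.norm.mul_const _)
    (Eventually.of_forall fun x w _ => ?_)
  · exact key.2.differentiableAt
  · by_cases hx : x ∈ tsupport φ
    · have h1 := hB x hx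
      have hw' : ‖w‖ ≤ ‖w₀‖ + 1 := by
        have h2 : ‖w - w₀‖ < 1 := by simpa [dist_eq_norm] using hw
        have h3 := norm_sub_norm_le w w₀
        linarith
      simp only [F', norm_mul, Complex.norm_exp, norm_neg, Complex.norm_I, one_mul,
        Complex.norm_real]
      gcongr
      have h4 : (-2 * Real.pi * Complex.I * (⟪x, q⟫_ℝ : ℂ) - Complex.I * w * (⟪v, x⟫_ℝ : ℂ)).re =
        w.im * ⟪v, x⟫_ℝ := by simp
      rw [h4]
      refine (le_abs_self _).trans ?_
      rw [abs_mul]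
      gcongr
      · exact (Complex.abs_im_le_norm w).trans hw'
      · exact h1
    · simp [F', image_eq_zero_of_notMem_tsupport hx]
  · refine HasDerivAt.const_mul _ ?_
    refine HasDerivAt.cexp ?_
    have := (((hasDerivAt_id w).const_mul Complex.I).mul_const (⟪v, x⟫_ℝ : ℂ)).const_sub
      (-2 * Real.pi * Complex.I * (⟪x, q⟫_ℝ : ℂ))
    simpa using this

end Shift

/-! ### Multipliers with a holomorphic continuation in an imaginary direction. -/

section ShiftSymbol

open scoped ContDiff FourierTransform InnerProductSpace

variable {E : Type*} [NormedAddCommGroup E] [InnerProductSpace ℝ E]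

/-- A family of symbols `m · μ`, `0 ≤ μ`, which describes the values `m (q + i μ v / (2π))` of a
symbol having a holomorphic continuation in the imaginary direction `v`. -/
structure ShiftSymbol (v : E) (m : E → ℝ → ℂ) : Prop where
  continuousOn : ContinuousOn (Function.uncurry m) (Set.univ ×ˢ Set.Ici 0)
  differentiableOn : ∀ q, DifferentiableOn ℂ
    (fun w : ℂ => m (q + w.re • ((2 * Real.pi)⁻¹ • v)) w.im) {w | 0 < w.im}
  bound : ∃ (C : ℝ) (N : ℕ), 0 ≤ C ∧
    ∀ q μ, 0 ≤ μ → ‖m q μ‖ ≤ C * (1 + ‖q‖) ^ N * (1 + μ) ^ N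

theorem ShiftSymbol.mul {v : E} {m₁ m₂ : E → ℝ → ℂ} (h₁ : ShiftSymbol v m₁)
    (h₂ : ShiftSymbol v m₂) : ShiftSymbol v (fun q μ => m₁ q μ * m₂ q μ) := by
  refine ⟨h₁.continuousOn.mul h₂.continuousOn,
    fun q => (h₁.differentiableOn q).mul (h₂.differentiableOn q), ?_⟩
  obtain ⟨C₁, N₁, hC₁, b₁⟩ := h₁.bound
  obtain ⟨C₂, N₂, hC₂, b₂⟩ := h₂.bound
  refine ⟨C₁ * C₂, N₁ + N₂, by positivity, fun q μ hμ => ?_⟩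
  rw [norm_mul]
  calc _ ≤ (C₁ * (1 + ‖q‖) ^ N₁ * (1 + μ) ^ N₁) * (C₂ * (1 + ‖q‖) ^ N₂ * (1 + μ) ^ N₂) := by
        gcongr
        · exact b₁ q μ hμ
        · exact b₂ q μ hμ
    _ = _ := by ring

theorem ShiftSymbol.inv {v : E} {m : E → ℝ → ℂ} (h : ShiftSymbol v m)
    (h0 : ∀ q μ, 0 ≤ μ → m q μ ≠ 0)
    (hb : ∃ (C : ℝ) (N : ℕ), 0 ≤ C ∧
      ∀ q μ, 0 ≤ μ → ‖(m q μ)⁻¹‖ ≤ C * (1 + ‖q‖) ^ N * (1 + μ) ^ N) :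
    ShiftSymbol v (fun q μ => (m q μ)⁻¹) :=
  ⟨h.continuousOn.inv₀ fun p hp => h0 p.1 p.2 hp.2,
    fun q => (h.differentiableOn q).inv fun _ hw => h0 _ _ (le_of_lt hw), hb⟩

variable [FiniteDimensional ℝ E] [MeasurableSpace E] [BorelSpace E]

/-- Multipliers with a holomorphic continuation in an imaginary direction intertwine
multiplication with exponential weights. -/
theorem ShiftSymbol.fourierInv_expMul {v : E} {m : E → ℝ → ℂ} (h : ShiftSymbol v m)
    (φ : 𝓢(E, ℂ)) (hφ : HasCompactSupport φ) {Λ : ℝ} (hΛ : 0 ≤ Λ) (y : E) :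
    𝓕⁻ (fun q => m q Λ * 𝓕 (expMul (Λ • v) φ hφ) q) y =
      Complex.exp ((⟪Λ • v, y⟫_ℝ : ℝ) : ℂ) * 𝓕⁻ (fun q => m q 0 * 𝓕 φ q) y := by
  -- The extra factor `exp (-μ ⟪v, y⟫)` continues the inverse Fourier kernel, so that `H` is
  -- holomorphic along `v`.
  set H : E → ℝ → ℂ := fun q μ => m q μ * 𝓕 (expMul (μ • v) φ hφ) q *
    Complex.exp (2 * Real.pi * Complex.I * ⟪q, y⟫_ℝ - μ * ⟪v, y⟫_ℝ) with hH
  obtain ⟨C, N, hC, hm⟩ := h.bound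
  obtain ⟨B, hB⟩ := hφ.isCompact.exists_bound_of_continuousOn
    (f := fun x => ⟪v, x⟫_ℝ) (by fun_prop)
  -- Of the powers of decay, `N` compensate the growth of `m`, and the remaining `finrank + 1` give
  -- the integrable `decayWeight`.
  obtain ⟨D, hD, hF⟩ := exists_norm_fourier_expMul_le v φ hφ (b := |B|)
    (fun x hx => (le_abs_self _).trans ((hB x hx).trans (le_abs_self _))) one_pos
    (N + (Module.finrank ℝ E + 1))
  have key : ∫ q, H q 0 = ∫ q, H q Λ := by
    refine integral_shift (v := (2 * Real.pi)⁻¹ • v) hΛ ?_ ?_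
      (C := C * (1 + Λ) ^ N * (D * Real.exp (Λ * (|B| + 1))) * Real.exp (Λ * |⟪v, y⟫_ℝ|))
      (by positivity) ?_
    · refine ((h.continuousOn.mono (Set.prod_mono subset_rfl Set.Icc_subset_Ici_self)).mul
        (continuous_fourier_expMul v φ hφ).continuousOn).mul (Continuous.continuousOn ?_)
      fun_prop
    · intro q
      have e : (fun w : ℂ => H (q + w.re • ((2 * Real.pi)⁻¹ • v)) w.im) = fun w : ℂ =>
          m (q + w.re • ((2 * Real.pi)⁻¹ • v)) w.im *
          𝓕 (expMul (w.im • v) φ hφ) (q + w.re • ((2 * Real.pi)⁻¹ • v)) *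
          Complex.exp (2 * Real.pi * Complex.I * ⟪q, y⟫_ℝ + Complex.I * w * ⟪v, y⟫_ℝ) := by
        ext w
        simp only [hH]
        congr 2
        obtain ⟨a, b, rfl⟩ : ∃ a b : ℝ, w = a + b * Complex.I := ⟨w.re, w.im, by simp⟩
        simp only [inner_smul_left, inner_add_left, conj_trivial, Complex.add_re, Complex.add_im,
          Complex.ofReal_re, Complex.ofReal_im, Complex.mul_re, Complex.mul_im, Complex.I_re,
          Complex.I_im]
        have hpi : (Real.pi : ℂ) ≠ 0 := by exact_mod_cast Real.pi_ne_zero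
        push_cast
        field_simp
        linear_combination (-(b : ℂ) * ⟪v, y⟫_ℝ) * Complex.I_sq
      rw [e]
      refine (((h.differentiableOn q).mono fun w hw => hw.1).mul
        (differentiable_fourier_expMul v φ hφ q).differentiableOn).mul ?_
      exact Differentiable.differentiableOn (by fun_prop)
    · intro q μ hμ
      have h1 := hm q μ hμ.1
      have h2 := hF μ hμ.1 q
      have h3 : ‖Complex.exp (2 * Real.pi * Complex.I * ⟪q, y⟫_ℝ - μ * ⟪v, y⟫_ℝ)‖ ≤
          Real.exp (Λ * |⟪v, y⟫_ℝ|) := by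
        rw [Complex.norm_exp]
        gcongr
        simp only [Complex.sub_re, Complex.mul_re, Complex.I_re, Complex.I_im, Complex.ofReal_re,
          Complex.ofReal_im, Complex.mul_im]
        simp
        have h4 := neg_abs_le ⟪v, y⟫_ℝ
        nlinarith [abs_nonneg ⟪v, y⟫_ℝ, hμ.1, hμ.2]
      simp only [hH, norm_mul]
      rw [pow_add] at h2
      have h5 : (1 + ‖q‖) ^ N * ‖𝓕 (expMul (μ • v) φ hφ) q‖ ≤
          D * Real.exp (Λ * (|B| + 1)) * decayWeight q := by
        unfold decayWeight
        rw [← div_eq_mul_inv, le_div_iff₀ (by positivity)]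
        calc _ = _ := by ring
          _ ≤ _ := h2
          _ ≤ _ := by
            gcongr
            exact hμ.2
      calc _ ≤ (C * (1 + ‖q‖) ^ N * (1 + Λ) ^ N) * ‖𝓕 (expMul (μ • v) φ hφ) q‖ *
            Real.exp (Λ * |⟪v, y⟫_ℝ|) := by
            gcongr
            refine h1.trans ?_
            have := hμ.1
            gcongr
            exact hμ.2
        _ = C * (1 + Λ) ^ N * ((1 + ‖q‖) ^ N * ‖𝓕 (expMul (μ • v) φ hφ) q‖) *
            Real.exp (Λ * |⟪v, y⟫_ℝ|) := by ring
        _ ≤ C * (1 + Λ) ^ N * (D * Real.exp (Λ * (|B| + 1)) * decayWeight q) *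
            Real.exp (Λ * |⟪v, y⟫_ℝ|) := by gcongr
        _ = _ := by ring
  have e0 : ∫ q, H q 0 = 𝓕⁻ (fun q => m q 0 * 𝓕 φ q) y := by
    rw [Real.fourierInv_eq']
    refine integral_congr_ae (Eventually.of_forall fun q => ?_)
    have : expMul ((0 : ℝ) • v) φ hφ = φ := by
      ext x
      simp [expMul_apply]
    simp only [hH, this, smul_eq_mul, Complex.ofReal_zero, zero_mul, sub_zero]
    rw [mul_comm]
    push_cast
    congr 2
    ring
  have e1 : Complex.exp ((⟪Λ • v, y⟫_ℝ : ℝ) : ℂ) * ∫ q, H q Λ =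
      𝓕⁻ (fun q => m q Λ * 𝓕 (expMul (Λ • v) φ hφ) q) y := by
    rw [Real.fourierInv_eq', ← integral_const_mul]
    refine integral_congr_ae (Eventually.of_forall fun q => ?_)
    simp only [hH, smul_eq_mul, inner_smul_left, conj_trivial]
    rw [mul_left_comm, ← Complex.exp_add, mul_comm]
    push_cast
    congr 2
    ring
  rw [← e0, ← e1, key]

theorem eq_zero_of_norm_le_pow_mul_exp {V : ℂ} {C δ : ℝ} {N : ℕ} (hδ : 0 < δ)
    (h : ∀ Λ : ℝ, 0 ≤ Λ → ‖V‖ ≤ C * (1 + Λ) ^ N * Real.exp (-(δ * Λ))) : V = 0 := by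
  have h1 : Tendsto (fun Λ : ℝ => C * (1 + Λ) ^ N * Real.exp (-(δ * Λ))) atTop (𝓝 0) := by
    have h2 : Tendsto (fun Λ : ℝ => δ * (1 + Λ)) atTop atTop :=
      (tendsto_atTop_add_const_left atTop 1 tendsto_id).const_mul_atTop hδ
    have h3 := ((Real.tendsto_pow_mul_exp_neg_atTop_nhds_zero N).comp h2).const_mul
      (C * Real.exp δ / δ ^ N)
    rw [mul_zero] at h3
    refine h3.congr fun Λ => ?_
    simp only [Function.comp_apply]
    rw [mul_add δ 1 Λ, mul_one, neg_add, Real.exp_add, Real.exp_neg δ,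
      show δ + δ * Λ = δ * (1 + Λ) by ring, mul_pow]
    have := Real.exp_pos δ
    field_simp
  have h2 := ge_of_tendsto h1 (eventually_atTop.2 ⟨0, h⟩)
  simpa using h2

/-- Multipliers with a holomorphic continuation in an imaginary direction preserve supports in
the corresponding half-spaces. -/
theorem ShiftSymbol.fourierInv_eq_zero {v : E} {m : E → ℝ → ℂ} (h : ShiftSymbol v m)
    (φ : 𝓢(E, ℂ)) (hφ : HasCompactSupport φ) {b : ℝ} (hb : ∀ x ∈ tsupport φ, ⟪v, x⟫_ℝ ≤ b)
    {y : E} (hy : b < ⟪v, y⟫_ℝ) : 𝓕⁻ (fun q => m q 0 * 𝓕 φ q) y = 0 := by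
  obtain ⟨C, N, hC, hm⟩ := h.bound
  -- With half the gap, `b + ε = ⟪v, y⟫ - ε`: after division by `exp (Λ ⟪v, y⟫)` a factor `exp (-ε
  -- Λ)` remains, and it beats the polynomial in `Λ`.
  set ε := (⟪v, y⟫_ℝ - b) / 2 with hε
  have hε0 : 0 < ε := by rw [hε]; linarith
  obtain ⟨D, hD, hF⟩ := exists_norm_fourier_expMul_le v φ hφ hb hε0
    (N + (Module.finrank ℝ E + 1))
  refine eq_zero_of_norm_le_pow_mul_exp (C := C * D * ∫ q : E, decayWeight q) (N := N) hε0
    fun Λ hΛ => ?_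
  have h1 := h.fourierInv_expMul φ hφ hΛ y
  have h2 : ‖𝓕⁻ (fun q => m q Λ * 𝓕 (expMul (Λ • v) φ hφ) q) y‖ ≤
      C * (1 + Λ) ^ N * (D * Real.exp (Λ * (b + ε))) * ∫ q : E, decayWeight q := by
    rw [Real.fourierInv_eq', ← integral_const_mul]
    refine norm_integral_le_of_norm_le (integrable_decayWeight.const_mul _)
      (Eventually.of_forall fun q => ?_)
    rw [smul_eq_mul, norm_mul, norm_mul]
    have h3 : ‖Complex.exp (((2 * Real.pi * ⟪q, y⟫_ℝ : ℝ) : ℂ) * Complex.I)‖ = 1 :=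
      Complex.norm_exp_ofReal_mul_I _
    rw [h3, one_mul]
    have h4 := hF Λ hΛ q
    have h5 : (1 + ‖q‖) ^ N * ‖𝓕 (expMul (Λ • v) φ hφ) q‖ ≤
        D * Real.exp (Λ * (b + ε)) * decayWeight q := by
      unfold decayWeight
      rw [← div_eq_mul_inv, le_div_iff₀ (by positivity)]
      calc _ = _ := by ring
        _ ≤ _ := h4
    calc _ ≤ (C * (1 + ‖q‖) ^ N * (1 + Λ) ^ N) * ‖𝓕 (expMul (Λ • v) φ hφ) q‖ := by
          gcongr
          exact hm q Λ hΛ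
      _ = C * (1 + Λ) ^ N * ((1 + ‖q‖) ^ N * ‖𝓕 (expMul (Λ • v) φ hφ) q‖) := by ring
      _ ≤ C * (1 + Λ) ^ N * (D * Real.exp (Λ * (b + ε)) * decayWeight q) := by gcongr
      _ = _ := by ring
  have h6 := congrArg norm h1
  rw [norm_mul, Complex.norm_exp, Complex.ofReal_re, inner_smul_left, conj_trivial] at h6
  rw [h6] at h2
  have h7 : Real.exp (Λ * (b + ε)) = Real.exp (Λ * ⟪v, y⟫_ℝ) * Real.exp (-(ε * Λ)) := by
    rw [← Real.exp_add]
    congr 1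
    rw [hε]
    ring
  rw [h7] at h2
  have h8 := Real.exp_pos (Λ * ⟪v, y⟫_ℝ)
  refine le_of_mul_le_mul_left (h2.trans (le_of_eq ?_)) h8
  ring

end ShiftSymbol

/-! ### Temperate growth of inverses and of holomorphic functions on horizontal lines. -/

section TemperateGrowth

open scoped ContDiff

variable {V W : Type*} [NormedAddCommGroup V] [NormedSpace ℝ V] [NormedAddCommGroup W]
  [NormedSpace ℝ W]

/-- Polynomial bounds for the derivatives of order at most `n`. -/
def PolyBoundUpTo (n : ℕ) (f : V → W) : Prop :=
  ∃ (k : ℕ) (C : ℝ), 0 ≤ C ∧ ∀ i ≤ n, ∀ x, ‖iteratedFDeriv ℝ i f x‖ ≤ C * (1 + ‖x‖) ^ k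

theorem PolyBoundUpTo.smul [NormedSpace ℂ W] {n : ℕ} {f : V → ℂ}
    {g : V → W} (hf : ContDiff ℝ ∞ f) (hg : ContDiff ℝ ∞ g) (bf : PolyBoundUpTo n f)
    (bg : PolyBoundUpTo n g) [IsScalarTower ℝ ℂ W] : PolyBoundUpTo n (fun x => f x • g x) := by
  obtain ⟨k₁, C₁, hC₁, b₁⟩ := bf
  obtain ⟨k₂, C₂, hC₂, b₂⟩ := bg
  refine ⟨k₁ + k₂, 2 ^ n * (C₁ * C₂), by positivity, fun i hi x => ?_⟩
  refine (norm_iteratedFDeriv_smul_le (N := ∞) hf hg x (mod_cast le_top)).trans ?_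
  calc _ ≤ ∑ j ∈ Finset.range (i + 1), (i.choose j : ℝ) *
        (C₁ * (1 + ‖x‖) ^ k₁) * (C₂ * (1 + ‖x‖) ^ k₂) := by
        refine Finset.sum_le_sum fun j hj => ?_
        have : j ≤ i := Nat.lt_succ_iff.1 (Finset.mem_range.1 hj)
        gcongr
        · exact b₁ j (this.trans hi) x
        · exact b₂ (i - j) ((Nat.sub_le _ _).trans hi) x
    _ = 2 ^ i * (C₁ * C₂) * (1 + ‖x‖) ^ (k₁ + k₂) := by
        rw [← Finset.sum_mul, ← Finset.sum_mul]
        have := Nat.sum_range_choose i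
        have h2 : ∑ j ∈ Finset.range (i + 1), (i.choose j : ℝ) = 2 ^ i := by exact_mod_cast this
        rw [h2]
        ring
    _ ≤ _ := by
        gcongr
        exact one_le_two

/-- The inverse of a function of temperate growth has temperate growth if it is polynomially
bounded. -/
theorem hasTemperateGrowth_inv {f : V → ℂ} (hf : f.HasTemperateGrowth) (h0 : ∀ x, f x ≠ 0)
    {C : ℝ} {N : ℕ} (hb : ∀ x, ‖(f x)⁻¹‖ ≤ C * (1 + ‖x‖) ^ N) :
    (fun x => (f x)⁻¹).HasTemperateGrowth := by
  have hs : ContDiff ℝ ∞ (fun x => (f x)⁻¹) := hf.1.inv h0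
  have hs' : ContDiff ℝ ∞ (fderiv ℝ f) := hf.1.fderiv_right (by simp)
  have hd : fderiv ℝ (fun x => (f x)⁻¹) = fun x => ((f x)⁻¹ • (f x)⁻¹) • (-fderiv ℝ f x) := by
    ext x y
    have h1 := (hasFDerivAt_inv' (𝕜 := ℝ) (h0 x)).comp x
      ((hf.1.differentiable (by simp)).differentiableAt (x := x)).hasFDerivAt
    have h2 : (fun x => (f x)⁻¹) = Inv.inv ∘ f := rfl
    rw [h2, h1.fderiv]
    simp
    ring
  -- Induction through `(1/f)' = -f⁻² f'`. The Leibniz rule on the right involves all lower orders,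
  -- hence bounds up to order `n` and not at order `n` alone.
  have key : ∀ n, PolyBoundUpTo n (fun x => (f x)⁻¹) := by
    intro n
    induction n with
    | zero =>
      refine ⟨N, |C|, abs_nonneg C, fun i hi x => ?_⟩
      obtain rfl : i = 0 := by omega
      rw [norm_iteratedFDeriv_zero]
      refine (hb x).trans ?_
      gcongr
      exact le_abs_self C
    | succ n ih =>
      have hg : PolyBoundUpTo n (fun x => -fderiv ℝ f x) := by
        obtain ⟨k, D, hD, hk⟩ := hf.norm_iteratedFDeriv_le_uniform (n + 1)
        refine ⟨k, D, hD, fun i hi x => ?_⟩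
        have e : (fun x => -fderiv ℝ f x) = -fderiv ℝ f := rfl
        rw [e, iteratedFDeriv_neg, Pi.neg_apply, norm_neg, norm_iteratedFDeriv_fderiv]
        exact hk _ (by omega) x
      have h3 : PolyBoundUpTo n (fderiv ℝ (fun x => (f x)⁻¹)) := by
        rw [hd]
        exact (ih.smul hs hs ih).smul (hs.smul hs) hs'.neg hg
      obtain ⟨k, D, hD, hk⟩ := h3
      refine ⟨max k N, max D |C|, by positivity, fun i hi x => ?_⟩
      rcases i with _ | i
      · rw [norm_iteratedFDeriv_zero]
        refine (hb x).trans ?_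
        gcongr
        · exact (le_abs_self C).trans (le_max_right _ _)
        · linarith [norm_nonneg x]
        · exact le_max_right _ _
      · rw [← norm_iteratedFDeriv_fderiv]
        refine (hk i (by omega) x).trans ?_
        gcongr
        · exact le_max_left _ _
        · linarith [norm_nonneg x]
        · exact le_max_left _ _
  refine ⟨hs, fun n => ?_⟩
  obtain ⟨k, C, -, h⟩ := key n
  exact ⟨k, C, h n le_rfl⟩

theorem contDiffAt_of_differentiableOn_upperHalfPlane {F : ℂ → ℂ}
    (hF : DifferentiableOn ℂ F {z : ℂ | 0 < z.im}) {η : ℝ} (hη : 0 < η) :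
    ContDiff ℝ ∞ (fun τ : ℝ => F (τ + η * Complex.I)) := by
  have ho : IsOpen {z : ℂ | 0 < z.im} := isOpen_lt continuous_const Complex.continuous_im
  have h1 := hF.analyticOnNhd ho
  rw [contDiff_iff_contDiffAt]
  intro τ
  have h2 : ContDiffAt ℂ ∞ F (τ + η * Complex.I) := (h1 _ (by simpa using hη)).contDiffAt
  exact ContDiffAt.comp (𝕜 := ℝ) τ (h2.restrict_scalars ℝ)
    (Complex.ofRealCLM.contDiff.add contDiff_const).contDiffAt

theorem iteratedDeriv_horizontal {F : ℂ → ℂ}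
    (hF : DifferentiableOn ℂ F {z : ℂ | 0 < z.im}) {η : ℝ} (hη : 0 < η) (n : ℕ) :
    iteratedDeriv n (fun τ : ℝ => F (τ + η * Complex.I)) =
      fun τ : ℝ => iteratedDeriv n F (τ + η * Complex.I) := by
  have ho : IsOpen {z : ℂ | 0 < z.im} := isOpen_lt continuous_const Complex.continuous_im
  have h1 := hF.analyticOnNhd ho
  induction n with
  | zero => simp
  | succ n ih =>
    rw [iteratedDeriv_succ, ih]
    ext τ
    rw [iteratedDeriv_succ]
    have h2 : DifferentiableAt ℂ (iteratedDeriv n F) (τ + η * Complex.I) := by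
      rw [iteratedDeriv_eq_iterate]
      exact (h1.iterated_deriv n _ (by simpa using hη)).differentiableAt
    have h3 := h2.hasDerivAt.comp_add_const (τ : ℂ) (η * Complex.I)
    exact h3.comp_ofReal.deriv

/-- A polynomially bounded holomorphic function on the upper half plane has temperate growth on
horizontal lines. -/
theorem hasTemperateGrowth_horizontal {F : ℂ → ℂ}
    (hF : DifferentiableOn ℂ F {z : ℂ | 0 < z.im}) {C : ℝ} {N : ℕ}
    (hb : ∀ z : ℂ, 0 ≤ z.im → ‖F z‖ ≤ C * (1 + ‖z‖) ^ N) {η : ℝ} (hη : 0 < η) :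
    (fun τ : ℝ => F (τ + η * Complex.I)).HasTemperateGrowth := by
  refine ⟨contDiffAt_of_differentiableOn_upperHalfPlane hF hη, fun n => ?_⟩
  refine ⟨N, n.factorial * (|C| * (1 + 2 * η) ^ N) / (η / 2) ^ n, fun τ => ?_⟩
  rw [norm_iteratedFDeriv_eq_norm_iteratedDeriv, iteratedDeriv_horizontal hF hη]
  have h1 : ∀ z ∈ Metric.closedBall (τ + η * Complex.I : ℂ) (η / 2), 0 < z.im := by
    intro z hz
    have h2 := (Complex.abs_im_le_norm (z - (τ + η * Complex.I))).trans
      (by simpa [dist_eq_norm] using hz)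
    have h3 := (abs_le.1 h2).1
    simp at h3
    linarith
  -- Cauchy estimates on discs of radius `η / 2`, which stay in the open upper half plane. On them
  -- `1 + ‖z‖ ≤ (1 + 2η)(1 + ‖τ‖)`.
  have h2 := Complex.norm_iteratedDeriv_le_of_forall_mem_sphere_norm_le (c := τ + η * Complex.I)
    (R := η / 2) (C := |C| * (1 + 2 * η) ^ N * (1 + ‖τ‖) ^ N) (f := F) n (by positivity) ?_ ?_
  · refine h2.trans (le_of_eq ?_)
    ring
  · refine DifferentiableOn.diffContOnCl (hF.mono ?_)
    rw [closure_ball _ (by positivity)]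
    exact h1
  · intro z hz
    have hz' := h1 z (Metric.sphere_subset_closedBall hz)
    refine (hb z hz'.le).trans ?_
    rw [mul_assoc, ← mul_pow]
    have h3 : ‖z‖ ≤ ‖τ‖ + η + η / 2 := by
      have h4 : ‖z - (τ + η * Complex.I)‖ = η / 2 := by simpa [dist_eq_norm] using hz
      have h5 : ‖(τ + η * Complex.I : ℂ)‖ ≤ ‖τ‖ + η := by
        refine (norm_add_le _ _).trans (le_of_eq ?_)
        simp [abs_of_pos hη]
      have h6 := norm_le_norm_add_norm_sub' z (τ + η * Complex.I)
      linarith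
    gcongr
    · exact le_abs_self C
    · nlinarith [norm_nonneg τ]

end TemperateGrowth

/-! ### Positivity of the imaginary part and a Schwarz–Pick estimate. -/

section UpperHalfPlane

theorem isOpen_upperHalfPlane : IsOpen {z : ℂ | 0 < z.im} :=
  isOpen_lt continuous_const Complex.continuous_im

/-- At an interior zero of `Im κt` the modulus of `exp (i κt)` attains its maximum `1`. Hence `κt`
is a real constant, and by continuity so is `κ`. The symmetry at `ω = 0` forces this constant to be
imaginary as well, so `κ = 0`. -/
theorem IsHolomorphicContinuation.im_pos {κ : ℝ → ℂ} {κt : ℂ → ℂ}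
    (hκ : IsAttenuationCoefficient κ) (hκt : IsHolomorphicContinuation κ κt) {z : ℂ}
    (hz : 0 < z.im) : 0 < (κt z).im := by
  by_contra hcon
  have him : (κt z).im = 0 := le_antisymm (not_lt.1 hcon) (hκt.im_nonneg z hz.le)
  have hconn : IsPreconnected {z : ℂ | 0 < z.im} := (convex_halfSpace_im_gt 0).isPreconnected
  have hexp : DifferentiableOn ℂ (fun w => Complex.exp (Complex.I * κt w)) {z : ℂ | 0 < z.im} :=
    (hκt.differentiableOn.const_mul Complex.I).cexp
  have hnorm : ∀ w, ‖Complex.exp (Complex.I * κt w)‖ = Real.exp (-(κt w).im) := fun w => by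
    simp [Complex.norm_exp]
  have h1 := Complex.eqOn_of_isPreconnected_of_isMaxOn_norm hconn isOpen_upperHalfPlane hexp
    (show z ∈ {z : ℂ | 0 < z.im} from hz) (fun w hw => by
      simp only [Set.mem_ofPred_eq, Function.comp_apply, hnorm, him, neg_zero, Real.exp_zero]
      exact Real.exp_le_one_iff.2 (by linarith [hκt.im_nonneg w (le_of_lt hw)]))
  have hd : Set.EqOn (deriv κt) 0 {z : ℂ | 0 < z.im} := by
    intro w hw
    have hw' := (hκt.differentiableOn.differentiableAt (isOpen_upperHalfPlane.mem_nhds hw)).hasDerivAt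
    have h2 := (hw'.const_mul Complex.I).cexp
    have h3 : (fun w => Complex.exp (Complex.I * κt w)) =ᶠ[𝓝 w]
        fun _ => Complex.exp (Complex.I * κt z) := by
      filter_upwards [isOpen_upperHalfPlane.mem_nhds hw] with y hy using h1 hy
    have h4 := h2.unique ((hasDerivAt_const w _).congr_of_eventuallyEq h3)
    simpa [Complex.exp_ne_zero] using h4
  have hconst : ∀ w : ℂ, 0 < w.im → κt w = κt z := fun w hw =>
    isOpen_upperHalfPlane.is_const_of_deriv_eq_zero hconn hκt.differentiableOn hd hw hz
  have hreal : ∀ ω : ℝ, κ ω = κt z := by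
    intro ω
    have hcl : (ω : ℂ) ∈ closure {z : ℂ | 0 < z.im} := by
      rw [Complex.closure_setOfPred_lt_im]
      simp
    have : (𝓝[{z : ℂ | 0 < z.im}] (ω : ℂ)).NeBot := mem_closure_iff_nhdsWithin_neBot.1 hcl
    have h5 : Tendsto κt (𝓝[{z : ℂ | 0 < z.im}] (ω : ℂ)) (𝓝 (κt ω)) :=
      (hκt.continuousOn (ω : ℂ) (by simp)).mono_left
        (nhdsWithin_mono _ fun w (hw : 0 < w.im) => le_of_lt hw)
    have h6 : Tendsto κt (𝓝[{z : ℂ | 0 < z.im}] (ω : ℂ)) (𝓝 (κt z)) :=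
      tendsto_const_nhds.congr' (by
        filter_upwards [self_mem_nhdsWithin] with w hw using (hconst w hw).symm)
    rw [← hκt.apply_ofReal]
    exact tendsto_nhds_unique h5 h6
  have hs := hκ.symm 0
  rw [hreal, hreal] at hs
  have h0 : κt z = 0 := by
    apply Complex.ext
    · have := congrArg Complex.re hs
      simp at this
      simp
      linarith
    · simpa using him
  exact hκ.ne_zero (funext fun ω => by simp [hreal, h0])

/-- This shows that `(a - b) / (a - conj b)` maps the upper half plane into the unit disc, and by
how much its modulus stays below `1`. -/
theorem normSq_sub_conj_sub (a b : ℂ) :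
    ‖a - (starRingEnd ℂ) b‖ ^ 2 - ‖a - b‖ ^ 2 = 4 * a.im * b.im := by
  rw [← Complex.normSq_eq_norm_sq, ← Complex.normSq_eq_norm_sq, Complex.normSq_apply,
    Complex.normSq_apply]
  simp
  ring

/-- A lower bound for the imaginary part of a holomorphic self-map of the upper half plane. -/
theorem le_im_of_mapsTo_upperHalfPlane {F : ℂ → ℂ}
    (hF : DifferentiableOn ℂ F {z : ℂ | 0 < z.im}) (hpos : ∀ z : ℂ, 0 < z.im → 0 < (F z).im)
    {z : ℂ} (hz : 0 < z.im) :
    (F Complex.I).im * z.im ≤ (F z).im * ‖z + Complex.I‖ ^ 2 := by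
  set k := F Complex.I with hk
  have hk0 : 0 < k.im := hpos _ (by simp)
  -- `T` is the inverse Cayley transform, taking `0` to `i`. Below, `f` is `F` read in disc
  -- coordinates centred at `i` and at `F i`, so `f 0 = 0` and the Schwarz lemma applies.
  let T : ℂ → ℂ := fun w => Complex.I * ((1 + w) / (1 - w))
  have hne : ∀ w ∈ Metric.ball (0 : ℂ) 1, 1 - w ≠ 0 := fun w hw h => by
    rw [sub_eq_zero] at h
    simp [← h] at hw
  have hT : ∀ w ∈ Metric.ball (0 : ℂ) 1, 0 < (T w).im := fun w hw => by
    have h1 : (T w).im = (1 - ‖w‖ ^ 2) / ‖1 - w‖ ^ 2 := by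
      rw [← Complex.normSq_eq_norm_sq, ← Complex.normSq_eq_norm_sq]
      simp only [T, Complex.I_mul_im, Complex.div_re]
      rw [← add_div]
      congr 1
      simp [Complex.normSq_apply]
      ring
    rw [h1]
    have h2 : ‖w‖ < 1 := by simpa using hw
    have h3 := norm_pos_iff.2 (hne w hw)
    have h4 : 0 < 1 - ‖w‖ ^ 2 := by nlinarith [norm_nonneg w]
    positivity
  have hden : ∀ u : ℂ, 0 < u.im → u - (starRingEnd ℂ) k ≠ 0 := fun u hu h => by
    have := congrArg Complex.im h
    simp at this
    linarith
  let f : ℂ → ℂ := fun w => (F (T w) - k) / (F (T w) - (starRingEnd ℂ) k)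
  have hTd : DifferentiableOn ℂ T (Metric.ball 0 1) :=
    ((differentiableOn_const _).add differentiableOn_id).div
      ((differentiableOn_const _).sub differentiableOn_id) hne |>.const_mul _
  have hFT : DifferentiableOn ℂ (fun w => F (T w)) (Metric.ball 0 1) := hF.comp hTd hT
  have hf : DifferentiableOn ℂ f (Metric.ball 0 1) :=
    (hFT.sub (differentiableOn_const _)).div (hFT.sub (differentiableOn_const _))
      fun w hw => hden _ (hpos _ (hT w hw))
  have hmaps : Set.MapsTo f (Metric.ball 0 1) (Metric.ball 0 1) := fun w hw => by
    have h1 := hpos _ (hT w hw)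
    have h2 := normSq_sub_conj_sub (F (T w)) k
    have h3 := norm_pos_iff.2 (hden _ h1)
    have h4 : 0 < 4 * (F (T w)).im * k.im := by positivity
    simp only [f, Metric.mem_ball, dist_zero_right, norm_div]
    rw [div_lt_one h3]
    exact lt_of_pow_lt_pow_left₀ 2 h3.le (by linarith)
  have hzI : z + Complex.I ≠ 0 := fun h => by
    have := congrArg Complex.im h
    simp at this
    linarith
  have hnum := normSq_sub_conj_sub z Complex.I
  simp only [Complex.conj_I, sub_neg_eq_add, Complex.I_im, mul_one] at hnum
  have hw : ‖(z - Complex.I) / (z + Complex.I)‖ < 1 := by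
    rw [norm_div, div_lt_one (norm_pos_iff.2 hzI)]
    exact lt_of_pow_lt_pow_left₀ 2 (norm_nonneg _) (by linarith)
  have hTz : T ((z - Complex.I) / (z + Complex.I)) = z := by
    have h1 : 1 - (z - Complex.I) / (z + Complex.I) = 2 * Complex.I / (z + Complex.I) := by
      field_simp
      ring
    have h2 : 1 + (z - Complex.I) / (z + Complex.I) = 2 * z / (z + Complex.I) := by
      field_simp
      ring
    simp only [T]
    rw [h1, h2]
    have := Complex.I_ne_zero
    field_simp
  have key := Complex.norm_le_norm_of_mapsTo_ball hf (hmaps.mono_right Metric.ball_subset_closedBall) (by simp [f, T, ← hk]) hw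
  simp only [f, hTz, norm_div] at key
  have hz0 := hpos z hz
  have h3 := norm_pos_iff.2 (hden _ hz0)
  rw [div_le_div_iff₀ h3 (norm_pos_iff.2 hzI)] at key
  have h5 := normSq_sub_conj_sub (F z) k
  have h6 : (‖F z - k‖ * ‖z + Complex.I‖) ^ 2 ≤
      (‖z - Complex.I‖ * ‖F z - (starRingEnd ℂ) k‖) ^ 2 := by gcongr
  have h7 : k.im ≤ ‖F z - (starRingEnd ℂ) k‖ := by
    refine le_trans ?_ (Complex.abs_im_le_norm _)
    refine le_trans ?_ (le_abs_self _)
    simp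
    exact hz0.le
  have h8 : k.im ^ 2 ≤ ‖F z - (starRingEnd ℂ) k‖ ^ 2 := by gcongr
  -- Replacing `‖F z - k‖²` and `‖z - i‖²` in `h6` by means of `h5` and `hnum` cancels the main
  -- terms.
  have h9 : ‖F z - (starRingEnd ℂ) k‖ ^ 2 * z.im ≤ ‖z + Complex.I‖ ^ 2 * (F z).im * k.im := by
    nlinarith
  have h10 : k.im * (k.im * z.im) ≤ k.im * ((F z).im * ‖z + Complex.I‖ ^ 2) := by nlinarith
  exact le_of_mul_le_mul_left h10 hk0

end UpperHalfPlane

/-! ### The weighted wave symbol: lower bound and holomorphic dependence on the weight. -/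

section Symbol

open scoped InnerProductSpace

/-- The complex frequency `2πτ + iη`. -/
noncomputable def freq (η : ℝ) (q : SpaceTime) : ℂ :=
  ((2 * Real.pi * q.fst : ℝ) : ℂ) + η * Complex.I

/-- The symbol `ζ ⬝ ζ - κt(z) ^ 2` of the attenuated wave operator at the complex covector
`z = 2πτ + iη`, `ζ = 2πξ + iα`, where `v = (η, α)`. -/
noncomputable def waveSymbol (κt : ℂ → ℂ) (v q : SpaceTime) : ℂ :=
  (((2 * Real.pi) ^ 2 * ‖q.snd‖ ^ 2 - ‖v.snd‖ ^ 2 : ℝ) : ℂ) +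
    ((4 * Real.pi * ⟪q.snd, v.snd⟫_ℝ : ℝ) : ℂ) * Complex.I - κt (freq v.fst q) ^ 2

theorem freq_im (η : ℝ) (q : SpaceTime) : (freq η q).im = η := by simp [freq]

theorem freq_re (η : ℝ) (q : SpaceTime) : (freq η q).re = 2 * Real.pi * q.fst := by simp [freq]

theorem norm_fst_le (q : SpaceTime) : |q.fst| ≤ ‖q‖ := by
  have h : q.fst ^ 2 ≤ ‖q‖ ^ 2 := by
    rw [WithLp.prod_norm_sq_eq_of_L2]
    simp
  exact abs_le_of_sq_le_sq h (norm_nonneg _)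

theorem norm_snd_le (q : SpaceTime) : ‖q.snd‖ ≤ ‖q‖ := by
  have h : ‖q.snd‖ ^ 2 ≤ ‖q‖ ^ 2 := by
    rw [WithLp.prod_norm_sq_eq_of_L2]
    simp
    positivity
  exact abs_le_of_sq_le_sq' h (norm_nonneg _) |>.2

theorem norm_freq_le (η : ℝ) (q : SpaceTime) : ‖freq η q‖ ≤ 7 * ‖q‖ + |η| := by
  refine (norm_add_le _ _).trans ?_
  have h := norm_fst_le q
  have h1 := Real.pi_pos
  have h2 := Real.pi_lt_d2
  rw [norm_mul, Complex.norm_I, mul_one, Complex.norm_real, Complex.norm_real, Real.norm_eq_abs,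
    Real.norm_eq_abs, abs_mul, abs_of_pos (by positivity)]
  nlinarith [abs_nonneg q.fst]

theorem continuous_freq : Continuous (fun p : ℝ × SpaceTime => freq p.1 p.2) := by
  unfold freq
  have : Continuous (fun p : ℝ × SpaceTime => p.2.fst) :=
    (WithLp.fstL 2 ℝ ℝ Space3).continuous.comp continuous_snd
  fun_prop

theorem hasTemperateGrowth_waveSymbol_of {κt : ℂ → ℂ} (v : SpaceTime)
    (h : (fun τ : ℝ => κt (τ + v.fst * Complex.I)).HasTemperateGrowth) :
    (waveSymbol κt v).HasTemperateGrowth := by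
  have h1 : (fun ξ : SpaceTime => 2 * Real.pi * ξ.fst).HasTemperateGrowth :=
    ((2 * Real.pi) • WithLp.fstL 2 ℝ ℝ Space3).hasTemperateGrowth
  have h2 := (h.comp h1).pow 2
  have hs : (fun ξ : SpaceTime => ξ.snd).HasTemperateGrowth :=
    (WithLp.sndL 2 ℝ ℝ Space3).hasTemperateGrowth
  have h3 : (fun ξ : SpaceTime => ‖ξ.snd‖ ^ 2).HasTemperateGrowth :=
    (Function.hasTemperateGrowth_norm_sq (H := Space3)).comp hs
  have h4 : (fun ξ : SpaceTime => ⟪ξ.snd, v.snd⟫_ℝ).HasTemperateGrowth :=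
    (Function.hasTemperateGrowth_inner_left v.snd).comp hs
  have h5 : (fun ξ : SpaceTime => (2 * Real.pi) ^ 2 * ‖ξ.snd‖ ^ 2 - ‖v.snd‖ ^ 2).HasTemperateGrowth :=
    ((Function.HasTemperateGrowth.const _).mul h3).sub (Function.HasTemperateGrowth.const _)
  have h6 : (fun ξ : SpaceTime => 4 * Real.pi * ⟪ξ.snd, v.snd⟫_ℝ).HasTemperateGrowth :=
    (Function.HasTemperateGrowth.const _).mul h4
  exact ((Function.Complex.hasTemperateGrowth_ofReal.comp h5).add
    ((Function.Complex.hasTemperateGrowth_ofReal.comp h6).mul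
      (Function.HasTemperateGrowth.const _))).sub h2

variable {κ : ℝ → ℂ} {κt : ℂ → ℂ}

theorem hasTemperateGrowth_waveSymbol (hκt : IsHolomorphicContinuation κ κt) (v : SpaceTime)
    (hv : 0 < v.fst) : (waveSymbol κt v).HasTemperateGrowth := by
  obtain ⟨C, N, hb⟩ := hκt.bound
  exact hasTemperateGrowth_waveSymbol_of v
    (hasTemperateGrowth_horizontal hκt.differentiableOn hb hv)

theorem hasTemperateGrowth_waveSymbol_zero (hκ : IsAttenuationCoefficient κ)
    (hκt : IsHolomorphicContinuation κ κt) : (waveSymbol κt 0).HasTemperateGrowth := by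
  refine hasTemperateGrowth_waveSymbol_of 0 ?_
  have : (fun τ : ℝ => κt (τ + (0 : SpaceTime).fst * Complex.I)) = κ := by
    ext τ
    simp [hκt.apply_ofReal]
  rw [this]
  exact hκ.hasTemperateGrowth

/-- Meant for `ν² = ζ ⬝ ζ` with `A`, `B` the lengths of the real and imaginary parts of `ζ` and `D`
their inner product, so that `hD` is Cauchy–Schwarz. As `D = Re ν Im ν`, it becomes `((Im ν)² -
B²)((Re ν)² + B²) ≤ 0`. -/
theorem abs_im_le_of_sq_eq {ν : ℂ} {A B D : ℝ} (hB : 0 ≤ B) (hD : D ^ 2 ≤ A ^ 2 * B ^ 2)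
    (h : ν ^ 2 = ((A ^ 2 - B ^ 2 : ℝ) : ℂ) + ((2 * D : ℝ) : ℂ) * Complex.I) : |ν.im| ≤ B := by
  have h1 := congrArg Complex.re h
  have h2 := congrArg Complex.im h
  simp [sq] at h1 h2
  refine abs_le_of_sq_le_sq ?_ hB
  by_contra hcon
  rw [not_le] at hcon
  have h3 : (ν.re * ν.im) ^ 2 ≤ A ^ 2 * B ^ 2 := by
    have : ν.re * ν.im = D := by linarith
    rwa [this]
  have h4 : (ν.im ^ 2 - B ^ 2) * (ν.re ^ 2 + B ^ 2) ≤ 0 := by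
    have : A ^ 2 = ν.re ^ 2 - ν.im ^ 2 + B ^ 2 := by linarith
    rw [this] at h3
    linarith
  have h5 : 0 < ν.im ^ 2 - B ^ 2 := by linarith
  have h6 : ν.re ^ 2 + B ^ 2 ≤ 0 := nonpos_of_mul_nonpos_right h4 h5
  nlinarith [sq_nonneg ν.re, sq_nonneg B, sq_nonneg A]

/-- The symbol is `(ν - k)(ν + k)` with `|Im ν| ≤ ‖v.snd‖`, and the imaginary part of each factor
has modulus at least `Im k - ‖v.snd‖`. -/
theorem sq_le_norm_waveSymbol (v q : SpaceTime) (h : ‖v.snd‖ ≤ (κt (freq v.fst q)).im) :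
    ((κt (freq v.fst q)).im - ‖v.snd‖) ^ 2 ≤ ‖waveSymbol κt v q‖ := by
  set k := κt (freq v.fst q) with hk
  obtain ⟨ν, hν⟩ := IsAlgClosed.exists_pow_nat_eq
    ((((2 * Real.pi * ‖q.snd‖) ^ 2 - ‖v.snd‖ ^ 2 : ℝ) : ℂ) +
      ((2 * (2 * Real.pi * ⟪q.snd, v.snd⟫_ℝ) : ℝ) : ℂ) * Complex.I) two_pos
  have h1 := abs_im_le_of_sq_eq (norm_nonneg _) (by
    have h2 := abs_real_inner_le_norm q.snd v.snd
    have h3 : ⟪q.snd, v.snd⟫_ℝ ^ 2 ≤ (‖q.snd‖ * ‖v.snd‖) ^ 2 := sq_le_sq' (by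
      linarith [neg_abs_le ⟪q.snd, v.snd⟫_ℝ]) ((le_abs_self _).trans h2)
    rw [mul_pow _ ⟪q.snd, v.snd⟫_ℝ, mul_pow _ ‖q.snd‖, mul_assoc, ← mul_pow ‖q.snd‖]
    gcongr) hν
  have e : waveSymbol κt v q = (ν - k) * (ν + k) := by
    have : (ν - k) * (ν + k) = ν ^ 2 - k ^ 2 := by ring
    rw [this, hν, waveSymbol, ← hk]
    push_cast
    ring
  rw [e, norm_mul, sq]
  have h2 := abs_le.1 h1
  have h3 : k.im - ‖v.snd‖ ≤ ‖ν - k‖ := by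
    refine le_trans ?_ (Complex.abs_im_le_norm _)
    refine le_trans ?_ (neg_le_abs _)
    simp
    linarith
  have h4 : k.im - ‖v.snd‖ ≤ ‖ν + k‖ := by
    refine le_trans ?_ (Complex.abs_im_le_norm _)
    refine le_trans ?_ (le_abs_self _)
    simp
    linarith
  gcongr

theorem freq_shift (η₀ : ℝ) (v q : SpaceTime) (w : ℂ) :
    freq (η₀ + w.im * v.fst) (q + w.re • ((2 * Real.pi)⁻¹ • v)) =
      freq 0 q + v.fst * w + η₀ * Complex.I := by
  have hpi := Real.pi_ne_zero
  apply Complex.ext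
  · simp [freq]
    field_simp
  · simp [freq]
    ring

/-- In this form the symbol along the complex line is a quadratic polynomial in `w` minus the square
of `κt` at an affine function of `w`, hence holomorphic. -/
theorem waveSymbol_shift (η₀ : ℝ) (v q : SpaceTime) (w : ℂ) :
    waveSymbol κt (mkST η₀ 0 + w.im • v) (q + w.re • ((2 * Real.pi)⁻¹ • v)) =
      (((2 * Real.pi) ^ 2 * ‖q.snd‖ ^ 2 : ℝ) : ℂ) +
        w * ((4 * Real.pi * ⟪q.snd, v.snd⟫_ℝ : ℝ) : ℂ) + w ^ 2 * ((‖v.snd‖ ^ 2 : ℝ) : ℂ) -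
        κt (freq 0 q + v.fst * w + η₀ * Complex.I) ^ 2 := by
  rw [waveSymbol]
  have h1 : (mkST η₀ 0 + w.im • v).fst = η₀ + w.im * v.fst := by simp
  have h2 : (mkST η₀ 0 + w.im • v).snd = w.im • v.snd := by simp
  have h3 : (q + w.re • ((2 * Real.pi)⁻¹ • v)).snd = q.snd + (w.re * (2 * Real.pi)⁻¹) • v.snd := by
    simp [mul_smul]
  rw [h1, freq_shift, h2, h3, norm_add_sq_real]
  congr 1
  have hpi := Real.pi_ne_zero
  obtain ⟨a, b, rfl⟩ : ∃ a b : ℝ, w = a + b * Complex.I := ⟨w.re, w.im, by simp⟩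
  simp only [norm_smul, mul_pow, inner_add_left, inner_smul_left, inner_smul_right,
    real_inner_self_eq_norm_sq, conj_trivial, Complex.add_re, Complex.add_im,
    Complex.ofReal_re, Complex.ofReal_im, Complex.mul_re, Complex.mul_im, Complex.I_re,
    Complex.I_im, Real.norm_eq_abs, sq_abs]
  apply Complex.ext
  · simp [sq, Complex.mul_re, Complex.mul_im]
    field_simp
    ring
  · simp [sq, Complex.mul_re, Complex.mul_im]
    field_simp
    ring

theorem one_add_norm_freq_le {η₀ : ℝ} (hη₀ : 0 ≤ η₀) (v q : SpaceTime) {μ : ℝ} (hμ : 0 ≤ μ) :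
    1 + ‖freq (η₀ + μ * v.fst) q‖ ≤ (8 + η₀ + ‖v‖) * ((1 + ‖q‖) * (1 + μ)) := by
  have h1 := norm_freq_le (η₀ + μ * v.fst) q
  have h2 : |η₀ + μ * v.fst| ≤ η₀ + μ * ‖v‖ := by
    refine (abs_add_le _ _).trans ?_
    rw [abs_mul, abs_of_nonneg hη₀, abs_of_nonneg hμ]
    gcongr
    exact norm_fst_le v
  have h3 := norm_nonneg q
  have h4 := norm_nonneg v
  nlinarith [mul_nonneg h3 hμ, mul_nonneg h4 hμ, mul_nonneg h3 h4, mul_nonneg hη₀ h3,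
    mul_nonneg hη₀ hμ, mul_nonneg hη₀ (mul_nonneg h3 hμ), mul_nonneg h4 (mul_nonneg h3 hμ)]

theorem shiftSymbol_freq {η₀ : ℝ} (hη₀ : 0 ≤ η₀) (v : SpaceTime) :
    ShiftSymbol v (fun q μ => Complex.I * freq (η₀ + μ * v.fst) q) := by
  refine ⟨?_, fun q => ?_, 8 + η₀ + ‖v‖, 1, by positivity, fun q μ hμ => ?_⟩
  · refine Continuous.continuousOn ?_
    refine continuous_const.mul ?_
    exact continuous_freq.comp (f := fun p : SpaceTime × ℝ => (η₀ + p.2 * v.fst, p.1)) (by fun_prop)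
  · simp_rw [freq_shift]
    exact Differentiable.differentiableOn (by fun_prop)
  · have := one_add_norm_freq_le hη₀ v q hμ
    rw [norm_mul, Complex.norm_I]
    linarith

/-- The base weight `η₀ = 0` is allowed: the frequency is then real at `μ = 0`, where only
continuity of `κt` is required. -/
theorem shiftSymbol_waveSymbol (hκt : IsHolomorphicContinuation κ κt) {η₀ : ℝ} (hη₀ : 0 ≤ η₀)
    (v : SpaceTime) (hv : 0 < v.fst) :
    ShiftSymbol v (fun q μ => waveSymbol κt (mkST η₀ 0 + μ • v) q) := by
  have hfst : ∀ μ : ℝ, (mkST η₀ 0 + μ • v).fst = η₀ + μ * v.fst := fun μ => by simp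
  have hsnd : ∀ μ : ℝ, (mkST η₀ 0 + μ • v).snd = μ • v.snd := fun μ => by simp
  refine ⟨?_, fun q => ?_, ?_⟩
  · simp only [Function.uncurry_def, waveSymbol, hfst, hsnd]
    have hs : Continuous (fun p : SpaceTime × ℝ => p.1.snd) :=
      (WithLp.sndL 2 ℝ ℝ Space3).continuous.comp continuous_fst
    refine ContinuousOn.sub (Continuous.continuousOn (by fun_prop)) (ContinuousOn.pow ?_ 2)
    refine hκt.continuousOn.comp (f := fun p : SpaceTime × ℝ => freq (η₀ + p.2 * v.fst) p.1)
      (Continuous.continuousOn ?_) ?_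
    · exact continuous_freq.comp (f := fun p : SpaceTime × ℝ => (η₀ + p.2 * v.fst, p.1))
        (by fun_prop)
    · intro p hp
      have : 0 ≤ p.2 := hp.2
      simp only [Set.mem_ofPred_eq, freq_im]
      positivity
  · simp_rw [waveSymbol_shift]
    refine DifferentiableOn.sub (Differentiable.differentiableOn (by fun_prop))
      (DifferentiableOn.pow ?_ 2)
    refine hκt.differentiableOn.comp (Differentiable.differentiableOn (by fun_prop)) ?_
    intro w hw
    have hw' : 0 < w.im := hw
    simp [freq]
    positivity
  · obtain ⟨C, N, hb⟩ := hκt.bound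
    refine ⟨(8 + η₀ + ‖v‖) ^ 2 + C ^ 2 * (8 + η₀ + ‖v‖) ^ (2 * N), 2 * N + 2, by positivity,
      fun q μ hμ => ?_⟩
    set X := (1 + ‖q‖) * (1 + μ) with hX
    set B := 8 + η₀ + ‖v‖ with hB
    have hX1 : 1 ≤ X := one_le_mul_of_one_le_of_one_le (by simp) (by simpa using hμ)
    have h1 := one_add_norm_freq_le hη₀ v q hμ
    have h2 : ‖κt (freq (η₀ + μ * v.fst) q)‖ ≤ |C| * (B * X) ^ N := by
      refine (hb _ (by rw [freq_im]; positivity)).trans ?_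
      gcongr
      exact le_abs_self C
    have h3 : ‖waveSymbol κt (mkST η₀ 0 + μ • v) q‖ ≤
        (2 * Real.pi * ‖q.snd‖ + μ * ‖v.snd‖) ^ 2 + (|C| * (B * X) ^ N) ^ 2 := by
      rw [waveSymbol, hfst, hsnd]
      refine (norm_sub_le _ _).trans (add_le_add ?_ ?_)
      · refine (norm_add_le _ _).trans ?_
        rw [norm_mul, Complex.norm_I, mul_one, Complex.norm_real, Complex.norm_real,
          norm_smul, inner_smul_right]
        have h4 := abs_real_inner_le_norm q.snd v.snd
        have h5 := Real.pi_pos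
        have h6 : ‖(2 * Real.pi) ^ 2 * ‖q.snd‖ ^ 2 - (‖μ‖ * ‖v.snd‖) ^ 2‖ ≤
            (2 * Real.pi) ^ 2 * ‖q.snd‖ ^ 2 + (‖μ‖ * ‖v.snd‖) ^ 2 := by
          refine (norm_sub_le _ _).trans (le_of_eq ?_)
          rw [Real.norm_of_nonneg (by positivity), Real.norm_of_nonneg (by positivity)]
        have h7 : ‖4 * Real.pi * (μ * ⟪q.snd, v.snd⟫_ℝ)‖ ≤
            4 * Real.pi * (μ * (‖q.snd‖ * ‖v.snd‖)) := by
          rw [norm_mul, norm_mul μ, Real.norm_of_nonneg (by positivity : 0 ≤ 4 * Real.pi),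
            Real.norm_of_nonneg hμ, Real.norm_eq_abs]
          gcongr
        rw [Real.norm_of_nonneg hμ] at h6 ⊢
        linarith
      · rw [norm_pow]
        gcongr
    have h8 : 2 * Real.pi * ‖q.snd‖ + μ * ‖v.snd‖ ≤ B * X := by
      have := norm_snd_le q
      have := norm_snd_le v
      have h5 := Real.pi_pos
      have h6 := Real.pi_lt_d2
      calc _ ≤ 8 * ‖q‖ + μ * ‖v‖ := by
            gcongr
            linarith
        _ ≤ _ := by
          have h3 := norm_nonneg q
          have h4 := norm_nonneg v
          rw [hB, hX]
          nlinarith [mul_nonneg h3 hμ, mul_nonneg h4 hμ, mul_nonneg h3 h4, mul_nonneg hη₀ h3,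
            mul_nonneg hη₀ hμ, mul_nonneg hη₀ (mul_nonneg h3 hμ),
            mul_nonneg h4 (mul_nonneg h3 hμ)]
    refine h3.trans ?_
    have hB0 : 0 ≤ B := by positivity
    rw [mul_assoc (B ^ 2 + _), ← mul_pow, ← hX]
    calc _ ≤ (B * X) ^ 2 + (|C| * (B * X) ^ N) ^ 2 := by
          have := Real.pi_pos
          gcongr
      _ = B ^ 2 * X ^ 2 + C ^ 2 * B ^ (2 * N) * X ^ (2 * N) := by
          rw [mul_pow |C|, sq_abs]
          ring_nf
      _ ≤ B ^ 2 * X ^ (2 * N + 2) + C ^ 2 * B ^ (2 * N) * X ^ (2 * N + 2) := by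
          gcongr <;> first | exact hX1 | omega
      _ = _ := by ring

end Symbol

/-! ### The equation in weighted form. -/

section Equation

open scoped FourierTransform InnerProductSpace

theorem fourier_multiplier_apply {g : SpaceTime → ℂ} (hg : g.HasTemperateGrowth)
    (φ : 𝓢(SpaceTime, ℂ)) (q : SpaceTime) :
    𝓕 (SchwartzMap.fourierMultiplierCLM ℂ g φ) q = g q * 𝓕 φ q := by
  rw [SchwartzMap.fourierMultiplierCLM_apply, FourierTransform.fourier_fourierInv_eq,
    SchwartzMap.smulLeftCLM_apply_apply hg, smul_eq_mul]

theorem multiplier_apply {g : SpaceTime → ℂ} (hg : g.HasTemperateGrowth)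
    (φ : 𝓢(SpaceTime, ℂ)) (y : SpaceTime) :
    SchwartzMap.fourierMultiplierCLM ℂ g φ y = 𝓕⁻ (fun q => g q * 𝓕 φ q) y := by
  rw [SchwartzMap.fourierMultiplierCLM_apply, SchwartzMap.fourierInv_coe]
  refine congrArg (fun f : SpaceTime → ℂ => 𝓕⁻ f y) (funext fun q => ?_)
  rw [SchwartzMap.smulLeftCLM_apply_apply hg, smul_eq_mul]

theorem fourier_lineDeriv_apply (φ : 𝓢(SpaceTime, ℂ)) (m q : SpaceTime) :
    𝓕 (∂_{m} φ : 𝓢(SpaceTime, ℂ)) q = 2 * Real.pi * Complex.I * ⟪q, m⟫_ℝ * 𝓕 φ q := by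
  rw [SchwartzMap.fourier_lineDerivOp_eq, smul_apply,
    SchwartzMap.smulLeftCLM_apply_apply (Function.hasTemperateGrowth_inner_left m)]
  simp [mul_assoc]

theorem eq_of_fourier_eq {φ ψ : 𝓢(SpaceTime, ℂ)} (h : ∀ q, 𝓕 φ q = 𝓕 ψ q) : φ = ψ := by
  have h1 : 𝓕 φ = (𝓕 ψ : 𝓢(SpaceTime, ℂ)) := by
    ext q
    exact h q
  have h2 := congrArg (fun f : 𝓢(SpaceTime, ℂ) => (𝓕⁻ f : 𝓢(SpaceTime, ℂ))) h1
  simpa using h2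

/-- The attenuated wave operator acting on test functions. -/
noncomputable def waveOp (κt : ℂ → ℂ) (v : SpaceTime) : 𝓢(SpaceTime, ℂ) →L[ℂ] 𝓢(SpaceTime, ℂ) :=
  SchwartzMap.fourierMultiplierCLM ℂ (waveSymbol κt v)

/-- The pairing of a test function with the source `δ'(t) h(x)`, up to sign. -/
noncomputable def sourcePairing (h : Space3 → ℝ) (ϑ : 𝓢(SpaceTime, ℂ)) : ℂ :=
  ∫ x : Space3, (h x : ℂ) * deriv (fun t : ℝ => ϑ (mkST t x)) 0

variable {κ : ℝ → ℂ} {κt : ℂ → ℂ}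

/-- All operators are moved onto the test function and compared on the Fourier side, where they add
up to `4π² ‖ξ‖² - κ²`. -/
theorem attenuationOp_sub_spatialLaplacian (hκ : IsAttenuationCoefficient κ)
    (hκt : IsHolomorphicContinuation κ κt) (p : 𝓢'(SpaceTime, ℂ)) (ϑ : 𝓢(SpaceTime, ℂ)) :
    attenuationOp κ p ϑ - spatialLaplacian p ϑ = p (waveOp κt 0 ϑ) := by
  have e : waveOp κt 0 ϑ = -timeMultiplier κ ϑ - ∑ i : Fin 3,
      (∂_{mkST 0 (EuclideanSpace.single i 1)}
        (∂_{mkST 0 (EuclideanSpace.single i 1)} ϑ : 𝓢(SpaceTime, ℂ)) : 𝓢(SpaceTime, ℂ)) := by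
    refine eq_of_fourier_eq fun q => ?_
    have hlin : 𝓕 (-timeMultiplier κ ϑ - ∑ i : Fin 3,
      (∂_{mkST 0 (EuclideanSpace.single i 1)}
        (∂_{mkST 0 (EuclideanSpace.single i 1)} ϑ : 𝓢(SpaceTime, ℂ)) : 𝓢(SpaceTime, ℂ))) =
        -𝓕 (timeMultiplier κ ϑ) - ∑ i : Fin 3, 𝓕
      (∂_{mkST 0 (EuclideanSpace.single i 1)}
        (∂_{mkST 0 (EuclideanSpace.single i 1)} ϑ : 𝓢(SpaceTime, ℂ)) : 𝓢(SpaceTime, ℂ)) := by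
      simp only [← FourierTransform.fourierCLM_apply (R := ℂ), map_sub, map_neg, map_sum]
    rw [hlin, sub_apply, neg_apply, sum_apply, waveOp,
      fourier_multiplier_apply (hasTemperateGrowth_waveSymbol_zero hκ hκt), timeMultiplier,
      fourier_multiplier_apply hκ.symbol_hasTemperateGrowth]
    simp only [fourier_lineDeriv_apply]
    have hκ0 : κt (freq 0 q) = κ (2 * Real.pi * q.fst) := by
      rw [← hκt.apply_ofReal]
      simp [freq]
    have hn : ‖q.snd‖ ^ 2 = ∑ i : Fin 3, (q.snd i) ^ 2 := by
      rw [EuclideanSpace.norm_sq_eq]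
      simp
    have hi : ∀ i : Fin 3, ⟪q, mkST 0 (EuclideanSpace.single i 1)⟫_ℝ = q.snd i := fun i => by
      simp [WithLp.prod_inner_apply, EuclideanSpace.inner_single_right]
    simp only [waveSymbol, WithLp.zero_fst, hκ0, hn, hi, WithLp.zero_snd, norm_zero,
      inner_zero_right, Fin.sum_univ_three]
    push_cast
    linear_combination (4 * Real.pi ^ 2 * ((q.snd 0 : ℂ) ^ 2 + (q.snd 1 : ℂ) ^ 2 +
      (q.snd 2 : ℂ) ^ 2) * 𝓕 ϑ q) * Complex.I_sq
  rw [e, attenuationOp_apply_apply, map_sub, map_neg, map_sum]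
  simp [spatialLaplacian, TemperedDistribution.lineDerivOp_apply_apply]

theorem IsCausalSolution.apply_waveOp (hκ : IsAttenuationCoefficient κ)
    (hκt : IsHolomorphicContinuation κ κt) {h : Space3 → ℝ} {p : 𝓢'(SpaceTime, ℂ)}
    (hp : IsCausalSolution κ h p) (ϑ : 𝓢(SpaceTime, ℂ)) :
    p (waveOp κt 0 ϑ) = -sourcePairing h ϑ := by
  rw [← attenuationOp_sub_spatialLaplacian hκ hκt]
  exact hp.equation ϑ

/-- The intertwining relation for multipliers with shift length `1`, starting from the unweighted
symbol. -/
theorem waveOp_expMul (hκ : IsAttenuationCoefficient κ) (hκt : IsHolomorphicContinuation κ κt)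
    (v : SpaceTime) (hv : 0 < v.fst) (φ : 𝓢(SpaceTime, ℂ)) (hφ : HasCompactSupport φ)
    (y : SpaceTime) :
    waveOp κt v (expMul v φ hφ) y = Complex.exp ((⟪v, y⟫_ℝ : ℝ) : ℂ) * waveOp κt 0 φ y := by
  have h := (shiftSymbol_waveSymbol hκt le_rfl v hv).fourierInv_expMul φ hφ zero_le_one y
  have e0 : mkST 0 0 = (0 : SpaceTime) := rfl
  simp only [one_smul, zero_smul, add_zero, e0, zero_add] at h
  rw [waveOp, waveOp, multiplier_apply (hasTemperateGrowth_waveSymbol hκt v hv),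
    multiplier_apply (hasTemperateGrowth_waveSymbol_zero hκ hκt)]
  exact h

theorem apply_eq_of_eqOn (p : 𝓢'(SpaceTime, ℂ)) {O : Set SpaceTime} (hO : IsOpen O)
    (hd : Distribution.dsupport p ⊆ O) {φ ψ : 𝓢(SpaceTime, ℂ)} (h : Set.EqOn φ ψ O) :
    p φ = p ψ := by
  rw [← sub_eq_zero, ← map_sub]
  refine apply_eq_zero_of_disjoint_dsupport p _ ?_
  have h1 : tsupport (φ - ψ : 𝓢(SpaceTime, ℂ)) ⊆ Oᶜ :=
    closure_minimal (fun q hq hqO => hq (by simp [h hqO])) hO.isClosed_compl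
  exact Set.disjoint_left.2 fun q hq hq' => h1 hq (hd hq')

theorem sourcePairing_congr {h : Space3 → ℝ} {O : Set SpaceTime} (hO : IsOpen O)
    (hh : ∀ᵐ x, h x = 0 ∨ mkST 0 x ∈ O) {φ ψ : 𝓢(SpaceTime, ℂ)} (he : Set.EqOn φ ψ O) :
    sourcePairing h φ = sourcePairing h ψ := by
  refine integral_congr_ae ?_
  filter_upwards [hh] with x hx
  rcases hx with hx | hx
  · simp [hx]
  · have hc : Continuous (fun t : ℝ => mkST t x) := by fun_prop
    have : (fun t : ℝ => φ (mkST t x)) =ᶠ[𝓝 0] fun t : ℝ => ψ (mkST t x) := by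
      filter_upwards [(hO.preimage hc).mem_nhds hx] with t ht using he ht
    rw [this.deriv_eq]

/-- The equation satisfied by an exponentially weighted causal solution. -/
theorem IsCausalSolution.apply_smul_waveOp (hκ : IsAttenuationCoefficient κ)
    (hκt : IsHolomorphicContinuation κ κt) {h : Space3 → ℝ} {p : 𝓢'(SpaceTime, ℂ)}
    (hp : IsCausalSolution κ h p) {v : SpaceTime} (hv : 0 < v.fst) {w : SpaceTime → ℂ}
    (hw : w.HasTemperateGrowth) {O : Set SpaceTime} (hO : IsOpen O)
    (hd : Distribution.dsupport p ⊆ O)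
    (hwO : ∀ q ∈ O, w q = Complex.exp ((-⟪v, q⟫_ℝ : ℝ) : ℂ))
    (hh : ∀ᵐ x, h x = 0 ∨ mkST 0 x ∈ O) (Φ : 𝓢(SpaceTime, ℂ)) :
    p (SchwartzMap.smulLeftCLM ℂ w (waveOp κt v Φ)) =
      -sourcePairing h (SchwartzMap.smulLeftCLM ℂ w Φ) := by
  rw [← hp.apply_waveOp hκ hκt]
  have hpc := continuous_temperedDistribution p
  revert Φ
  refine eq_of_eq_on_hasCompactSupport
    (p := fun Φ => p (SchwartzMap.smulLeftCLM ℂ w (waveOp κt v Φ)))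
    (q := fun Φ => p (waveOp κt 0 (SchwartzMap.smulLeftCLM ℂ w Φ)))
    (hpc.comp (SchwartzMap.smulLeftCLM ℂ w ∘L waveOp κt v).continuous)
    (hpc.comp (waveOp κt 0 ∘L SchwartzMap.smulLeftCLM ℂ w).continuous) fun Φ hΦ => ?_
  -- Once `Φ` has compact support, `φ = exp (-⟪v, ·⟫) Φ` is a test function. On `O`, `w Φ` agrees
  -- with `φ` and `w` times the weighted operator on `Φ` agrees with the unweighted one on `φ`.
  -- Neither `p` nor the source sees anything outside `O`.
  set φ := expMul (-v) Φ hΦ with hφ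
  have hφc : HasCompactSupport φ := hasCompactSupport_expMul _ _ _
  have hΦφ : expMul v φ hφc = Φ := by
    ext x
    rw [expMul_apply, hφ, expMul_apply, ← mul_assoc, ← Complex.exp_add]
    simp
  have h1 : p (SchwartzMap.smulLeftCLM ℂ w (waveOp κt v Φ)) = p (waveOp κt 0 φ) := by
    refine apply_eq_of_eqOn p hO hd fun q hq => ?_
    rw [SchwartzMap.smulLeftCLM_apply_apply hw, hwO q hq, ← hΦφ, waveOp_expMul hκ hκt v hv,
      smul_eq_mul, ← mul_assoc, ← Complex.exp_add]
    simp
  rw [h1, hp.apply_waveOp hκ hκt, hp.apply_waveOp hκ hκt]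
  congr 1
  refine sourcePairing_congr hO hh fun q hq => ?_
  rw [SchwartzMap.smulLeftCLM_apply_apply hw, hwO q hq, hφ, expMul_apply]
  simp

end Equation

/-! ### Part (i): finite speed of propagation. -/

section FiniteSpeed

open scoped FourierTransform InnerProductSpace

theorem ae_eq_zero_or_mem_essSupport (h : Space3 → ℝ) :
    ∀ᵐ x, h x = 0 ∨ x ∈ essSupport h := by
  have : volume {x : Space3 | h x ≠ 0 ∧ x ∉ essSupport h} = 0 := by
    refine measure_null_of_locally_null _ fun x hx => ?_
    have h1 := hx.2
    simp only [essSupport, Set.mem_ofPred_eq, not_forall, not_not] at h1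
    obtain ⟨U, hU, hU0⟩ := h1
    refine ⟨{y | h y ≠ 0} ∩ U, ?_, ?_⟩
    · filter_upwards [mem_nhdsWithin_of_mem_nhds hU, self_mem_nhdsWithin] with y hy hy'
      exact ⟨hy'.1, hy⟩
    · exact le_antisymm ((Measure.le_restrict_apply U {y | h y ≠ 0}).trans_eq hU0) zero_le
  rw [← compl_mem_ae_iff] at this
  filter_upwards [this] with x hx
  by_contra hcon
  rw [not_or] at hcon
  exact hx hcon

theorem hasTemperateGrowth_cutoff_fst {ε b : ℝ} (hε : 0 ≤ ε) :
    (fun q : SpaceTime => cutoff (q.fst + b) *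
      Complex.exp ((-ε * q.fst : ℝ) : ℂ)).HasTemperateGrowth := by
  have h := (derivBound_cutoff_mul_exp ε b hε).comp_affine (fun _ : Unit => ())
    (fun _ => WithLp.fstL 2 ℝ ℝ Space3) (fun _ => 0) (fun _ => le_rfl)
  have h2 := h.hasTemperateGrowth () (C := 1) fun q => by
    rw [Real.exp_le_one_iff]
    have := abs_nonneg ((WithLp.fstL 2 ℝ ℝ Space3) q + 0)
    nlinarith
  simpa using h2

variable {κ : ℝ → ℂ} {κt : ℂ → ℂ} {c : ℝ}

theorem inv_sq_le_norm_waveSymbol (hc : 0 < c)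
    (hs : ∀ z : ℂ, 0 ≤ z.im → 0 ≤ (κt z - z / (c : ℂ)).im) {v : SpaceTime} (hv : 0 ≤ v.fst)
    (h : 1 / c + ‖v.snd‖ ≤ v.fst / c) (q : SpaceTime) : (1 / c) ^ 2 ≤ ‖waveSymbol κt v q‖ := by
  have h1 := hs (freq v.fst q) (by rwa [freq_im])
  rw [Complex.sub_im, Complex.div_ofReal_im, freq_im] at h1
  have hc' : 0 < 1 / c := by positivity
  refine le_trans ?_ (sq_le_norm_waveSymbol v q (by linarith))
  gcongr
  linarith

theorem norm_inv_waveSymbol_le {v q : SpaceTime} (hc : 0 < c)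
    (h : (1 / c) ^ 2 ≤ ‖waveSymbol κt v q‖) : ‖(waveSymbol κt v q)⁻¹‖ ≤ c ^ 2 := by
  rw [norm_inv]
  refine (inv_anti₀ (by positivity) h).trans (le_of_eq ?_)
  simp

/-- The solution operator with an exponential weight in time propagates with finite speed. -/
theorem multiplier_inv_waveSymbol_eq_zero (hκt : IsHolomorphicContinuation κ κt) (hc : 0 < c)
    (hs : ∀ z : ℂ, 0 ≤ z.im → 0 ≤ (κt z - z / (c : ℂ)).im) {θ : Space3} (hθ : ‖θ‖ = 1)
    (φ : 𝓢(SpaceTime, ℂ)) (hφ : HasCompactSupport φ) {b : ℝ}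
    (hb : ∀ q ∈ tsupport φ, b ≤ ⟪θ, q.snd⟫_ℝ - c * q.fst) {y : SpaceTime}
    (hy : ⟪θ, y.snd⟫_ℝ - c * y.fst < b) :
    SchwartzMap.fourierMultiplierCLM ℂ (fun q => (waveSymbol κt (mkST 1 0) q)⁻¹) φ y = 0 := by
  -- Pairing with `v₁` is `-(1/c)` times the form `⟪θ, x⟫ - c t`. Along `(1, 0) + μ v₁` the
  -- difference `η / c - ‖α‖` stays equal to `1 / c`, which gives a bound uniform in `μ`.
  set v₁ : SpaceTime := mkST 1 (-(1 / c) • θ) with hv₁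
  have hin : ∀ q : SpaceTime, ⟪v₁, q⟫_ℝ = -(1 / c) * (⟪θ, q.snd⟫_ℝ - c * q.fst) := fun q => by
    rw [WithLp.prod_inner_apply]
    simp [hv₁, inner_smul_left]
    field_simp
    ring
  have hlow : ∀ (q : SpaceTime) (μ : ℝ), 0 ≤ μ → (1 / c) ^ 2 ≤ ‖waveSymbol κt (mkST 1 0 + μ • v₁) q‖ := by
    intro q μ hμ
    refine inv_sq_le_norm_waveSymbol hc hs ?_ ?_ q
    · simp [hv₁]
      positivity
    · have hn : ‖(mkST 1 0 + μ • v₁).snd‖ = μ / c := by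
        simp [hv₁, norm_smul, hθ, abs_of_nonneg hμ, abs_of_pos hc]
        ring
      rw [hn]
      simp [hv₁]
      apply le_of_eq
      ring
  have hsh := (shiftSymbol_waveSymbol hκt zero_le_one v₁ (by simp [hv₁])).inv
    (fun q μ hμ h0 => by
      have := hlow q μ hμ
      rw [h0, norm_zero] at this
      have : 0 < (1 / c) ^ 2 := by positivity
      linarith)
    ⟨c ^ 2, 0, by positivity, fun q μ hμ => by
      simpa using norm_inv_waveSymbol_le hc (hlow q μ hμ)⟩
  have hlow0 : ∀ q, (1 / c) ^ 2 ≤ ‖waveSymbol κt (mkST 1 0) q‖ := fun q => by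
    simpa using hlow q 0 le_rfl
  have ht : (fun q => (waveSymbol κt (mkST 1 0) q)⁻¹).HasTemperateGrowth :=
    hasTemperateGrowth_inv (hasTemperateGrowth_waveSymbol hκt _ (by simp)) (fun q h0 => by
      have := hlow0 q
      rw [h0, norm_zero] at this
      have : 0 < (1 / c) ^ 2 := by positivity
      linarith) (C := c ^ 2) (N := 0) fun q => by
        simpa using norm_inv_waveSymbol_le hc (hlow0 q)
  rw [multiplier_apply ht]
  have key := hsh.fourierInv_eq_zero φ hφ (b := -(1 / c) * b) (fun q hq => by
    rw [hin]
    exact mul_le_mul_of_nonpos_left (hb q hq) (by simp; positivity)) (y := y) (by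
    rw [hin]
    exact mul_lt_mul_of_neg_left hy (by simp; positivity))
  simpa using key

/-- Argument by duality: a test function `ϑ` near a point outside the cone is, up to the weight, the
image under the operator of a function vanishing near the source. Testing the equation with it gives
`p ϑ = 0`. -/
theorem propagatesWithSpeed (hκ : IsAttenuationCoefficient κ)
    (hκt : IsHolomorphicContinuation κ κt) (hc : 0 < c)
    (hs : ∀ z : ℂ, 0 ≤ z.im → 0 ≤ (κt z - z / (c : ℂ)).im) : PropagatesWithSpeed κ c := by
  intro h R _ _ hR hsupp p hp q₀ hq₀
  by_contra hcone
  rw [Set.mem_ofPred_eq, not_le] at hcone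
  have ht₀ : 0 ≤ q₀.fst := hp.causal hq₀
  have hx₀ : 0 < ‖q₀.snd‖ := by nlinarith [mul_nonneg hc.le ht₀]
  set θ : Space3 := ‖q₀.snd‖⁻¹ • q₀.snd with hθ
  have hθ1 : ‖θ‖ = 1 := by
    rw [hθ, norm_smul, norm_inv, norm_norm, inv_mul_cancel₀ hx₀.ne']
  have hθ2 : ⟪θ, q₀.snd⟫_ℝ = ‖q₀.snd‖ := by
    rw [hθ, inner_smul_left, real_inner_self_eq_norm_sq]
    simp
    field_simp
  -- With `θ` the direction of `q₀.snd`, the hyperplane `⟪θ, x⟫ - c t = b` separates `q₀` from the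
  -- source `{0} × B_R`.
  obtain ⟨b, hb1, hb2⟩ : ∃ b, R < b ∧ b < ‖q₀.snd‖ - c * q₀.fst := exists_between (by linarith)
  have hfst : Continuous (fun q : SpaceTime => q.fst) := (WithLp.fstL 2 ℝ ℝ Space3).continuous
  have hsnd : Continuous (fun q : SpaceTime => q.snd) := (WithLp.sndL 2 ℝ ℝ Space3).continuous
  have hℓ : Continuous (fun q : SpaceTime => ⟪θ, q.snd⟫_ℝ - c * q.fst) := by fun_prop
  refine (Distribution.notMem_dsupport_iff q₀).2
    ⟨{q | b < ⟪θ, q.snd⟫_ℝ - c * q.fst} ∩ Metric.ball q₀ 1, ?_,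
      (isOpen_lt continuous_const hℓ).inter Metric.isOpen_ball, ?_, Metric.mem_ball_self one_pos⟩
      hq₀
  swap
  · rw [Set.mem_ofPred_eq, hθ2]
    exact hb2
  intro ϑ hϑ
  have hϑc : HasCompactSupport ϑ :=
    (isCompact_closedBall q₀ 1).of_isClosed_subset (isClosed_tsupport _)
      (hϑ.trans (Set.inter_subset_right.trans Metric.ball_subset_closedBall))
  set v : SpaceTime := mkST 1 0 with hv
  have hvin : ∀ q : SpaceTime, ⟪v, q⟫_ℝ = q.fst := fun q => by
    simp [hv, WithLp.prod_inner_apply]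
  -- The shift by `2` makes the cutoff equal to `1` for `t ≥ -1`, that is, on a neighbourhood of the
  -- support of `p`.
  set w : SpaceTime → ℂ := fun q => cutoff (q.fst + 2) * Complex.exp ((-1 * q.fst : ℝ) : ℂ) with hw
  have hwt : w.HasTemperateGrowth := hasTemperateGrowth_cutoff_fst zero_le_one
  set φ := expMul v ϑ hϑc with hφ
  have hφc : HasCompactSupport φ := hasCompactSupport_expMul _ _ _
  set m : SpaceTime → ℂ := fun q => (waveSymbol κt v q)⁻¹ with hm
  have hlow : ∀ q, (1 / c) ^ 2 ≤ ‖waveSymbol κt v q‖ := inv_sq_le_norm_waveSymbol hc hs (by simp [hv])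
    (by simp [hv])
  have hne : ∀ q, waveSymbol κt v q ≠ 0 := fun q h0 => by
    have := hlow q
    rw [h0, norm_zero] at this
    have : 0 < (1 / c) ^ 2 := by positivity
    linarith
  have hσt : (waveSymbol κt v).HasTemperateGrowth :=
    hasTemperateGrowth_waveSymbol hκt _ (by simp [hv])
  have hmt : m.HasTemperateGrowth :=
    hasTemperateGrowth_inv hσt hne (C := c ^ 2) (N := 0) fun q => by
      simpa using norm_inv_waveSymbol_le hc (hlow q)
  set Φ := SchwartzMap.fourierMultiplierCLM ℂ m φ with hΦ
  have hLΦ : waveOp κt v Φ = φ := by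
    refine eq_of_fourier_eq fun q => ?_
    rw [waveOp, fourier_multiplier_apply hσt, hΦ, fourier_multiplier_apply hmt, ← mul_assoc,
      mul_inv_cancel₀ (hne q), one_mul]
  have hO : IsOpen {q : SpaceTime | -1 < q.fst} := isOpen_lt continuous_const hfst
  have hd : Distribution.dsupport p ⊆ {q : SpaceTime | -1 < q.fst} := fun q hq => by
    have h1 : 0 ≤ q.fst := hp.causal hq
    rw [Set.mem_ofPred_eq]
    linarith
  have hae : ∀ᵐ x, h x = 0 ∨ x ∈ Metric.ball (0 : Space3) R := by
    filter_upwards [ae_eq_zero_or_mem_essSupport h] with x hx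
    exact hx.imp_right fun hx => hsupp hx
  have heq := hp.apply_smul_waveOp hκ hκt (v := v) (by simp [hv]) hwt hO
    hd (fun q hq => by
      have : (1 : ℝ) ≤ q.fst + 2 := by
        have : -1 < q.fst := hq
        linarith
      rw [hw, hvin]
      simp only [cutoff_of_one_le this]
      simp)
    (Eventually.of_forall fun x => Or.inr (by simp)) Φ
  rw [hLΦ] at heq
  have h1 : p (SchwartzMap.smulLeftCLM ℂ w φ) = p ϑ := by
    refine apply_eq_of_eqOn p hO hd fun q hq => ?_
    have : (1 : ℝ) ≤ q.fst + 2 := by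
      have : -1 < q.fst := hq
      linarith
    rw [SchwartzMap.smulLeftCLM_apply_apply hwt, hφ, expMul_apply, hw, hvin]
    simp only [cutoff_of_one_le this]
    rw [one_mul, smul_eq_mul, ← mul_assoc, ← Complex.exp_add]
    simp
  -- The source lies in the half-space `⟪θ, x⟫ - c t < b`, on which `Φ` vanishes.
  rw [h1, sourcePairing_congr (ψ := 0) (isOpen_lt hℓ continuous_const)
    (O := {q : SpaceTime | ⟪θ, q.snd⟫_ℝ - c * q.fst < b}) (by
      filter_upwards [hae] with x hx
      refine hx.imp_right fun hx => ?_
      have h2 := real_inner_le_norm θ x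
      rw [hθ1, one_mul] at h2
      have h3 : ‖x‖ < R := by simpa using hx
      simp
      linarith) (fun q hq => by
      rw [SchwartzMap.smulLeftCLM_apply_apply hwt, hΦ,
        multiplier_inv_waveSymbol_eq_zero hκt hc hs hθ1 φ hφc (b := b) (fun y hy =>
          le_of_lt (hϑ (tsupport_expMul_subset _ _ _ hy)).1) hq]
      simp)] at heq
  rw [heq]
  simp [sourcePairing]

end FiniteSpeed

/-! ### Schwartz weights that are exponential near the cone. -/

section ConeWeight

open scoped InnerProductSpace

variable {V : Type*} [NormedAddCommGroup V] [NormedSpace ℝ V]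

theorem derivBound_prod_cutoff {ι : Type*} (s : Finset ι) {ε : ι → ℝ} (hε : ∀ i, 0 ≤ ε i)
    (ℓ : ι → V →L[ℝ] ℝ) (b : ℝ) :
    DerivBound
      (fun (_ : Unit) q => ∏ i ∈ s, cutoff (ℓ i q + b) * Complex.exp ((-ε i * ℓ i q : ℝ) : ℂ))
      (fun _ q => ∏ i ∈ s, Real.exp (-ε i * |ℓ i q|)) := by
  classical
  induction s using Finset.induction_on with
  | empty =>
    refine ⟨fun _ => by simpa using contDiff_const, fun n => ⟨1, zero_le_one, fun _ x => ?_⟩⟩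
    rcases n with _ | n
    · simp
    · simp [iteratedFDeriv_const_of_ne]
  | insert i s hi ih =>
    have h := (derivBound_cutoff_mul_exp (ε i) b (hε i)).comp_affine (fun _ : Unit => ())
      (fun _ => ℓ i) (fun _ => 0) (fun _ => le_rfl)
    simpa [Finset.prod_insert hi] using h.mul ih

/-- The coordinate forms `t` and `c t ± x_j`, which are bounded below on the cone. -/
noncomputable def coneForm (c : ℝ) : Option (Fin 3 × Bool) → SpaceTime →L[ℝ] ℝ
  | none => WithLp.fstL 2 ℝ ℝ Space3
  | some (j, true) => c • WithLp.fstL 2 ℝ ℝ Space3 +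
      (EuclideanSpace.proj j : Space3 →L[ℝ] ℝ) ∘L WithLp.sndL 2 ℝ ℝ Space3
  | some (j, false) => c • WithLp.fstL 2 ℝ ℝ Space3 -
      (EuclideanSpace.proj j : Space3 →L[ℝ] ℝ) ∘L WithLp.sndL 2 ℝ ℝ Space3

theorem norm_le_sum_abs_coneForm (c : ℝ) (q : SpaceTime) :
    ‖q‖ ≤ ∑ i, |coneForm c i q| := by
  have h1 : ‖q‖ ≤ |q.fst| + (|q.snd 0| + |q.snd 1| + |q.snd 2|) := by
    refine abs_le_of_sq_le_sq' ?_ (by positivity) |>.2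
    rw [WithLp.prod_norm_sq_eq_of_L2, EuclideanSpace.norm_sq_eq, Fin.sum_univ_three]
    simp only [Real.norm_eq_abs]
    nlinarith [mul_nonneg (abs_nonneg q.fst) (abs_nonneg (q.snd 0)),
      mul_nonneg (abs_nonneg q.fst) (abs_nonneg (q.snd 1)),
      mul_nonneg (abs_nonneg q.fst) (abs_nonneg (q.snd 2)),
      mul_nonneg (abs_nonneg (q.snd 0)) (abs_nonneg (q.snd 1)),
      mul_nonneg (abs_nonneg (q.snd 0)) (abs_nonneg (q.snd 2)),
      mul_nonneg (abs_nonneg (q.snd 1)) (abs_nonneg (q.snd 2))]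
  have h2 : ∀ a b : ℝ, |b| ≤ |a + b| + |a - b| := fun a b => by
    have h3 := abs_sub (a + b) (a - b)
    have e : a + b - (a - b) = 2 * b := by ring
    rw [e, abs_mul, abs_two] at h3
    linarith [abs_nonneg b]
  refine h1.trans ?_
  rw [Fintype.sum_option, Fintype.sum_prod_type, Fin.sum_univ_three]
  simp only [Fintype.sum_bool, coneForm]
  have h3 := h2 (c * q.fst) (q.snd 0)
  have h4 := h2 (c * q.fst) (q.snd 1)
  have h5 := h2 (c * q.fst) (q.snd 2)
  simp
  linarith

/-- An exponential weight which grows more slowly in space than it decays in time agrees with a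
Schwartz function near the cone. -/
theorem exists_schwartz_eq_exp {c y a R : ℝ} (hc : 0 < c) (ha : 0 ≤ a) (hay : a * c < y)
    (hR : 0 ≤ R) :
    ∃ (w : 𝓢(SpaceTime, ℂ)) (O : Set SpaceTime), IsOpen O ∧
      {q : SpaceTime | 0 ≤ q.fst ∧ ‖q.snd‖ ≤ c * q.fst + R} ⊆ O ∧
      ∀ q ∈ O, w q =
        Complex.exp ((-⟪mkST y (EuclideanSpace.single 0 a), q⟫_ℝ : ℝ) : ℂ) := by
  set δ := (y - a * c) / 2 with hδ
  have hδ0 : 0 < δ := by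
    rw [hδ]
    linarith
  -- Positive coefficients with `∑ ε i * coneForm c i = y t + a x₀`: the six forms `c t ± x_j` with
  -- coefficient `δ / (6c)` add up to `δ t`, the extra `a (c t + x₀)` contributes `a c t + a x₀`,
  -- and `2δ + a c = y`.
  let ε : Option (Fin 3 × Bool) → ℝ
    | none => δ
    | some (j, s) => δ / (6 * c) + if j = 0 ∧ s = true then a else 0
  set ε₀ := min δ (δ / (6 * c)) with hε₀
  have hε₀0 : 0 < ε₀ := lt_min hδ0 (by positivity)
  have hε : ∀ i, ε₀ ≤ ε i := by
    rintro (_ | ⟨j, s⟩)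
    · exact min_le_left _ _
    · refine (min_le_right _ _).trans ?_
      simp only [ε]
      split_ifs <;> linarith
  obtain ⟨w, hw⟩ := (derivBound_prod_cutoff Finset.univ (fun i => hε₀0.le.trans (hε i))
    (coneForm c) (R + 2)).exists_schwartz hε₀0 zero_le_one fun q => by
      rw [← Real.exp_sum, one_mul, Real.exp_le_exp, neg_mul]
      calc _ ≤ ∑ i, -(ε₀ * |coneForm c i q|) := by
            refine Finset.sum_le_sum fun i _ => ?_
            rw [neg_mul]
            gcongr
            exact hε i
        _ ≤ _ := by
            rw [Finset.sum_neg_distrib, ← Finset.mul_sum]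
            gcongr
            exact norm_le_sum_abs_coneForm c q
  -- The forms are at least `-R` on the cone for `t ≥ 0`, and the cutoffs, shifted by `R + 2`, equal
  -- `1` from `-(R + 1)` on. The margin makes `O` an open neighbourhood.
  refine ⟨w, ⋂ i, {q | -(R + 1) < coneForm c i q},
    isOpen_iInter_of_finite fun i => isOpen_lt continuous_const (coneForm c i).continuous,
    fun q hq => ?_, fun q hq => ?_⟩
  · refine Set.mem_iInter.2 fun i => ?_
    have h1 : ∀ j, |q.snd j| ≤ ‖q.snd‖ := fun j => PiLp.norm_apply_le q.snd j
    obtain ⟨ht, hx⟩ := hq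
    rw [Set.mem_ofPred_eq]
    rcases i with _ | ⟨j, _ | _⟩
    · simp [coneForm]
      linarith
    · have := abs_le.1 (h1 j)
      simp [coneForm]
      linarith
    · have := abs_le.1 (h1 j)
      simp [coneForm]
      linarith
  · rw [hw, Finset.prod_congr rfl fun i _ => by
      rw [cutoff_of_one_le (by linarith [show -(R + 1) < coneForm c i q from Set.mem_iInter.1 hq i]),
        one_mul], ← Complex.exp_sum, ← Complex.ofReal_sum]
    congr 2
    rw [Fintype.sum_option, Fintype.sum_prod_type, Fin.sum_univ_three, WithLp.prod_inner_apply]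
    simp [coneForm, ε, EuclideanSpace.inner_single_left]
    field_simp
    rw [hδ]
    ring

end ConeWeight

/-! ### Band-limited approximations of plane waves. -/

section ApproximateIdentity

open scoped ContDiff FourierTransform InnerProductSpace

variable {E : Type*} [NormedAddCommGroup E] [InnerProductSpace ℝ E] [FiniteDimensional ℝ E]
  [MeasurableSpace E] [BorelSpace E]

/-- Normalized bumps on the Fourier side. Their inverse transforms approach the character of
frequency `q₀`, while all supports stay in one ball. -/
theorem exists_approximate_identity (q₀ : E) :
    ∃ b : ℕ → 𝓢(E, ℂ), (∀ n q, ‖q₀‖ + 1 < ‖q‖ → b n q = 0) ∧ (∀ n, ∫ q, ‖b n q‖ = 1) ∧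
      (∀ n q, b n q = ‖b n q‖) ∧
      ∀ F : E → ℂ, Continuous F → Tendsto (fun n => ∫ q, b n q * F q) atTop (𝓝 (F q₀)) := by
  let β : ℕ → ContDiffBump q₀ := fun n =>
    ⟨1 / (n + 2), 1 / (n + 1), by positivity, by gcongr; linarith⟩
  have hcs : ∀ n, HasCompactSupport (fun q => (((β n).normed volume q : ℝ) : ℂ)) := fun n =>
    (β n).hasCompactSupport_normed.comp_left (g := Complex.ofReal) (by simp)
  let b : ℕ → 𝓢(E, ℂ) := fun n => (hcs n).toSchwartzMap
    (Complex.ofRealCLM.contDiff.comp (β n).contDiff_normed)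
  have hb : ∀ n q, b n q = (((β n).normed volume q : ℝ) : ℂ) := fun n q => rfl
  have hn : ∀ n q, ‖b n q‖ = (β n).normed volume q := fun n q => by
    rw [hb, Complex.norm_real, Real.norm_of_nonneg ((β n).nonneg_normed q)]
  have hz : ∀ (n : ℕ) (q : E), 1 / ((n : ℝ) + 1) ≤ dist q q₀ → b n q = 0 := fun n q hq => by
    have h1 : q ∉ Function.support ((β n).normed volume) := by
      rw [(β n).support_normed_eq, Metric.mem_ball, not_lt]
      exact hq
    rw [hb, Function.notMem_support.1 h1, Complex.ofReal_zero]
  refine ⟨b, fun n q hq => hz n q (?_ : 1 / ((n : ℝ) + 1) ≤ dist q q₀), fun n => ?_, fun n q => ?_, fun F hF => ?_⟩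
  · have h1 : 1 / ((n : ℝ) + 1) ≤ 1 := by
      rw [div_le_one (by positivity)]
      simp
    have h2 := norm_sub_norm_le q q₀
    rw [← dist_eq_norm] at h2
    linarith
  · simp_rw [hn]
    exact (β n).integral_normed
  · rw [hn, hb]
  · have h1 : ∀ n, ∫ q, b n q = 1 := fun n => by
      simp_rw [hb]
      rw [integral_complex_ofReal, (β n).integral_normed, Complex.ofReal_one]
    rw [Metric.tendsto_atTop]
    intro ε hε
    obtain ⟨δ, hδ, hFδ⟩ := Metric.continuousAt_iff.1 hF.continuousAt (ε / 2) (half_pos hε)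
    obtain ⟨N, hN⟩ := exists_nat_one_div_lt hδ
    refine ⟨N, fun n hnN => ?_⟩
    have hi1 : Integrable (fun q => b n q * F q) :=
      ((b n).continuous.mul hF).integrable_of_hasCompactSupport ((hcs n).mul_right)
    have hi2 : Integrable (fun q => b n q * F q₀) := (b n).integrable.mul_const _
    have e : (∫ q, b n q * F q) - F q₀ = ∫ q, b n q * (F q - F q₀) := by
      simp_rw [mul_sub]
      rw [integral_sub hi1 hi2, integral_mul_const, h1, one_mul]
    rw [dist_eq_norm, e]
    refine lt_of_le_of_lt ?_ (half_lt_self hε)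
    have h3 : ∫ q, ‖b n q‖ * (ε / 2) = ε / 2 := by
      simp_rw [hn]
      rw [integral_mul_const, (β n).integral_normed, one_mul]
    rw [← h3]
    refine norm_integral_le_of_norm_le ((b n).integrable.norm.mul_const _)
      (Eventually.of_forall fun q => ?_)
    rw [norm_mul]
    rcases lt_or_ge (dist q q₀) (1 / ((n : ℝ) + 1)) with hq | hq
    · have h4 : dist q q₀ < δ := hq.trans_le ((one_div_le_one_div_of_le (by positivity)
        (by gcongr)).trans hN.le)
      have h5 := (hFδ h4).le
      rw [dist_eq_norm] at h5
      gcongr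
    · simp [hz n q hq]

/-- Band-limited functions have uniformly bounded derivatives. -/
theorem derivBound_fourierInv {ι : Type*} {g : ι → 𝓢(E, ℂ)} {r : ℝ} (hr : 0 ≤ r)
    (hg : ∀ i q, r < ‖q‖ → g i q = 0) :
    DerivBound (fun i => ⇑(𝓕⁻ (g i) : 𝓢(E, ℂ))) (fun i _ => ∫ q, ‖g i q‖) := by
  refine ⟨fun i => (𝓕⁻ (g i) : 𝓢(E, ℂ)).smooth ⊤, fun n =>
    ⟨(2 * Real.pi * ‖innerSL ℝ (E := E)‖) ^ n * r ^ n, by positivity, fun i x => ?_⟩⟩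
  have hint : ∀ k : ℕ, Integrable (fun q => ‖q‖ ^ k * ‖g i (-q)‖) := fun k => by
    have h1 := ((g i).integrable_pow_mul volume k).comp_neg
    simpa using h1
  rw [SchwartzMap.fourierInv_coe, Real.fourierInv_eq_fourier_comp_neg,
    Real.iteratedFDeriv_fourier (N := ⊤) (fun k _ => hint k)
      ((g i).continuous.comp continuous_neg).aestronglyMeasurable le_top]
  have h2 : ∫ q, ‖g i q‖ = ∫ q, ‖g i (-q)‖ := (integral_neg_eq_self (fun q => ‖g i q‖) volume).symm
  rw [h2, ← integral_const_mul, Real.fourier_eq]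
  refine norm_integral_le_of_norm_le ((g i).integrable.norm.comp_neg.const_mul _)
    (Eventually.of_forall fun q => ?_)
  rw [Circle.norm_smul]
  refine (VectorFourier.norm_fourierPowSMulRight_le _ _ _ _).trans ?_
  rcases le_or_gt ‖q‖ r with hq | hq
  · gcongr
  · simp [hg i (-q) (by simpa using hq)]

/-- The functions `w 𝓕⁻ g` tend to zero if the functions `g` tend to zero in `L¹` and have
uniformly bounded supports. -/
theorem tendsto_apply_smulLeft_fourierInv (p : 𝓢'(E, ℂ)) (w : 𝓢(E, ℂ)) {g : ℕ → 𝓢(E, ℂ)} {r : ℝ}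
    (hr : 0 ≤ r) (hg : ∀ i q, r < ‖q‖ → g i q = 0)
    (hlim : Tendsto (fun i => ∫ q, ‖g i q‖) atTop (𝓝 0)) :
    Tendsto (fun i => p (SchwartzMap.smulLeftCLM ℂ (w : E → ℂ) (𝓕⁻ (g i) : 𝓢(E, ℂ)))) atTop
      (𝓝 0) := by
  have h0 : Tendsto (fun i => SchwartzMap.smulLeftCLM ℂ (w : E → ℂ) (𝓕⁻ (g i) : 𝓢(E, ℂ))) atTop
      (𝓝 0) := by
    rw [(schwartz_withSeminorms ℝ E ℂ).tendsto_nhds]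
    rintro ⟨k, n⟩ ε hε
    obtain ⟨C, hC, hb⟩ := norm_pow_mul_iteratedFDeriv_mul_le (derivBound_fourierInv hr hg)
      Set.univ (fun i => ∫ q, ‖g i q‖) 0 (fun i x _ => by simp) k n
    set M := (Finset.Iic (k + 0, n)).sup (schwartzSeminormFamily ℝ E ℂ) w
    have hM : 0 ≤ M := apply_nonneg _ _
    have hlim2 : Tendsto (fun i => C * |∫ q, ‖g i q‖| * M) atTop (𝓝 0) := by
      simpa using (hlim.abs.const_mul C).mul_const M
    filter_upwards [hlim2.eventually (gt_mem_nhds hε)] with i hi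
    refine lt_of_le_of_lt ?_ hi
    rw [sub_zero]
    refine SchwartzMap.seminorm_le_bound ℝ k n _ (by positivity) fun x => ?_
    have h3 : ⇑(SchwartzMap.smulLeftCLM ℂ (w : E → ℂ) (𝓕⁻ (g i) : 𝓢(E, ℂ))) =
        fun y => (𝓕⁻ (g i) : 𝓢(E, ℂ)) y * w y := by
      ext y
      rw [SchwartzMap.smulLeftCLM_apply_apply w.hasTemperateGrowth, smul_eq_mul, mul_comm]
    rw [h3]
    exact hb i w (Set.subset_univ _) x
  simpa [Function.comp_def] using ((continuous_temperedDistribution p).tendsto 0).comp h0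

end ApproximateIdentity

/-! ### Part (ii): testing with a complex plane wave. -/

section FasterPropagation

open scoped FourierTransform InnerProductSpace

theorem hasDerivAt_time (ϑ : 𝓢(SpaceTime, ℂ)) (x : Space3) (t : ℝ) :
    HasDerivAt (fun t : ℝ => ϑ (mkST t x)) ((∂_{mkST 1 0} ϑ : 𝓢(SpaceTime, ℂ)) (mkST t x)) t := by
  have h1 : HasDerivAt (fun t : ℝ => mkST 0 x + t • mkST 1 0) (mkST 1 0) t := by
    simpa using ((hasDerivAt_id t).smul_const (mkST 1 0)).const_add (mkST 0 x)
  have e : ∀ t : ℝ, mkST 0 x + t • mkST 1 0 = mkST t x := fun t => by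
    rw [← WithLp.toLp_smul, ← WithLp.toLp_add]
    simp
  have h2 := ϑ.hasFDerivAt (x := mkST 0 x + t • mkST 1 0)
  have h3 := h2.comp_hasDerivAt t h1
  simp only [Function.comp_def, e] at h3
  rw [SchwartzMap.lineDerivOp_apply_eq_fderiv]
  exact h3

theorem lineDeriv_time_eq_fourierInv (ϑ : 𝓢(SpaceTime, ℂ)) (y : SpaceTime) :
    (∂_{mkST 1 0} ϑ : 𝓢(SpaceTime, ℂ)) y =
      𝓕⁻ (fun q => Complex.I * freq 0 q * 𝓕 ϑ q) y := by
  have h : (∂_{mkST 1 0} ϑ : 𝓢(SpaceTime, ℂ)) =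
      𝓕⁻ (𝓕 (∂_{mkST 1 0} ϑ : 𝓢(SpaceTime, ℂ)) : 𝓢(SpaceTime, ℂ)) := by simp
  rw [h, SchwartzMap.fourierInv_coe]
  refine congrArg (fun f : SpaceTime → ℂ => 𝓕⁻ f y) (funext fun q => ?_)
  rw [fourier_lineDeriv_apply]
  simp only [freq, WithLp.prod_inner_apply, inner_zero_right, add_zero, Complex.ofReal_zero,
    zero_mul]
  simp
  ring_nf
  simp

theorem integrable_mul_of_norm_le (b : 𝓢(SpaceTime, ℂ)) {G : SpaceTime → ℂ} (hG : Continuous G)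
    {C : ℝ} (hC : ∀ q, ‖G q‖ ≤ C * (1 + ‖q‖)) : Integrable (fun q => b q * G q) := by
  refine Integrable.mono' ((b.integrable.norm.add (b.integrable_pow_mul volume 1)).const_mul C)
    (b.continuous.mul hG).aestronglyMeasurable (Eventually.of_forall fun q => ?_)
  rw [norm_mul]
  have := mul_le_mul_of_nonneg_left (hC q) (norm_nonneg (b q))
  simp only [Pi.add_apply, pow_one]
  linarith

/-- The time derivative of a band-limited function with an exponential weight. -/
theorem hasDerivAt_exp_mul_fourierInv (b : 𝓢(SpaceTime, ℂ)) (v : SpaceTime) (x : Space3) :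
    HasDerivAt (fun t : ℝ => Complex.exp ((-⟪v, mkST t x⟫_ℝ : ℝ) : ℂ) *
        (𝓕⁻ b : 𝓢(SpaceTime, ℂ)) (mkST t x))
      (Complex.exp ((-⟪v, mkST 0 x⟫_ℝ : ℝ) : ℂ) * ∫ q, b q * (Complex.I * freq v.fst q *
        Complex.exp (((2 * Real.pi * ⟪q, mkST 0 x⟫_ℝ : ℝ) : ℂ) * Complex.I))) 0 := by
  have h1 := hasDerivAt_time (𝓕⁻ b) x 0
  have h2 : HasDerivAt (fun t : ℝ => Complex.exp ((-⟪v, mkST t x⟫_ℝ : ℝ) : ℂ))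
      (Complex.exp ((-⟪v, mkST 0 x⟫_ℝ : ℝ) : ℂ) * (-v.fst : ℝ)) 0 := by
    refine HasDerivAt.cexp (HasDerivAt.ofReal_comp ?_)
    have h3 := (((hasDerivAt_id (0 : ℝ)).mul_const v.fst).add_const (⟪v.snd, x⟫_ℝ)).neg
    rw [one_mul] at h3
    refine h3.congr_of_eventuallyEq (Eventually.of_forall fun t => ?_)
    simp [WithLp.prod_inner_apply]
  have h3 : HasDerivAt (fun t : ℝ => Complex.exp ((-⟪v, mkST t x⟫_ℝ : ℝ) : ℂ) *
      (𝓕⁻ b : 𝓢(SpaceTime, ℂ)) (mkST t x)) _ 0 := h2.mul h1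
  have hi1 := integrable_mul_of_norm_le b
    (G := fun q => Complex.exp (((2 * Real.pi * ⟪q, mkST 0 x⟫_ℝ : ℝ) : ℂ) * Complex.I))
    (by fun_prop) (C := 1) fun q => by
      rw [Complex.norm_exp_ofReal_mul_I]
      linarith [norm_nonneg q]
  have hi2 := integrable_mul_of_norm_le b
    (G := fun q => Complex.exp (((2 * Real.pi * ⟪q, mkST 0 x⟫_ℝ : ℝ) : ℂ) * Complex.I) *
      (Complex.I * freq 0 q))
    (by
      have : Continuous (freq 0) := continuous_freq.comp (Continuous.prodMk_right (0 : ℝ))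
      fun_prop) (C := 7) fun q => by
      rw [norm_mul, Complex.norm_exp_ofReal_mul_I, norm_mul, Complex.norm_I]
      have := norm_freq_le 0 q
      rw [abs_zero] at this
      linarith
  -- The weight contributes `-η` and the Fourier kernel `2πiτ`; together they give `i * freq η`.
  refine h3.congr_deriv ?_
  rw [lineDeriv_time_eq_fourierInv, FourierTransform.fourier_fourierInv_eq,
    SchwartzMap.fourierInv_coe, Real.fourierInv_eq', Real.fourierInv_eq']
  rw [mul_assoc, ← mul_add]
  congr 1
  rw [← integral_const_mul, ← integral_add]
  · refine integral_congr_ae (Eventually.of_forall fun q => ?_)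
    simp only [smul_eq_mul, freq]
    push_cast
    linear_combination (-v.fst * b q * Complex.exp (2 * Real.pi * ⟪q, mkST 0 x⟫_ℝ * Complex.I)) *
      Complex.I_sq
  · refine (hi1.const_mul ((-v.fst : ℝ) : ℂ)).congr (Eventually.of_forall fun q => ?_)
    simp only [smul_eq_mul]
    ring
  · refine hi2.congr (Eventually.of_forall fun q => ?_)
    simp only [smul_eq_mul]
    ring

variable {κ : ℝ → ℂ} {κt : ℂ → ℂ} {c : ℝ}

/-- On so small a ball the real part of the integrand is at least `exp (-1) * cos 1 > 0`. -/
theorem integral_ball_exp_ne_zero {k : ℂ} {r : ℝ} (hr : 0 < r) (hkr : ‖k‖ * r ≤ 1) :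
    ∫ x in Metric.ball (0 : Space3) r, Complex.exp (Complex.I * k * (x 0 : ℝ)) ≠ 0 := by
  intro h0
  have hc : Continuous (fun x : Space3 => Complex.exp (Complex.I * k * (x 0 : ℝ))) := by fun_prop
  have hint : IntegrableOn (fun x : Space3 => Complex.exp (Complex.I * k * (x 0 : ℝ)))
      (Metric.ball 0 r) :=
    (hc.continuousOn.integrableOn_compact (isCompact_closedBall 0 r)).mono_set
      Metric.ball_subset_closedBall
  have h1 : ∫ x in Metric.ball (0 : Space3) r, (Complex.exp (Complex.I * k * (x 0 : ℝ))).re = 0 := by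
    have := Complex.reCLM.integral_comp_comm hint
    simpa [h0] using this
  have h2 : ∀ x ∈ Metric.ball (0 : Space3) r,
      Real.exp (-1) * Real.cos 1 ≤ (Complex.exp (Complex.I * k * (x 0 : ℝ))).re := by
    intro x hx
    have hx1 : |x 0| ≤ r := (PiLp.norm_apply_le x 0).trans (by simpa using (mem_ball_zero_iff.1 hx).le)
    have h3 : |k.re * x 0| ≤ 1 := by
      rw [abs_mul]
      exact (mul_le_mul (Complex.abs_re_le_norm k) hx1 (abs_nonneg _) (norm_nonneg _)).trans hkr
    have h4 : |k.im * x 0| ≤ 1 := by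
      rw [abs_mul]
      exact (mul_le_mul (Complex.abs_im_le_norm k) hx1 (abs_nonneg _) (norm_nonneg _)).trans hkr
    have e : Complex.I * k * (x 0 : ℝ) = ((-(k.im * x 0) : ℝ) : ℂ) +
        ((k.re * x 0 : ℝ) : ℂ) * Complex.I := by
      apply Complex.ext <;> simp
    rw [e, Complex.exp_add, Complex.exp_ofReal_mul_I, ← Complex.ofReal_exp, Complex.re_ofReal_mul]
    have h5 : Real.cos 1 ≤ Real.cos (k.re * x 0) := by
      rw [← Real.cos_abs (k.re * x 0)]
      exact Real.cos_le_cos_of_nonneg_of_le_pi (abs_nonneg _) (by linarith [Real.pi_gt_three]) h3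
    have h6 := Real.cos_one_pos
    have h7 := (abs_le.1 h4).2
    have e2 : ∀ u s : ℝ, ((u : ℂ) + (s : ℂ) * Complex.I).re = u := fun u s => by simp
    rw [e2]
    gcongr
  have h3 := setIntegral_ge_of_const_le_real (μ := volume) measurableSet_ball
    measure_ball_lt_top.ne h2 hint.re
  have h4 : 0 < volume.real (Metric.ball (0 : Space3) r) :=
    ENNReal.toReal_pos (Metric.measure_ball_pos _ _ hr).ne' measure_ball_lt_top.ne
  have h5 : 0 < Real.exp (-1) * Real.cos 1 := mul_pos (Real.exp_pos _) Real.cos_one_pos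
  have h6 := mul_pos h5 h4
  exact absurd (h3.trans_eq h1) (by linarith)

/-- If `p` lived in the cone, it could be paired with `exp(i(z t + k x₀))`. This plane wave solves
the homogeneous equation, so its pairing with the source would have to vanish. -/
theorem not_dsupport_subset_cone (hκ : IsAttenuationCoefficient κ)
    (hκt : IsHolomorphicContinuation κ κt) (hc : 0 < c) {z : ℂ} (hz : 0 < z.im)
    (hlt : (κt z).im < z.im / c) {r R : ℝ} (hr : 0 < r) (hkr : ‖κt z‖ * r ≤ 1) (hrR : r ≤ R)
    {p : 𝓢'(SpaceTime, ℂ)}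
    (hp : IsCausalSolution κ (Set.indicator (Metric.ball 0 r) 1) p) :
    ¬ Distribution.dsupport p ⊆ {q : SpaceTime | ‖q.snd‖ ≤ c * q.fst + R} := by
  intro hcone
  set k := κt z with hk
  set e₁ : ℝ → Space3 := fun a => EuclideanSpace.single 0 a with he₁
  set v : SpaceTime := mkST z.im (e₁ k.im) with hv
  -- Together, `v` and `q₀` encode the complex covector `(z, k e₁)`, at which `ζ ⬝ ζ = k²` and the
  -- symbol vanishes.
  set q₀ : SpaceTime := mkST (z.re / (2 * Real.pi)) (e₁ (k.re / (2 * Real.pi))) with hq₀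
  have hpi := Real.pi_ne_zero
  have hfreq : freq v.fst q₀ = z := by
    apply Complex.ext
    · rw [freq_re, hq₀]
      simp
      field_simp
    · rw [freq_im]
      rfl
  have hsym : waveSymbol κt v q₀ = 0 := by
    rw [waveSymbol, hfreq, ← hk]
    have h1 : ⟪q₀.snd, v.snd⟫_ℝ = k.re / (2 * Real.pi) * k.im := by
      simp [hq₀, hv, he₁, EuclideanSpace.inner_single_left, mul_comm]
    have h2 : ‖q₀.snd‖ ^ 2 = (k.re / (2 * Real.pi)) ^ 2 := by
      simp [hq₀, he₁, div_pow, abs_of_pos Real.pi_pos]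
    have h3 : ‖v.snd‖ ^ 2 = k.im ^ 2 := by
      simp [hv, he₁]
    have h4 : (2 * Real.pi) ^ 2 * (k.re / (2 * Real.pi)) ^ 2 = k.re ^ 2 := by
      field_simp
    have h5 : 4 * Real.pi * (k.re / (2 * Real.pi) * k.im) = 2 * k.re * k.im := by
      field_simp
      ring
    rw [h1, h2, h3, h4, h5]
    apply Complex.ext <;> simp [sq]
    ring
  obtain ⟨w, O, hO, hcO, hwO⟩ := exists_schwartz_eq_exp (y := z.im) (R := R) hc
    (hκt.im_nonneg z hz.le) (by rwa [lt_div_iff₀ hc] at hlt) (hr.le.trans hrR)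
  have hballO : ∀ x ∈ Metric.ball (0 : Space3) r, mkST 0 x ∈ O := fun x hx => by
    refine hcO ⟨le_rfl, ?_⟩
    have := mem_ball_zero_iff.1 hx
    simp
    linarith
  have hσt : (waveSymbol κt v).HasTemperateGrowth := hasTemperateGrowth_waveSymbol hκt v hz
  have hσc : Continuous (waveSymbol κt v) := hσt.1.continuous
  obtain ⟨b, hbs, hb1, hbn, hblim⟩ := exists_approximate_identity q₀
  set g : ℕ → 𝓢(SpaceTime, ℂ) := fun n => SchwartzMap.smulLeftCLM ℂ (waveSymbol κt v) (b n) with hg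
  have hga : ∀ n q, g n q = waveSymbol κt v q * b n q := fun n q => by
    rw [hg, SchwartzMap.smulLeftCLM_apply_apply hσt, smul_eq_mul]
  -- As `b n ≥ 0`, these `L¹` norms are averages of `‖waveSymbol κt v ·‖` concentrating at its zero
  -- `q₀`.
  have hglim : Tendsto (fun n => ∫ q, ‖g n q‖) atTop (𝓝 0) := by
    have h1 := hblim (fun q => (‖waveSymbol κt v q‖ : ℂ)) (by fun_prop)
    rw [hsym, norm_zero, Complex.ofReal_zero] at h1
    have h2 := (Complex.continuous_re.tendsto 0).comp h1
    rw [Complex.zero_re] at h2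
    refine h2.congr fun n => ?_
    rw [Function.comp_apply]
    have : ∫ q, b n q * (‖waveSymbol κt v q‖ : ℂ) = ((∫ q, ‖g n q‖ : ℝ) : ℂ) := by
      rw [← integral_complex_ofReal]
      refine integral_congr_ae (Eventually.of_forall fun q => ?_)
      simp only [hga, norm_mul, Complex.ofReal_mul]
      rw [mul_comm, ← hbn]
    rw [this, Complex.ofReal_re]
  have hlhs := tendsto_apply_smulLeft_fourierInv p w (r := ‖q₀‖ + 1) (by positivity)
    (fun n q hq => by rw [hga, hbs n q hq, mul_zero]) hglim
  set ψ : ℕ → 𝓢(SpaceTime, ℂ) := fun n =>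
    SchwartzMap.smulLeftCLM ℂ (w : SpaceTime → ℂ) (𝓕⁻ (b n) : 𝓢(SpaceTime, ℂ)) with hψ
  have heq : ∀ n, p (SchwartzMap.smulLeftCLM ℂ (w : SpaceTime → ℂ) (𝓕⁻ (g n) : 𝓢(SpaceTime, ℂ))) =
      -sourcePairing (Set.indicator (Metric.ball 0 r) 1) (ψ n) := fun n => by
    rw [← hp.apply_smul_waveOp hκ hκt (v := v) hz w.hasTemperateGrowth hO
      (fun q hq => hcO ⟨hp.causal hq, hcone hq⟩) hwO (Eventually.of_forall fun x => ?_)]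
    · rw [waveOp, SchwartzMap.fourierMultiplierCLM_apply, FourierTransform.fourier_fourierInv_eq]
    · by_cases hx : x ∈ Metric.ball (0 : Space3) r
      · exact Or.inr (hballO x hx)
      · exact Or.inl (Set.indicator_of_notMem hx _)
  set G : Space3 → SpaceTime → ℂ := fun x q => Complex.I * freq v.fst q *
    Complex.exp (((2 * Real.pi * ⟪q, mkST 0 x⟫_ℝ : ℝ) : ℂ) * Complex.I) with hG
  set W : Space3 → ℂ := fun x => Complex.exp ((-⟪v, mkST 0 x⟫_ℝ : ℝ) : ℂ) with hW
  have hderiv : ∀ n, ∀ x ∈ Metric.ball (0 : Space3) r,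
      HasDerivAt (fun t : ℝ => ψ n (mkST t x)) (W x * ∫ q, b n q * G x q) 0 := by
    intro n x hx
    have hcont : Continuous (fun t : ℝ => mkST t x) := by fun_prop
    refine (hasDerivAt_exp_mul_fourierInv (b n) v x).congr_of_eventuallyEq ?_
    filter_upwards [(hO.preimage hcont).mem_nhds (hballO x hx)] with t ht
    rw [hψ, SchwartzMap.smulLeftCLM_apply_apply w.hasTemperateGrowth, hwO _ ht, smul_eq_mul]
  have hfc : Continuous (freq v.fst) := continuous_freq.comp (Continuous.prodMk_right v.fst)
  have hpair : ∀ n, sourcePairing (Set.indicator (Metric.ball 0 r) 1) (ψ n) =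
      ∫ x in Metric.ball (0 : Space3) r, (∂_{mkST 1 0} (ψ n) : 𝓢(SpaceTime, ℂ)) (mkST 0 x) := by
    intro n
    rw [sourcePairing, ← integral_indicator measurableSet_ball]
    refine integral_congr_ae (Eventually.of_forall fun x => ?_)
    by_cases hx : x ∈ Metric.ball (0 : Space3) r
    · simp only [Set.indicator_of_mem hx, (hasDerivAt_time (ψ n) x 0).deriv]
      simp
    · simp [Set.indicator_of_notMem hx]
  -- Dominated convergence on the ball: `‖k‖ r ≤ 1` bounds the weight by `exp 1`, and the common
  -- support of the `b n` bounds the frequency.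
  have hrhs : Tendsto (fun n => sourcePairing (Set.indicator (Metric.ball 0 r) 1) (ψ n)) atTop
      (𝓝 (∫ x in Metric.ball (0 : Space3) r, W x * G x q₀)) := by
    simp_rw [hpair]
    refine tendsto_integral_of_dominated_convergence
      (fun _ => Real.exp 1 * (7 * (‖q₀‖ + 1) + |v.fst|)) (fun n => ?_) ?_ (fun n => ?_) ?_
    · have : Continuous (fun x => (∂_{mkST 1 0} (ψ n) : 𝓢(SpaceTime, ℂ)) (mkST 0 x)) :=
        (∂_{mkST 1 0} (ψ n) : 𝓢(SpaceTime, ℂ)).continuous.comp (by fun_prop)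
      exact this.aestronglyMeasurable
    · exact integrableOn_const measure_ball_lt_top.ne
    · refine (ae_restrict_iff' measurableSet_ball).2 (Eventually.of_forall fun x hx => ?_)
      rw [(hasDerivAt_time (ψ n) x 0).unique (hderiv n x hx), norm_mul]
      gcongr
      · rw [hW, Complex.norm_exp, Complex.ofReal_re, Real.exp_le_exp]
        have h1 : |x 0| ≤ r := (PiLp.norm_apply_le x 0).trans (mem_ball_zero_iff.1 hx).le
        have h2 : |k.im * x 0| ≤ 1 := by
          rw [abs_mul]
          exact (mul_le_mul (Complex.abs_im_le_norm k) h1 (abs_nonneg _) (norm_nonneg _)).trans hkr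
        have h3 : ⟪v, mkST 0 x⟫_ℝ = k.im * x 0 := by
          simp [hv, he₁, WithLp.prod_inner_apply, EuclideanSpace.inner_single_left]
        rw [h3]
        linarith [(abs_le.1 h2).1]
      · have h1 : ∫ q, ‖b n q‖ * (7 * (‖q₀‖ + 1) + |v.fst|) = 7 * (‖q₀‖ + 1) + |v.fst| := by
          rw [integral_mul_const, hb1, one_mul]
        rw [← h1]
        refine norm_integral_le_of_norm_le ((b n).integrable.norm.mul_const _)
          (Eventually.of_forall fun q => ?_)
        rw [norm_mul]
        rcases le_or_gt ‖q‖ (‖q₀‖ + 1) with hq | hq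
        · gcongr
          rw [hG, norm_mul, Complex.norm_exp_ofReal_mul_I, norm_mul, Complex.norm_I, one_mul,
            mul_one]
          have := norm_freq_le v.fst q
          linarith
        · simp [hbs n q hq]
    · refine (ae_restrict_iff' measurableSet_ball).2 (Eventually.of_forall fun x hx => ?_)
      have h1 : Continuous (G x) := by
        simp only [hG]
        fun_prop
      refine ((hblim _ h1).const_mul (W x)).congr fun n => ?_
      exact ((hasDerivAt_time (ψ n) x 0).unique (hderiv n x hx)).symm
  have hzero : ∫ x in Metric.ball (0 : Space3) r, W x * G x q₀ = 0 := by
    refine tendsto_nhds_unique hrhs ?_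
    have := hlhs.neg
    simp_rw [heq, neg_neg, neg_zero] at this
    exact this
  have hz0 : Complex.I * z ≠ 0 := mul_ne_zero Complex.I_ne_zero fun h => by
    rw [h, Complex.zero_im] at hz
    exact lt_irrefl _ hz
  have hWG : ∀ x, W x * G x q₀ = Complex.I * z * Complex.exp (Complex.I * k * (x 0 : ℝ)) := by
    intro x
    simp only [hW, hG, hfreq]
    rw [mul_left_comm, ← Complex.exp_add]
    congr 2
    have h3 : ⟪v, mkST 0 x⟫_ℝ = k.im * x 0 := by
      simp [hv, he₁, WithLp.prod_inner_apply, EuclideanSpace.inner_single_left]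
    have h4 : ⟪q₀, mkST 0 x⟫_ℝ = k.re / (2 * Real.pi) * x 0 := by
      simp [hq₀, he₁, WithLp.prod_inner_apply, EuclideanSpace.inner_single_left]
    have h5 : 2 * Real.pi * (k.re / (2 * Real.pi) * x 0) = k.re * x 0 := by
      field_simp
    rw [h3, h4, h5]
    apply Complex.ext <;> simp
  simp_rw [hWG] at hzero
  rw [integral_const_mul] at hzero
  exact (mul_ne_zero hz0 (integral_ball_exp_ne_zero hr hkr)) hzero

end FasterPropagation

/-! ### The weighted solution operator. -/

section Resolvent

open scoped FourierTransform InnerProductSpace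

theorem sup_schwartzSeminormFamily_real {V : Type*} [NormedAddCommGroup V] [NormedSpace ℝ V]
    (s : Finset (ℕ × ℕ)) (ϑ : 𝓢(V, ℂ)) :
    s.sup (schwartzSeminormFamily ℝ V ℂ) ϑ = s.sup (schwartzSeminormFamily ℂ V ℂ) ϑ := by
  classical
  induction s using Finset.induction_on with
  | empty => simp
  | insert i s hi ih =>
    rw [Finset.sup_insert, Finset.sup_insert, Seminorm.sup_apply, Seminorm.sup_apply, ih]
    rfl

/-- The symbol of the solution operator with exponential weight `exp (-η t)`, composed with the
time derivative. -/
noncomputable def resolventSymbol (κt : ℂ → ℂ) (η : ℝ) (q : SpaceTime) : ℂ :=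
  Complex.I * freq η q * (waveSymbol κt (mkST η 0) q)⁻¹

variable {κ : ℝ → ℂ} {κt : ℂ → ℂ}

/-- Schwarz–Pick gives `Im κt(z) ≥ a η / ‖z + i‖²` with `a = Im κt(i)`. Without a spatial weight the
symbol is at least the square of this, hence the exponents `4` and `η⁻²`. -/
theorem exists_norm_inv_waveSymbol_le (hκ : IsAttenuationCoefficient κ)
    (hκt : IsHolomorphicContinuation κ κt) :
    ∃ C, 0 ≤ C ∧ ∀ η, 0 < η → ∀ q, waveSymbol κt (mkST η 0) q ≠ 0 ∧
      ‖(waveSymbol κt (mkST η 0) q)⁻¹‖ ≤ C * (1 + ‖q‖) ^ 4 * (1 + η) ^ 4 / η ^ 2 := by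
  set a := (κt Complex.I).im with ha
  have ha0 : 0 < a := hκt.im_pos hκ (by simp)
  refine ⟨(49 / a) ^ 2, by positivity, fun η hη q => ?_⟩
  set X := (1 + ‖q‖) * (1 + η) with hX
  have hX0 : 0 < X := by positivity
  have hfim : (freq η q).im = η := freq_im η q
  have h1 := le_im_of_mapsTo_upperHalfPlane hκt.differentiableOn (fun z hz => hκt.im_pos hκ hz)
    (z := freq η q) (by rwa [hfim])
  rw [hfim, ← ha] at h1
  have h2 : ‖freq η q + Complex.I‖ ≤ 7 * X := by
    refine (norm_add_le _ _).trans ?_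
    rw [Complex.norm_I]
    have h3 := norm_freq_le η q
    rw [abs_of_pos hη] at h3
    have := mul_nonneg (norm_nonneg q) hη.le
    rw [hX]
    nlinarith [norm_nonneg q]
  have h3 : 0 ≤ (κt (freq η q)).im := hκt.im_nonneg _ (by rw [hfim]; exact hη.le)
  have h4 : a * η ≤ (κt (freq η q)).im * (49 * X ^ 2) := by
    refine h1.trans ?_
    have : ‖freq η q + Complex.I‖ ^ 2 ≤ (7 * X) ^ 2 := by gcongr
    nlinarith
  have h5 : a * η / (49 * X ^ 2) ≤ (κt (freq η q)).im := by
    rwa [div_le_iff₀ (by positivity)]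
  have h6 : (a * η / (49 * X ^ 2)) ^ 2 ≤ ‖waveSymbol κt (mkST η 0) q‖ := by
    refine le_trans ?_ (sq_le_norm_waveSymbol _ q (by simpa using h3))
    have hn : ‖(mkST η 0).snd‖ = 0 := norm_zero
    rw [hn, sub_zero]
    gcongr
    exact h5
  have h7 : 0 < (a * η / (49 * X ^ 2)) ^ 2 := by positivity
  refine ⟨norm_pos_iff.1 (h7.trans_le h6), ?_⟩
  rw [norm_inv]
  refine (inv_anti₀ h7 h6).trans (le_of_eq ?_)
  rw [hX]
  field_simp

theorem exists_norm_resolventSymbol_le (hκ : IsAttenuationCoefficient κ)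
    (hκt : IsHolomorphicContinuation κ κt) :
    ∃ C, 0 ≤ C ∧ ∀ η, 0 < η → ∀ q,
      ‖resolventSymbol κt η q‖ ≤ C * (1 + ‖q‖) ^ 5 * (1 + η) ^ 5 / η ^ 2 := by
  obtain ⟨C, hC, h⟩ := exists_norm_inv_waveSymbol_le hκ hκt
  refine ⟨7 * C, by positivity, fun η hη q => ?_⟩
  rw [resolventSymbol, norm_mul, norm_mul, Complex.norm_I, one_mul]
  have h1 : ‖freq η q‖ ≤ 7 * ((1 + ‖q‖) * (1 + η)) := by
    have h3 := norm_freq_le η q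
    rw [abs_of_pos hη] at h3
    have := mul_nonneg (norm_nonneg q) hη.le
    nlinarith [norm_nonneg q]
  calc _ ≤ 7 * ((1 + ‖q‖) * (1 + η)) * (C * (1 + ‖q‖) ^ 4 * (1 + η) ^ 4 / η ^ 2) := by
        gcongr
        exact (h η hη q).2
    _ = _ := by ring

theorem mkST_add_smul (η μ : ℝ) : mkST η 0 + μ • mkST 1 0 = mkST (η + μ) 0 := by
  rw [← WithLp.toLp_smul, ← WithLp.toLp_add]
  simp

theorem shiftSymbol_resolventSymbol (hκ : IsAttenuationCoefficient κ)
    (hκt : IsHolomorphicContinuation κ κt) {η : ℝ} (hη : 0 < η) :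
    ShiftSymbol (mkST 1 0) (fun q μ => resolventSymbol κt (η + μ) q) := by
  obtain ⟨C, hC, hb⟩ := exists_norm_inv_waveSymbol_le hκ hκt
  have h1 := shiftSymbol_freq hη.le (mkST 1 0)
  have h2 := shiftSymbol_waveSymbol hκt hη.le (mkST 1 0) (by simp)
  simp only [mkST_add_smul] at h2
  have h3 := h1.mul (h2.inv (fun q μ hμ => (hb (η + μ) (by positivity) q).1)
    ⟨C * (1 + η) ^ 4 / η ^ 2, 4, by positivity, fun q μ hμ => by
      refine (hb (η + μ) (by positivity) q).2.trans ?_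
      have h5 : 1 + (η + μ) ≤ (1 + η) * (1 + μ) := by nlinarith
      calc _ ≤ C * (1 + ‖q‖) ^ 4 * ((1 + η) * (1 + μ)) ^ 4 / η ^ 2 := by
            gcongr
            linarith
        _ = _ := by ring⟩)
  simpa [resolventSymbol] using h3

theorem hasTemperateGrowth_resolventSymbol (hκ : IsAttenuationCoefficient κ)
    (hκt : IsHolomorphicContinuation κ κt) {η : ℝ} (hη : 0 < η) :
    (resolventSymbol κt η).HasTemperateGrowth := by
  obtain ⟨C, hC, hb⟩ := exists_norm_inv_waveSymbol_le hκ hκt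
  have h1 : (fun q => (waveSymbol κt (mkST η 0) q)⁻¹).HasTemperateGrowth :=
    hasTemperateGrowth_inv (hasTemperateGrowth_waveSymbol hκt _ (by simpa using hη))
      (fun q => (hb η hη q).1) (C := C * (1 + η) ^ 4 / η ^ 2) (N := 4) fun q =>
        (hb η hη q).2.trans_eq (by ring)
  have h2 : (fun ξ : SpaceTime => 2 * Real.pi * ξ.fst).HasTemperateGrowth :=
    ((2 * Real.pi) • WithLp.fstL 2 ℝ ℝ Space3).hasTemperateGrowth
  have h3 : (freq η).HasTemperateGrowth :=
    (Function.Complex.hasTemperateGrowth_ofReal.comp h2).add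
      (Function.HasTemperateGrowth.const _)
  exact ((Function.HasTemperateGrowth.const _).mul h3).mul h1

/-- Integration of a test function against an integrable function `h` on the initial slice. -/
noncomputable def traceCLM (h : Space3 → ℝ) (hh : Integrable h) : 𝓢(SpaceTime, ℂ) →L[ℂ] ℂ :=
  have hi : ∀ ϑ : 𝓢(SpaceTime, ℂ), Integrable (fun x : Space3 => (h x : ℂ) * ϑ (mkST 0 x)) :=
    fun ϑ => hh.ofReal.mul_bdd (c := SchwartzMap.seminorm ℂ 0 0 ϑ)
      (ϑ.continuous.comp (by fun_prop)).aestronglyMeasurable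
      (Eventually.of_forall fun x => ϑ.norm_le_seminorm ℂ _)
  SchwartzMap.mkCLMtoNormedSpace (fun ϑ => ∫ x : Space3, (h x : ℂ) * ϑ (mkST 0 x))
    (fun φ ψ => by
      rw [← integral_add (hi φ) (hi ψ)]
      simp [mul_add])
    (fun a φ => by
      rw [RingHom.id_apply, smul_eq_mul, ← integral_const_mul]
      simp [mul_left_comm])
    ⟨{0}, ∫ x, ‖h x‖, by positivity, fun ϑ => by
      rw [← integral_mul_const]
      refine norm_integral_le_of_norm_le (hh.norm.mul_const _) (Eventually.of_forall fun x => ?_)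
      rw [norm_mul, Complex.norm_real]
      gcongr
      simpa using ϑ.norm_le_seminorm ℂ _⟩

theorem traceCLM_apply (h : Space3 → ℝ) (hh : Integrable h) (ϑ : 𝓢(SpaceTime, ℂ)) :
    traceCLM h hh ϑ = ∫ x : Space3, (h x : ℂ) * ϑ (mkST 0 x) := rfl

/-- The solution of the wave equation with the exponential weight `exp (-η t)`. -/
noncomputable def resolventCLM (κt : ℂ → ℂ) (h : Space3 → ℝ) (hh : Integrable h) (η : ℝ) :
    𝓢(SpaceTime, ℂ) →L[ℂ] ℂ :=
  -(traceCLM h hh ∘L SchwartzMap.fourierMultiplierCLM ℂ (resolventSymbol κt η))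

variable {h : Space3 → ℝ} {hh : Integrable h}

theorem resolventCLM_apply (hκ : IsAttenuationCoefficient κ)
    (hκt : IsHolomorphicContinuation κ κt) {η : ℝ} (hη : 0 < η) (ϑ : 𝓢(SpaceTime, ℂ)) :
    resolventCLM κt h hh η ϑ = -∫ x : Space3, (h x : ℂ) *
      𝓕⁻ (fun q => resolventSymbol κt η q * 𝓕 ϑ q) (mkST 0 x) := by
  have : resolventCLM κt h hh η ϑ =
    -traceCLM h hh (SchwartzMap.fourierMultiplierCLM ℂ (resolventSymbol κt η) ϑ) := rfl
  rw [this, traceCLM_apply]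
  simp_rw [multiplier_apply (hasTemperateGrowth_resolventSymbol hκ hκt hη)]

theorem inner_time (q : SpaceTime) : ⟪mkST 1 0, q⟫_ℝ = q.fst := by
  simp [WithLp.prod_inner_apply]

/-- Independence of `η`, by a contour shift of length `1 - η`. The exponential weight equals `1` on
the slice `t = 0`, where the trace is taken. -/
theorem resolventCLM_expMul (hκ : IsAttenuationCoefficient κ)
    (hκt : IsHolomorphicContinuation κ κt) {η : ℝ} (hη : 0 < η) (hη1 : η ≤ 1)
    (φ : 𝓢(SpaceTime, ℂ)) (hφ : HasCompactSupport φ) :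
    resolventCLM κt h hh η (expMul (η • mkST 1 0) φ hφ) =
      resolventCLM κt h hh 1 (expMul (mkST 1 0) φ hφ) := by
  have e : expMul ((1 - η) • mkST 1 0) (expMul (η • mkST 1 0) φ hφ)
      (hasCompactSupport_expMul _ _ _) = expMul (mkST 1 0) φ hφ := by
    ext x
    simp only [expMul_apply]
    rw [← mul_assoc, ← Complex.exp_add, ← Complex.ofReal_add, ← inner_add_left, ← add_smul]
    simp
  rw [resolventCLM_apply hκ hκt hη, resolventCLM_apply hκ hκt one_pos]
  congr 1
  refine integral_congr_ae (Eventually.of_forall fun x => ?_)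
  have h1 := (shiftSymbol_resolventSymbol hκ hκt hη).fourierInv_expMul
    (expMul (η • mkST 1 0) φ hφ) (hasCompactSupport_expMul _ _ _) (sub_nonneg.2 hη1) (mkST 0 x)
  have hf0 : (mkST 0 x).fst = (0 : ℝ) := rfl
  rw [e, inner_smul_left, inner_time, hf0] at h1
  simp only [add_sub_cancel, mul_zero, Complex.ofReal_zero, Complex.exp_zero, one_mul,
    add_zero] at h1
  simp only [h1]

theorem resolventCLM_eq_zero (hκ : IsAttenuationCoefficient κ)
    (hκt : IsHolomorphicContinuation κ κt) (φ : 𝓢(SpaceTime, ℂ)) (hφ : HasCompactSupport φ)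
    {b : ℝ} (hb : b < 0) (hφb : ∀ q ∈ tsupport φ, q.fst ≤ b) :
    resolventCLM κt h hh 1 φ = 0 := by
  rw [resolventCLM_apply hκ hκt one_pos, neg_eq_zero]
  refine integral_eq_zero_of_ae (Eventually.of_forall fun x => ?_)
  have h1 := (shiftSymbol_resolventSymbol hκ hκt one_pos).fourierInv_eq_zero φ hφ (b := b)
    (fun q hq => by
      rw [inner_time]
      exact hφb q hq) (y := mkST 0 x) (by rwa [inner_time])
  simp only [add_zero] at h1
  simp [h1]

/-- The inverse symbol cancels. What remains, `i * freq 1`, is the time derivative conjugated by the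
weight, and the weight is `1` at `t = 0`. -/
theorem resolventCLM_waveOp (hκ : IsAttenuationCoefficient κ)
    (hκt : IsHolomorphicContinuation κ κt) (ϑ : 𝓢(SpaceTime, ℂ)) (hϑ : HasCompactSupport ϑ) :
    resolventCLM κt h hh 1 (waveOp κt (mkST 1 0) (expMul (mkST 1 0) ϑ hϑ)) =
      -sourcePairing h ϑ := by
  obtain ⟨C, hC, hb⟩ := exists_norm_inv_waveSymbol_le hκ hκt
  rw [resolventCLM_apply hκ hκt one_pos, sourcePairing]
  congr 1
  refine integral_congr_ae (Eventually.of_forall fun x => ?_)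
  have h1 := (shiftSymbol_freq le_rfl (mkST 1 0)).fourierInv_expMul ϑ hϑ zero_le_one (mkST 0 x)
  have h2 : ∀ q, resolventSymbol κt 1 q *
      𝓕 (waveOp κt (mkST 1 0) (expMul (mkST 1 0) ϑ hϑ)) q =
      Complex.I * freq 1 q * 𝓕 (expMul (mkST 1 0) ϑ hϑ) q := fun q => by
    rw [waveOp, fourier_multiplier_apply (hasTemperateGrowth_waveSymbol hκt _ (by simp)),
      resolventSymbol, mul_assoc, inv_mul_cancel_left₀ (hb 1 one_pos q).1]
  have hf0 : (mkST 0 x).fst = (0 : ℝ) := rfl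
  simp only [one_smul, zero_add, one_mul, zero_mul, inner_time, hf0, Complex.ofReal_zero,
    Complex.exp_zero] at h1
  dsimp only
  rw [(hasDerivAt_time ϑ x 0).deriv, lineDeriv_time_eq_fourierInv, ← h1]
  simp_rw [h2]
  rfl

theorem exists_norm_resolventCLM_le (hκ : IsAttenuationCoefficient κ)
    (hκt : IsHolomorphicContinuation κ κt) (hh : Integrable h) :
    ∃ C, 0 ≤ C ∧ ∀ η, 0 < η → η ≤ 1 → ∀ (ψ : 𝓢(SpaceTime, ℂ)) (D : ℝ), 0 ≤ D →
      (∀ q, (1 + ‖q‖) ^ (5 + (Module.finrank ℝ SpaceTime + 1)) * ‖𝓕 ψ q‖ ≤ D) →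
      ‖resolventCLM κt h hh η ψ‖ ≤ C * (D / η ^ 2) := by
  obtain ⟨C, hC, hb⟩ := exists_norm_resolventSymbol_le hκ hκt
  set I₀ : ℝ := ∫ q : SpaceTime, decayWeight q with hI₀
  have hI₀0 : 0 ≤ I₀ := integral_nonneg fun q => decayWeight_nonneg q
  refine ⟨(∫ x, ‖h x‖) * (C * 2 ^ 5 * I₀), by positivity, fun η hη hη1 ψ D hD0 hD => ?_⟩
  rw [resolventCLM_apply hκ hκt hη, norm_neg, mul_assoc, ← integral_mul_const]
  refine norm_integral_le_of_norm_le (hh.norm.mul_const _) (Eventually.of_forall fun x => ?_)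
  rw [norm_mul, Complex.norm_real]
  gcongr
  rw [Real.fourierInv_eq']
  have e : C * 2 ^ 5 * I₀ * (D / η ^ 2) =
      ∫ q : SpaceTime, C * 2 ^ 5 * (D / η ^ 2) * decayWeight q := by
    rw [integral_const_mul, ← hI₀]
    ring
  rw [e]
  refine norm_integral_le_of_norm_le (integrable_decayWeight.const_mul _)
    (Eventually.of_forall fun q => ?_)
  rw [norm_smul, Complex.norm_exp_ofReal_mul_I, one_mul, norm_mul]
  have h1 := hD q
  rw [pow_add] at h1
  have h2 : (1 + ‖q‖) ^ 5 * ‖𝓕 ψ q‖ ≤ D * decayWeight q := by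
    unfold decayWeight
    rw [← div_eq_mul_inv, le_div_iff₀ (by positivity)]
    linarith
  calc _ ≤ (C * (1 + ‖q‖) ^ 5 * 2 ^ 5 / η ^ 2) * ‖𝓕 ψ q‖ := by
        gcongr
        refine (hb η hη q).trans ?_
        gcongr
        linarith
    _ = C * 2 ^ 5 / η ^ 2 * ((1 + ‖q‖) ^ 5 * ‖𝓕 ψ q‖) := by ring
    _ ≤ C * 2 ^ 5 / η ^ 2 * (D * decayWeight q) := by gcongr
    _ = _ := by ring

end Resolvent

/-! ### Construction of a causal tempered solution. -/

section CausalSolution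

open scoped FourierTransform InnerProductSpace

theorem cutoff_one_sub (s : ℝ) : cutoff (1 - s) = 1 - cutoff s := by
  have h : Real.smoothTransition (1 - s) = 1 - Real.smoothTransition s := by
    have h1 := (Real.smoothTransition.pos_denom s).ne'
    have h2 := (Real.smoothTransition.pos_denom (1 - s)).ne'
    rw [sub_sub_cancel] at h2
    rw [Real.smoothTransition, Real.smoothTransition, sub_sub_cancel]
    field_simp
    ring
  rw [cutoff, cutoff, h]
  push_cast
  rfl

/-- With `s = t - n` this makes the slab cutoffs differences of consecutive truncations, so that
their sum telescopes. -/
theorem cutoff_mul_cutoff (s : ℝ) : cutoff (2 - s) * cutoff s = cutoff (2 - s) - cutoff (1 - s) := by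
  rcases le_total 1 s with h | h
  · rw [cutoff_of_one_le h, cutoff_of_nonpos (by linarith : 1 - s ≤ 0)]
    ring
  · rw [cutoff_of_one_le (by linarith : 1 ≤ 2 - s), cutoff_one_sub]
    ring

/-- An exponential weight in time, cut off for large times. -/
noncomputable def rampWeight (b : ℝ) (q : SpaceTime) : ℂ :=
  cutoff (b + 1 - q.fst) * Complex.exp (q.fst : ℝ)

/-- An exponential weight in time, localized in the slab `n ≤ t ≤ n + 2`. -/
noncomputable def slabWeight (n : ℕ) (q : SpaceTime) : ℂ :=
  cutoff (n + 2 - q.fst) * cutoff (q.fst - n) * Complex.exp ((1 / (n + 1) * q.fst : ℝ) : ℂ)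

theorem derivBound_cutoff_sub_fst {ι : Type*} (a : ι → ℝ) :
    DerivBound (fun i (q : SpaceTime) => cutoff (a i - q.fst))
      (fun i q => Set.indicator (Set.Ici 0) 1 (a i - q.fst)) := by
  have h := derivBound_cutoff.comp_affine (fun _ : ι => ())
    (fun _ => -WithLp.fstL 2 ℝ ℝ Space3) a (fun _ => le_rfl)
  simpa [neg_add_eq_sub] using h

theorem derivBound_cutoff_fst_sub {ι : Type*} (a : ι → ℝ) :
    DerivBound (fun i (q : SpaceTime) => cutoff (q.fst - a i))
      (fun i q => Set.indicator (Set.Ici 0) 1 (q.fst - a i)) := by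
  have h := derivBound_cutoff.comp_affine (fun _ : ι => ())
    (fun _ => WithLp.fstL 2 ℝ ℝ Space3) (fun i => -a i) (fun _ => le_rfl)
  simpa [← sub_eq_add_neg] using h

theorem derivBound_exp_fst {ι : Type*} {η : ι → ℝ} (hη : ∀ i, |η i| ≤ 1) :
    DerivBound (fun i (q : SpaceTime) => Complex.exp ((η i * q.fst : ℝ) : ℂ))
      (fun i q => Real.exp (η i * q.fst)) := by
  have h := DerivBound.exp_linear.comp_affine (fun _ : ι => ())
    (fun i => η i • WithLp.fstL 2 ℝ ℝ Space3) (fun _ => 0)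
    (B := ‖WithLp.fstL 2 ℝ ℝ Space3‖) (fun i => by
      rw [norm_smul]
      exact mul_le_of_le_one_left (norm_nonneg _) (hη i))
  simpa using h

theorem hasTemperateGrowth_rampWeight (b : ℝ) : (rampWeight b).HasTemperateGrowth := by
  have h := (derivBound_cutoff_sub_fst (fun _ : Unit => b + 1)).mul
    (derivBound_exp_fst (η := fun _ : Unit => 1) (by simp))
  have h2 := h.hasTemperateGrowth () (C := Real.exp (b + 1)) fun q => by
    simp only [Set.indicator, Set.mem_Ici, Pi.one_apply, one_mul]
    split_ifs with hq
    · rw [one_mul, Real.exp_le_exp]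
      linarith
    · rw [zero_mul]
      positivity
  have e : rampWeight b = fun q => cutoff (b + 1 - q.fst) * Complex.exp (q.fst : ℝ) := rfl
  rw [e]
  simpa using h2

theorem derivBound_slabWeight : DerivBound slabWeight
    (fun n q => Set.indicator (Set.Ici 0) 1 (n + 2 - q.fst) *
      Set.indicator (Set.Ici 0) 1 (q.fst - n) * Real.exp (1 / (n + 1) * q.fst)) :=
  ((derivBound_cutoff_sub_fst (fun n : ℕ => (n : ℝ) + 2)).mul
    (derivBound_cutoff_fst_sub (fun n : ℕ => (n : ℝ)))).mul
    (derivBound_exp_fst (η := fun n : ℕ => 1 / ((n : ℝ) + 1)) fun n => by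
      rw [abs_of_pos (by positivity), div_le_one (by positivity)]
      simp)

/-- On the slab `t / (n + 1) ≤ 2` and `n + 1 ≤ 1 + ‖q‖`. Of the four powers of `n + 1` gained, two
pay for the loss `η⁻² = (n + 1)²` and two make the sum converge. -/
theorem slabWeight_bound_le (n : ℕ) (q : SpaceTime) :
    Set.indicator (Set.Ici 0) 1 (n + 2 - q.fst) *
      Set.indicator (Set.Ici 0) 1 (q.fst - n) * Real.exp (1 / (n + 1) * q.fst) ≤
      Real.exp 2 / (n + 1) ^ 4 * (1 + ‖q‖) ^ 4 := by
  simp only [Set.indicator, Set.mem_Ici, Pi.one_apply]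
  split_ifs with h1 h2
  · have h3 : 1 / ((n : ℝ) + 1) * q.fst ≤ 2 := by
      rw [div_mul_eq_mul_div, one_mul, div_le_iff₀ (by positivity)]
      have : (0 : ℝ) ≤ n := by positivity
      linarith
    have h4 : (n : ℝ) + 1 ≤ 1 + ‖q‖ := by linarith [norm_fst_le q, le_abs_self q.fst]
    rw [one_mul, one_mul]
    refine (Real.exp_le_exp.2 h3).trans ?_
    rw [div_mul_eq_mul_div, le_div_iff₀ (by positivity)]
    gcongr
  all_goals
    simp only [mul_zero, zero_mul]
    positivity

theorem hasTemperateGrowth_slabWeight (n : ℕ) : (slabWeight n).HasTemperateGrowth := by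
  refine derivBound_slabWeight.hasTemperateGrowth n (C := Real.exp 2) fun q => ?_
  simp only [Set.indicator, Set.mem_Ici, Pi.one_apply]
  split_ifs with h1 h2
  · have h3 : 1 / ((n : ℝ) + 1) * q.fst ≤ 2 := by
      rw [div_mul_eq_mul_div, one_mul, div_le_iff₀ (by positivity)]
      have : (0 : ℝ) ≤ n := by positivity
      linarith
    rw [one_mul, one_mul]
    gcongr
  all_goals
    simp only [mul_zero, zero_mul]
    positivity

/-- Sums of tempered distributions which converge with respect to a fixed seminorm. -/
theorem exists_clm_hasSum {V : Type*} [NormedAddCommGroup V] [NormedSpace ℝ V]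
    {P : ℕ → 𝓢(V, ℂ) →L[ℂ] ℂ} {u : ℕ → ℝ} (hu : Summable u) (hu0 : ∀ n, 0 ≤ u n)
    {s : Finset (ℕ × ℕ)}
    (hP : ∀ n ϑ, ‖P n ϑ‖ ≤ u n * s.sup (schwartzSeminormFamily ℝ V ℂ) ϑ) :
    ∃ T : 𝓢(V, ℂ) →L[ℂ] ℂ, ∀ ϑ, HasSum (fun n => P n ϑ) (T ϑ) := by
  have hs : ∀ ϑ, Summable fun n => P n ϑ := fun ϑ =>
    Summable.of_norm_bounded (hu.mul_right _) fun n => hP n ϑ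
  refine ⟨SchwartzMap.mkCLMtoNormedSpace (fun ϑ => ∑' n, P n ϑ) (fun φ ψ => ?_) (fun a φ => ?_)
    ⟨s, ∑' n, u n, tsum_nonneg hu0, fun ϑ => ?_⟩, fun ϑ => (hs ϑ).hasSum⟩
  · simp_rw [map_add]
    exact (hs φ).tsum_add (hs ψ)
  · simp_rw [map_smul, smul_eq_mul]
    exact tsum_mul_left
  · rw [← sup_schwartzSeminormFamily_real, ← tsum_mul_right]
    exact tsum_of_norm_bounded (hu.mul_right _).hasSum fun n => hP n ϑ

variable {κ : ℝ → ℂ} {κt : ℂ → ℂ} {h : Space3 → ℝ} {hh : Integrable h}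

theorem exists_norm_resolventCLM_slabWeight_le (hκ : IsAttenuationCoefficient κ)
    (hκt : IsHolomorphicContinuation κ κt) (hh : Integrable h) :
    ∃ (s : Finset (ℕ × ℕ)) (C : ℝ), 0 ≤ C ∧ ∀ (n : ℕ) (ϑ : 𝓢(SpaceTime, ℂ)),
      ‖resolventCLM κt h hh (1 / (n + 1)) (SchwartzMap.smulLeftCLM ℂ (slabWeight n) ϑ)‖ ≤
        C / (n + 1) ^ 2 * s.sup (schwartzSeminormFamily ℝ SpaceTime ℂ) ϑ := by
  obtain ⟨C₁, hC₁, h₁⟩ := exists_norm_resolventCLM_le hκ hκt hh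
  obtain ⟨s, C₂, hC₂, h₂⟩ := exists_norm_fourier_mul_le derivBound_slabWeight Set.univ
    (fun n => Real.exp 2 / ((n : ℝ) + 1) ^ 4) 4 (fun n q _ => slabWeight_bound_le n q)
    (5 + (Module.finrank ℝ SpaceTime + 1))
  refine ⟨s, C₁ * C₂ * Real.exp 2, by positivity, fun n ϑ => ?_⟩
  have hs : 0 ≤ s.sup (schwartzSeminormFamily ℝ SpaceTime ℂ) ϑ := apply_nonneg _ _
  refine (h₁ _ (by positivity) (by
    rw [div_le_one (by positivity)]
    simp) _ _ (by positivity) (h₂ n ϑ _ (Set.subset_univ _) fun x => by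
      rw [SchwartzMap.smulLeftCLM_apply_apply (hasTemperateGrowth_slabWeight n),
        smul_eq_mul])).trans (le_of_eq ?_)
  rw [abs_of_pos (by positivity)]
  field_simp

theorem resolventCLM_eq_of_forall_eq (hκ : IsAttenuationCoefficient κ)
    (hκt : IsHolomorphicContinuation κ κt) {η : ℝ} (hη : 0 < η) (hη1 : η ≤ 1)
    {φ ψ : 𝓢(SpaceTime, ℂ)} (hφ : HasCompactSupport φ)
    (h1 : ∀ q, ψ q = Complex.exp ((η * q.fst : ℝ) : ℂ) * φ q) :
    resolventCLM κt h hh η ψ = resolventCLM κt h hh 1 (expMul (mkST 1 0) φ hφ) := by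
  rw [← resolventCLM_expMul hκ hκt hη hη1]
  congr 1
  ext q
  rw [h1, expMul_apply, inner_smul_left, inner_time]
  rfl

theorem exists_truncation (ϑ : 𝓢(SpaceTime, ℂ)) (hϑ : HasCompactSupport ϑ) :
    ∃ u : ℕ → 𝓢(SpaceTime, ℂ), (∀ n, HasCompactSupport (u n)) ∧
      ∀ (n : ℕ) q, u n q = cutoff (n + 1 - q.fst) * ϑ q := by
  have hcs : ∀ n : ℕ, HasCompactSupport fun q : SpaceTime => cutoff (n + 1 - q.fst) * ϑ q :=
    fun n => hϑ.mul_left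
  exact ⟨fun n => (hcs n).toSchwartzMap
    (((derivBound_cutoff_sub_fst (fun n : ℕ => (n : ℝ) + 1)).smooth n).mul (ϑ.smooth ⊤)), hcs,
    fun n q => rfl⟩

/-- The weight `exp t` is not tempered for large times. Since the functional does not depend on `η`,
the slab `n ≤ t ≤ n + 2` can be treated with `η = 1 / (n + 1)`, for which the weight is bounded
there. -/
theorem exists_clm_eq_resolventCLM_expMul (hκ : IsAttenuationCoefficient κ)
    (hκt : IsHolomorphicContinuation κ κt) (hh : Integrable h) :
    ∃ T : 𝓢(SpaceTime, ℂ) →L[ℂ] ℂ, ∀ (ϑ : 𝓢(SpaceTime, ℂ)) (hϑ : HasCompactSupport ϑ),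
      T ϑ = resolventCLM κt h hh 1 (expMul (mkST 1 0) ϑ hϑ) := by
  obtain ⟨s, C, hC, hb⟩ := exists_norm_resolventCLM_slabWeight_le hκ hκt hh
  have hu : Summable fun n : ℕ => C / ((n : ℝ) + 1) ^ 2 := by
    have h1 := (summable_nat_add_iff 1).2 (Real.summable_one_div_nat_pow.2 one_lt_two)
    refine (h1.mul_left C).congr fun n => ?_
    push_cast
    ring
  have hb' : ∀ (n : ℕ) (ϑ : 𝓢(SpaceTime, ℂ)), ‖(resolventCLM κt h hh (1 / (n + 1)) ∘L
      SchwartzMap.smulLeftCLM ℂ (slabWeight n)) ϑ‖ ≤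
      C / (n + 1) ^ 2 * s.sup (schwartzSeminormFamily ℝ SpaceTime ℂ) ϑ := hb
  obtain ⟨T, hT⟩ := exists_clm_hasSum hu (fun n => by positivity) hb'
  refine ⟨resolventCLM κt h hh 1 ∘L SchwartzMap.smulLeftCLM ℂ (rampWeight 0) + T, fun ϑ hϑ => ?_⟩
  obtain ⟨u, hucs, hu_apply⟩ := exists_truncation ϑ hϑ
  obtain ⟨a, ha⟩ : ∃ a : ℕ → ℂ, ∀ n, a n =
      resolventCLM κt h hh 1 (expMul (mkST 1 0) (u n) (hucs n)) := ⟨_, fun _ => rfl⟩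
  have h0 : resolventCLM κt h hh 1 (SchwartzMap.smulLeftCLM ℂ (rampWeight 0) ϑ) = a 0 := by
    rw [ha]
    refine resolventCLM_eq_of_forall_eq hκ hκt one_pos le_rfl (hucs 0) fun q => ?_
    rw [SchwartzMap.smulLeftCLM_apply_apply (hasTemperateGrowth_rampWeight 0), hu_apply,
      rampWeight, smul_eq_mul]
    simp
    ring
  have hn : ∀ n : ℕ, resolventCLM κt h hh (1 / (n + 1))
      (SchwartzMap.smulLeftCLM ℂ (slabWeight n) ϑ) = a (n + 1) - a n := fun n => by
    have hd : HasCompactSupport (u (n + 1) - u n) := (hucs (n + 1)).sub (hucs n)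
    have he : expMul (mkST 1 0) (u (n + 1) - u n) hd =
        expMul (mkST 1 0) (u (n + 1)) (hucs (n + 1)) - expMul (mkST 1 0) (u n) (hucs n) := by
      ext q
      rw [sub_apply, expMul_apply, expMul_apply, expMul_apply, sub_apply, mul_sub]
    rw [ha, ha, ← map_sub, ← he]
    refine resolventCLM_eq_of_forall_eq hκ hκt (by positivity) (by
      rw [div_le_one (by positivity)]
      simp) hd ?_
    · intro q
      rw [SchwartzMap.smulLeftCLM_apply_apply (hasTemperateGrowth_slabWeight n), sub_apply,
        hu_apply, hu_apply, slabWeight, smul_eq_mul]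
      have h1 := cutoff_mul_cutoff (q.fst - n)
      have e1 : (2 : ℝ) - (q.fst - n) = n + 2 - q.fst := by ring
      have e2 : (1 : ℝ) - (q.fst - n) = n + 1 - q.fst := by ring
      have e3 : ((n + 1 : ℕ) : ℝ) + 1 - q.fst = n + 2 - q.fst := by
        push_cast
        ring
      rw [e1, e2] at h1
      rw [h1, e3]
      ring
  have hlim := (hT ϑ).tendsto_sum_nat
  simp only [ContinuousLinearMap.comp_apply, hn, Finset.sum_range_sub] at hlim
  obtain ⟨B, hB⟩ := hϑ.isCompact.exists_bound_of_continuousOn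
    (f := fun q : SpaceTime => q.fst) (WithLp.fstL 2 ℝ ℝ Space3).continuous.continuousOn
  -- The truncations agree with `ϑ` once `n` exceeds the times in its support.
  have hev : ∀ᶠ n in atTop, a n - a 0 =
      resolventCLM κt h hh 1 (expMul (mkST 1 0) ϑ hϑ) - a 0 := by
    filter_upwards [eventually_ge_atTop ⌈B⌉₊] with n hnB
    have he : expMul (mkST 1 0) (u n) (hucs n) = expMul (mkST 1 0) ϑ hϑ := by
      ext q
      rw [expMul_apply, expMul_apply, hu_apply]
      by_cases hq : q ∈ tsupport ϑ
      · have h1 := (le_abs_self _).trans (hB q hq)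
        have h2 : B ≤ n := (Nat.le_ceil B).trans (by exact_mod_cast hnB)
        rw [cutoff_of_one_le (by linarith), one_mul]
      · rw [image_eq_zero_of_notMem_tsupport hq, mul_zero, mul_zero]
    rw [ha n, he]
  have h3 := tendsto_nhds_unique hlim ((tendsto_congr' hev).2 tendsto_const_nhds)
  rw [add_apply, ContinuousLinearMap.comp_apply, h0, h3]
  ring

/-- Existence of a causal solution of the attenuated wave equation. -/
theorem exists_isCausalSolution (hκ : IsAttenuationCoefficient κ)
    (hκt : IsHolomorphicContinuation κ κt) (hh : Integrable h) :
    ∃ p : 𝓢'(SpaceTime, ℂ), IsCausalSolution κ h p := by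
  obtain ⟨T, hT⟩ := exists_clm_eq_resolventCLM_expMul hκ hκt hh
  let p : 𝓢'(SpaceTime, ℂ) := ContinuousLinearMap.toPointwiseConvergenceCLM _ _ _ _ T
  have hpT : ∀ ϑ, p ϑ = T ϑ := fun ϑ => rfl
  -- The operator destroys compact support but does not move supports to later times. For supports
  -- bounded above in time the single weight `η = 1` is still available.
  have hramp : ∀ (b : ℝ) (ϑ : 𝓢(SpaceTime, ℂ)), tsupport ϑ ⊆ {q | q.fst ≤ b} →
      T ϑ = resolventCLM κt h hh 1 (SchwartzMap.smulLeftCLM ℂ (rampWeight b) ϑ) := by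
    intro b ϑ hϑ
    obtain ⟨u, huc, hus, hlim⟩ := exists_tendsto_hasCompactSupport ϑ
    refine tendsto_nhds_unique ((T.continuous.tendsto ϑ).comp hlim) ?_
    refine ((((resolventCLM κt h hh 1) ∘L
      SchwartzMap.smulLeftCLM ℂ (rampWeight b)).continuous.tendsto ϑ).comp hlim).congr fun n => ?_
    rw [Function.comp_apply, Function.comp_apply, hT _ (huc n), ContinuousLinearMap.comp_apply]
    congr 1
    ext q
    rw [SchwartzMap.smulLeftCLM_apply_apply (hasTemperateGrowth_rampWeight b), expMul_apply,
      inner_time, rampWeight, smul_eq_mul]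
    by_cases hq : q ∈ tsupport (u n)
    · have h1 : q.fst ≤ b := hϑ (hus n hq)
      rw [cutoff_of_one_le (by linarith), one_mul]
    · simp [image_eq_zero_of_notMem_tsupport hq]
  refine ⟨p, ⟨fun ϑ => ?_, fun q hq => ?_⟩⟩
  · rw [attenuationOp_sub_spatialLaplacian hκ hκt]
    have hsp : (fun ϑ => -sourcePairing h ϑ) = fun ϑ : 𝓢(SpaceTime, ℂ) =>
        -traceCLM h hh (LineDeriv.lineDerivOpCLM ℂ 𝓢(SpaceTime, ℂ) (mkST 1 0) ϑ) := by
      funext ϑ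
      rw [traceCLM_apply, sourcePairing]
      congr 1
      refine integral_congr_ae (Eventually.of_forall fun x => ?_)
      dsimp only
      rw [(hasDerivAt_time ϑ x 0).deriv]
      rfl
    refine eq_of_eq_on_hasCompactSupport (p := fun ϑ => p (waveOp κt 0 ϑ))
      (q := fun ϑ => -sourcePairing h ϑ)
      ((continuous_temperedDistribution p).comp (waveOp κt 0).continuous)
      (by
        rw [hsp]
        exact ((traceCLM h hh) ∘L
          (LineDeriv.lineDerivOpCLM ℂ 𝓢(SpaceTime, ℂ) (mkST 1 0))).continuous.neg) ?_ ϑ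
    intro ϑ hϑ
    obtain ⟨b, hb⟩ := hϑ.isCompact.exists_bound_of_continuousOn
      (f := fun q : SpaceTime => q.fst) (WithLp.fstL 2 ℝ ℝ Space3).continuous.continuousOn
    have hz : ∀ y : SpaceTime, b < y.fst → waveOp κt 0 ϑ y = 0 := fun y hy => by
      have h1 := (shiftSymbol_waveSymbol hκt le_rfl (mkST 1 0) (by simp)).fourierInv_eq_zero ϑ hϑ
        (b := b) (fun q hq => by
          rw [inner_time]
          exact (le_abs_self _).trans (hb q hq)) (y := y) (by rwa [inner_time])
      have e0 : mkST 0 0 = (0 : SpaceTime) := rfl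
      rw [waveOp, multiplier_apply (hasTemperateGrowth_waveSymbol_zero hκ hκt)]
      simpa [e0] using h1
    have hts : tsupport (waveOp κt 0 ϑ) ⊆ {q : SpaceTime | q.fst ≤ b} :=
      closure_minimal (fun q hq => le_of_not_gt fun hqb => hq (hz q hqb))
        (isClosed_le (WithLp.fstL 2 ℝ ℝ Space3).continuous continuous_const)
    rw [hpT, hramp b _ hts, ← resolventCLM_waveOp (hh := hh) hκ hκt ϑ hϑ]
    congr 1
    ext y
    rw [waveOp_expMul hκ hκt _ (by simp), inner_time,
      SchwartzMap.smulLeftCLM_apply_apply (hasTemperateGrowth_rampWeight b), smul_eq_mul,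
      rampWeight]
    rcases le_or_gt y.fst b with hy | hy
    · rw [cutoff_of_one_le (by linarith), one_mul]
    · rw [hz y hy, mul_zero, mul_zero]
  · by_contra hneg
    rw [Set.mem_ofPred_eq, not_le] at hneg
    refine (Distribution.notMem_dsupport_iff q).2 ⟨{q : SpaceTime | q.fst < 0}, fun ϑ hϑ => ?_,
      isOpen_lt (WithLp.fstL 2 ℝ ℝ Space3).continuous continuous_const, hneg⟩ hq
    obtain ⟨u, huc, hus, hlim⟩ := exists_tendsto_hasCompactSupport ϑ
    refine tendsto_nhds_unique ((T.continuous.tendsto ϑ).comp hlim) ?_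
    refine tendsto_const_nhds.congr fun n => ?_
    rw [Function.comp_apply, hT _ (huc n)]
    -- Compactness turns support in `t < 0` into a strictly negative bound, which leaves a gap to
    -- the slice `t = 0`.
    obtain ⟨b, hb, hub⟩ : ∃ b < 0, ∀ q ∈ tsupport (u n), q.fst ≤ b := by
      rcases (tsupport (u n)).eq_empty_or_nonempty with he | hne
      · exact ⟨-1, by norm_num, by simp [he]⟩
      · obtain ⟨q', hq', hmax⟩ := (huc n).isCompact.exists_isMaxOn hne
          (f := fun q : SpaceTime => q.fst) (WithLp.fstL 2 ℝ ℝ Space3).continuous.continuousOn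
        exact ⟨q'.fst, hϑ (hus n hq'), fun q hq => hmax hq⟩
    exact (resolventCLM_eq_zero hκ hκt _ (hasCompactSupport_expMul _ _ _) hb fun q hq =>
      hub q (tsupport_expMul_subset _ _ _ hq)).symm

end CausalSolution

/-! ### The source for part (ii). -/

section

variable {κ : ℝ → ℂ} {κt : ℂ → ℂ} {c : ℝ}

theorem isClosed_essSupport (h : Space3 → ℝ) : IsClosed (essSupport h) := by
  rw [← isOpen_compl_iff, isOpen_iff_mem_nhds]
  intro x hx
  simp only [essSupport, Set.mem_compl_iff, Set.mem_ofPred_eq, not_forall, not_not] at hx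
  obtain ⟨U, hU, hU0⟩ := hx
  filter_upwards [eventually_mem_nhds_iff.2 hU] with y hy hy'
  exact hy' U hy hU0

theorem essSupport_subset {h : Space3 → ℝ} {K : Set Space3} (hK : IsClosed K)
    (hh : ∀ x, x ∉ K → h x = 0) : essSupport h ⊆ K := by
  intro x hx
  by_contra hxK
  refine hx Kᶜ (hK.isOpen_compl.mem_nhds hxK) ?_
  exact (ae_restrict_iff' hK.measurableSet.compl).2 (Eventually.of_forall fun y hy => hh y hy)

/-- The solution propagates faster than with speed `c` if the continuation of the attenuation
coefficient has too small an imaginary part at some point. -/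
theorem propagatesFasterThan (hκ : IsAttenuationCoefficient κ)
    (hκt : IsHolomorphicContinuation κ κt) (hc : 0 < c) {z : ℂ} (hz : 0 < z.im)
    (hlt : (κt z).im < z.im / c) : PropagatesFasterThan κ c := by
  set r : ℝ := (1 + ‖κt z‖)⁻¹ with hr
  have hr0 : 0 < r := by positivity
  have hkr : ‖κt z‖ * r ≤ 1 := by
    rw [hr, ← div_eq_mul_inv, div_le_one (by positivity)]
    linarith
  have hes : essSupport (Set.indicator (Metric.ball (0 : Space3) r) 1) ⊆
      Metric.closedBall 0 r :=
    essSupport_subset Metric.isClosed_closedBall fun x hx =>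
      Set.indicator_of_notMem (fun hx' => hx (Metric.ball_subset_closedBall hx')) _
  have hint : Integrable (Set.indicator (Metric.ball (0 : Space3) r) (1 : Space3 → ℝ)) :=
    (integrable_indicator_iff measurableSet_ball).2 (integrableOn_const measure_ball_lt_top.ne)
  obtain ⟨p, hp⟩ := exists_isCausalSolution hκ hκt hint
  -- The radius is `2 * r` because the essential support is only known to lie in the closed ball of
  -- radius `r`, and it has to fit into an open one.
  refine ⟨Set.indicator (Metric.ball 0 r) 1, 2 * r, ?_,
    (isCompact_closedBall 0 r).of_isClosed_subset (isClosed_essSupport _) hes, by positivity,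
    hes.trans (Metric.closedBall_subset_ball (by linarith)), p, hp,
    not_dsupport_subset_cone hκ hκt hc hz hlt hr0 hkr (by linarith) hp⟩
  exact memLp_indicator_const 2 measurableSet_ball (1 : ℝ) (Or.inr measure_ball_lt_top.ne)

end

end AttenuatedWave

theorem mainTheorem8 (κ : ℝ → ℂ) (κt : ℂ → ℂ)
    (hκ : AttenuatedWave.IsAttenuationCoefficient κ)
    (hκt : AttenuatedWave.IsHolomorphicContinuation κ κt)
    (c : ℝ) (hc : 0 < c) :
    ((∀ z : ℂ, 0 ≤ z.im → 0 ≤ (κt z - z / (c : ℂ)).im) →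
      AttenuatedWave.PropagatesWithSpeed κ c) ∧
    ((∃ z : ℕ → ℂ,
        (∃ η₁ : ℝ, 0 < η₁ ∧ ∀ l : ℕ, η₁ ≤ (z l).im) ∧
        Tendsto (fun l : ℕ => ‖z l‖) atTop atTop ∧
        (∃ δ : ℝ, 0 < δ ∧ ∀ l : ℕ, (κt (z l) - z l / (c : ℂ)).im ≤ -δ * ‖z l‖)) →
      AttenuatedWave.PropagatesFasterThan κ c) := by
  refine ⟨AttenuatedWave.propagatesWithSpeed hκ hκt hc, ?_⟩
  rintro ⟨z, ⟨η₁, hη₁, hz⟩, -, δ, hδ, hlt⟩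
  -- The point `z 0` already has `Im κt z < Im z / c`, since `δ ‖z 0‖ > 0`.
  have hz0 : 0 < (z 0).im := hη₁.trans_le (hz 0)
  refine AttenuatedWave.propagatesFasterThan hκ hκt hc hz0 ?_
  have h1 := hlt 0
  rw [Complex.sub_im, Complex.div_ofReal_im] at h1
  have h2 : 0 < ‖z 0‖ := hz0.trans_le ((le_abs_self _).trans (Complex.abs_im_le_norm _))
  nlinarith [mul_pos hδ h2]
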